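/- Consider a mobile wireless sensor network in the plane: a data sink, $m$ targets $t$ with known positions and weights $t.\omega$, $n$ mobile sensors with known positions, a sensing range $R_s\ge 0$ and a transmission range $R_t>0$, where $(m,n)\neq(0,0)$. A point covers a target if their distance is at most $R_s$. Let $X$ be the set of the following reference points: the location of each target $t$, with $P_p=\{t\}$, and the (at most two) intersection points of the circles of radius $R_s$ centered at any two targets at distinct positions, with $P_p$ the set of all targets covered by $p$. The Steiner-tree-based algorithm (STBA) maintains a set $L$ of potential points and a set $Y\subseteq X$ of selected reference points, both initially empty. For $N=L\cup\{\mathrm{sink}\}$, let $\eta_N(p)$ be the distance from $p$ to the closest point of $N$, let $\phi_N(p)=\lceil \eta_N(p)/R_t\rceil$ if $p$ is an intersection point and $\phi_N(p)=\max(0,\lceil(\eta_N(p)-R_s)/R_t\rceil)$ otherwise, and let $\rho_N(p)=\infty$ if $\phi_N(p)=0$ and otherwise $\rho_N(p)=\Omega_N(P_p)/\phi_N(p)$, where $\Omega_N(P_p)$ is the total weight of the targets in $P_p$ not covered by $L$. While some target is not covered by $L$, the STBA does the following. (a) While some target is not covered by $L$ and there is $p\in X$ with $P_p\not\subseteq\bigcup_{q\in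 Y}P_q$ and $\phi_N(p)\le n-|L|$: select such a $p$ with maximum $\rho_N(p)$, ties being broken by smaller $\eta_N(p)$; add to $L$ points on the straight line to $p$ from the closest point of $N$, one every distance $R_t$, until $p$ is reached or all targets of $P_p$ are covered by $N$ and the added points; add $p$ to $Y$. (b) Compute a new family $L'$ of potential points from $Y$: construct the Voronoi diagram of $Y\cup\{\mathrm{sink}\}$; let $F$ consist of the Fermat points of all triples of sites that are pairwise neighbors (their cells share a boundary edge); in the complete graph on $Y\cup\{\mathrm{sink}\}\cup F$ with Euclidean edge lengths and node weights zero, compute a tree that spans the terminals $Y\cup\{\mathrm{sink}\}$ by the modified Klein–Ravi algorithm: initially each terminal is a tree by itself, and, while there are at least two trees, choose a node $v$ and a set $\Gamma'$ of at least two trees that minimize $\frac{1}{|\Gamma'|-1}\sum_{\Upsilon\in\Gamma'}\mathrm{dist}(v,\Upsilon)$, and merge the trees in $\Gamma'$ (and the one containing $v$, if any) through $v$. Starting from the sink, process all edges of the tree: for an edge from an already processed node $p_i$ to $p_j$, generate points every distance $R_t$ on the straight line to $p_j$ from the point representing $p_i$ (the sink represents itself), until $p_j$ is reached, or all targets of $P_{p_j}$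 are covered by the sink and the points generated so far (if $p_j\in Y$), or the last point is within distance $R_s$ of $p_j$ (if $p_j$ is a node for a Fermat point); the last point then represents $p_j$. (c) If $|L'|<|L|$, replace $L$ by $L'$ and continue; otherwise stop. Finally the sensors are assigned to the points of $L$ by the Hungarian method applied to the $n\times n$ cost matrix of the distances between sensors and points of $L$, filled up with columns of zeros. Theorem. The STBA runs in $O(m^5+n^3)$ time: in the model in which arithmetic operations on real numbers (including square roots and rounding up), comparisons, and accesses to memory take unit time, there is an absolute constant $C$ such that on every such network the algorithm terminates after at most $C\,(m^5+n^3)$ steps. -/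

import Mathlib

noncomputable section

namespace STBA

/-! ## The cost model: a unit-cost real RAM

Elementary operations, which cost one each: the arithmetic operations, the square root and the
rounding up of real numbers, comparisons of real numbers and of natural numbers, reading or writing
an entry of an array, adding an element to a list, and starting an iteration of a loop. The handling
of local variables (pairing, projections, case distinctions on Booleans and options, shifting an
index by a constant) is charged to these operations. -/

/-- The outcome of a computation: the value it returns, and the number of elementary operations
that it performs, which is `⊤` if it does not terminate. -/
structure Timed (α : Type) where
  val : α
  time : ℕ∞

instance : Monad Timed where
  pure x := ⟨x, 0⟩
  bind c f := ⟨(f c.val).val, c.time + (f c.val).time⟩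

/-- One elementary operation on natural numbers, indices or list cells. -/
def step {α : Type} (x : α) : Timed α := ⟨x, 1⟩

/-- A real number that has already been computed is available at no further cost. -/
instance : Coe ℝ (Timed ℝ) := ⟨fun x => ⟨x, 0⟩⟩

instance (k : ℕ) : OfNat (Timed ℝ) k := ⟨⟨(k : ℝ), 0⟩⟩

/-- An arithmetic operation costs one, plus the cost of evaluating its operands. -/
instance : Add (Timed ℝ) := ⟨fun a b => ⟨a.val + b.val, a.time + b.time + 1⟩⟩

instance : Sub (Timed ℝ) := ⟨fun a b => ⟨a.val - b.val, a.time + b.time + 1⟩⟩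

instance : Mul (Timed ℝ) := ⟨fun a b => ⟨a.val * b.val, a.time + b.time + 1⟩⟩

instance : Div (Timed ℝ) := ⟨fun a b => ⟨a.val / b.val, a.time + b.time + 1⟩⟩

def sqrtT (a : Timed ℝ) : Timed ℝ := ⟨Real.sqrt a.val, a.time + 1⟩

/-- `max (0, ⌈a⌉)`. -/
def ceilT (a : Timed ℝ) : Timed ℕ := ⟨⌈a.val⌉₊, a.time + 1⟩

def leT (a b : Timed ℝ) : Timed Bool := ⟨decide (a.val ≤ b.val), a.time + b.time + 1⟩

def ltT (a b : Timed ℝ) : Timed Bool := ⟨decide (a.val < b.val), a.time + b.time + 1⟩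

/-- The real number equal to a given natural number. -/
def ofNatT (k : ℕ) : Timed ℝ := ⟨(k : ℝ), 1⟩

/-- The unbounded loop `while cond do body` on the state `s`. Each evaluation of the condition
costs one more than the evaluation itself. If the condition never becomes false, the cost
is `⊤`. -/
def whileT {σ : Type} (cond : σ → Timed Bool) (body : σ → Timed σ) (s : σ) : Timed σ :=
  open Classical in
  let it : ℕ → σ := fun k => (fun x => (body x).val)^[k] s
  if h : ∃ k, (cond (it k)).val = false then
    ⟨it (Nat.find h),
      (∑ i ∈ Finset.range (Nat.find h), ((cond (it i)).time + 1 + (body (it i)).time))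
        + ((cond (it (Nat.find h))).time + 1)⟩
  else ⟨s, ⊤⟩

/-- The loop `for x in l do body` on the state `s`. Each iteration costs one more than its
body. -/
def forT {α σ : Type} : List α → σ → (σ → α → Timed σ) → Timed σ
  | [], s, _ => step s
  | x :: l, s, body => do
    let s ← step s
    let s ← body s x
    forT l s body

/-- Read an entry of an array. -/
def rd {ι α : Type} (a : ι → α) (i : ι) : Timed α := step (a i)

/-- Overwrite an entry of an array. -/
def wr {ι α : Type} [DecidableEq ι] (a : ι → α) (i : ι) (x : α) : Timed (ι → α) :=
  step (Function.update a i x)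

/-- An array with `N` entries, all equal to `x`: it costs `N + 1`. -/
def alloc {ι α : Type} (N : ℕ) (x : α) : Timed (ι → α) :=
  forT (List.range N) (fun _ => x) (fun a _ => pure a)

/-- Add an element to a list. -/
def push {α : Type} (x : α) (l : List α) : Timed (List α) := step (x :: l)

/-- The length of a list, by traversal. -/
def lenT {α : Type} (l : List α) : Timed ℕ := forT l 0 (fun k _ => pure (k + 1))

/-- Add all elements of the first list to the second one. -/
def pushAll {α : Type} (l l' : List α) : Timed (List α) := forT l l' (fun acc x => push x acc)

/-- Copy a list into an array. -/
def toArr {α : Type} (x₀ : α) (l : List α) : Timed (ℕ → α) := do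
  let r ← forT l ((0 : ℕ), (fun _ => x₀ : ℕ → α)) (fun s x => do
    let a ← wr s.2 s.1 x
    return (s.1 + 1, a))
  return r.2

/-! ## Geometric subroutines -/

/-- A point of the plane, given by its Cartesian coordinates. -/
structure Pt where
  x : ℝ
  y : ℝ

/-- Euclidean distance. -/
def distT (p q : Pt) : Timed ℝ := do
  let dx ← (p.x - q.x : Timed ℝ)
  let dy ← (p.y - q.y : Timed ℝ)
  sqrtT (dx * dx + dy * dy)

/-- Is the distance between `p` and `q` at most `r`? -/
def within (r : ℝ) (p q : Pt) : Timed Bool := leT (distT p q) r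

/-- The intersection points of the two circles of radius `r` centered at two distinct points
`p` and `q` (none if the circles are disjoint, or have the same center). -/
def circleInter (r : ℝ) (p q : Pt) : Timed (List Pt) := do
  let d ← distT p q
  let b₁ ← ltT 0 d
  let b₂ ← leT d (2 * r)
  if b₁ && b₂ then
    let h ← sqrtT (r * r - d * d / 4)
    let mx ← ((p.x + q.x) / 2 : Timed ℝ)
    let my ← ((p.y + q.y) / 2 : Timed ℝ)
    let ox ← (h * (q.y - p.y) / d : Timed ℝ)
    let oy ← (h * (q.x - p.x) / d : Timed ℝ)
    let x₁ ← (mx - ox : Timed ℝ)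
    let y₁ ← (my + oy : Timed ℝ)
    let x₂ ← (mx + ox : Timed ℝ)
    let y₂ ← (my - oy : Timed ℝ)
    return [⟨x₁, y₁⟩, ⟨x₂, y₂⟩]
  else return []

/-- Does the triangle `a b c` have an angle of at least 120 degrees at `a`? -/
def wideAngle (a b c : Pt) : Timed Bool := do
  let ab ← distT a b
  let ac ← distT a c
  leT ((b.x - a.x) * (c.x - a.x) + (b.y - a.y) * (c.y - a.y)) (0 - ab * ac / 2)

/-- The apex of the equilateral triangle on the side `p q`, to the right of the direction from
`p` to `q` if `sgn = 1`, and to the left of it if `sgn = -1`. -/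
def apex (sgn : ℝ) (p q : Pt) : Timed Pt := do
  let si ← (sgn * sqrtT 3 / 2 : Timed ℝ)
  let x ← (p.x + (q.x - p.x) / 2 + si * (q.y - p.y) : Timed ℝ)
  let y ← (p.y + (q.y - p.y) / 2 - si * (q.x - p.x) : Timed ℝ)
  return ⟨x, y⟩

/-- The Fermat point of the triangle `a b c`: a vertex whose angle is at least 120 degrees, if
there is one; otherwise the intersection of the lines that join `a` and `b` to the apexes of the
outer equilateral triangles on the opposite sides. -/
def fermat (a b c : Pt) : Timed Pt := do
  let wa ← wideAngle a b c
  let wb ← wideAngle b c a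
  let wc ← wideAngle c a b
  if wa then return a
  else if wb then return b
  else if wc then return c
  else
    let ccw ← ltT 0 ((b.x - a.x) * (c.y - a.y) - (b.y - a.y) * (c.x - a.x))
    let sgn ← if ccw then (1 : Timed ℝ) else (0 - 1 : Timed ℝ)
    let a' ← apex sgn b c
    let b' ← apex sgn c a
    let ux ← (a'.x - a.x : Timed ℝ)
    let uy ← (a'.y - a.y : Timed ℝ)
    let vx ← (b'.x - b.x : Timed ℝ)
    let vy ← (b'.y - b.y : Timed ℝ)
    let t ← (((b.x - a.x) * vy - (b.y - a.y) * vx) / (ux * vy - uy * vx) : Timed ℝ)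
    let x ← (a.x + t * ux : Timed ℝ)
    let y ← (a.y + t * uy : Timed ℝ)
    return ⟨x, y⟩

/-- Remove repetitions from a list of points. -/
def distinctPts (l : List Pt) : Timed (List Pt) :=
  forT l [] (fun acc p => do
    let seen ← forT acc false (fun b q => do
      let e ← leT (distT p q) 0
      return (b || e))
    if seen then return acc else push p acc)

/-- The part of the perpendicular bisector of two sites `p` and `q` that has been found to be a
common boundary of their Voronoi cells: the points `c + t u`, with `c` the midpoint of the two
sites and `u` the vector `q - p` turned by 90 degrees, where `t` lies between the two bounds
(an absent bound is infinite), or nothing at all if `nonempty` is false. -/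
structure Boundary where
  nonempty : Bool
  lo : Option ℝ
  hi : Option ℝ

/-- Cut a boundary down to the points that satisfy `a t ≤ b`. -/
def Boundary.cut (s : Boundary) (a b : ℝ) : Timed Boundary := do
  let pos ← ltT 0 a
  let neg ← ltT a 0
  if pos then
    let t ← (b / a : Timed ℝ)
    match s.hi with
    | none => return { s with hi := some t }
    | some h =>
      let less ← ltT t h
      return if less then { s with hi := some t } else s
  else if neg then
    let t ← (b / a : Timed ℝ)
    match s.lo with
    | none => return { s with lo := some t }
    | some h =>
      let more ← ltT h t
      return if more then { s with lo := some t } else s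
  else
    let bad ← ltT b 0
    return if bad then { s with nonempty := false } else s

/-- Are two distinct sites `p` and `q` neighbors in the Voronoi diagram of `sites`, that is, do
their cells have a boundary edge (of positive length) in common? -/
def voronoiNeighbors (sites : List Pt) (p q : Pt) : Timed Bool := do
  let cx ← ((p.x + q.x) / 2 : Timed ℝ)
  let cy ← ((p.y + q.y) / 2 : Timed ℝ)
  let ux ← (p.y - q.y : Timed ℝ)
  let uy ← (q.x - p.x : Timed ℝ)
  let s ← forT sites (⟨true, none, none⟩ : Boundary) (fun s r => do
    let a ← (2 * (ux * (r.x - p.x) + uy * (r.y - p.y)) : Timed ℝ)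
    let b ← (r.x * r.x + r.y * r.y - (p.x * p.x + p.y * p.y)
      - 2 * (cx * (r.x - p.x) + cy * (r.y - p.y)) : Timed ℝ)
    s.cut a b)
  match s.lo, s.hi with
  | some l, some h => do
    let long ← ltT l h
    return (s.nonempty && long)
  | _, _ => return s.nonempty

/-- The Fermat points of all triples of sites that are pairwise neighbors in the Voronoi diagram
of `sites`. -/
def fermatPoints (sites : List Pt) : Timed (List Pt) := do
  let k ← lenT sites
  let arr ← toArr ⟨0, 0⟩ sites
  let nb ← alloc (k * k) false
  let nb ← forT (List.range k) nb (fun nb i =>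
    forT (List.range k) nb (fun nb j => do
      let diff ← step (decide (i ≠ j))
      if diff then
        let p ← rd arr i
        let q ← rd arr j
        let b ← voronoiNeighbors sites p q
        wr nb (i, j) b
      else return nb))
  forT (List.range k) [] (fun F i =>
    forT (List.range k) F (fun F j =>
      forT (List.range k) F (fun F l => do
        let ordered ← step (decide (i < j ∧ j < l))
        let ij ← rd nb (i, j)
        let jl ← rd nb (j, l)
        let il ← rd nb (i, l)
        if ordered && ij && jl && il then
          let a ← rd arr i
          let b ← rd arr j
          let c ← rd arr l
          let f ← fermat a b c
          push f F
        else return F)))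

/-! ## The modified Klein-Ravi algorithm -/

/-- A tree seen from a node: its distance, the node of the tree that attains it, and the label of
the tree. -/
structure TreeDist where
  d : ℝ
  node : ℕ
  label : ℕ

/-- Insertion into a list that is sorted by distance. -/
def insertT (x : TreeDist) : List TreeDist → Timed (List TreeDist)
  | [] => step [x]
  | y :: ys => do
    let b ← leT x.d y.d
    if b then push x (y :: ys)
    else
      let zs ← insertT x ys
      push y zs

/-- A forest on the nodes `0, …, V - 1`: the label of the tree that contains a node (`none` if
no tree contains it), the list of the labels of the trees, and the list of the edges. -/
structure Forest where
  label : ℕ → Option ℕ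
  trees : List ℕ
  edges : List (ℕ × ℕ)

/-- The distances from the node `v` to all trees of the forest, in increasing order. Nodes have
weight zero and the weight of an edge is its length, so by the triangle inequality the distance
to a tree is the distance to the closest node of the tree. -/
def treeDists (V : ℕ) (pos : ℕ → Pt) (G : Forest) (v : ℕ) : Timed (List TreeDist) := do
  let p ← rd pos v
  let a ← alloc (ι := ℕ) V (none : Option TreeDist)
  let a ← forT (List.range V) a (fun a u => do
    let lu ← rd G.label u
    match lu with
    | none => return a
    | some l =>
      let q ← rd pos u
      let d ← distT p q
      let old ← rd a l
      match old with
      | none => wr a l (some ⟨d, u, l⟩)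
      | some o =>
        let less ← ltT d o.d
        if less then wr a l (some ⟨d, u, l⟩) else return a)
  forT G.trees [] (fun acc l => do
    let e ← rd a l
    match e with
    | none => return acc
    | some x => insertT x acc)

/-- A choice of a node and of a set of trees with the corresponding quotient. -/
structure Quotient where
  cost : ℝ
  node : ℕ
  trees : List TreeDist

/-- The quotient cost of the node `v`: the minimum of `(∑ distances to the chosen trees) / (k - 1)`
over all sets of `k ≥ 2` trees. For each `k`, the `k` closest trees are the best choice. The
result is `none` if there are fewer than two trees. -/
def quotientCost (v : ℕ) (ds : List TreeDist) : Timed (Option Quotient) := do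
  let r ← forT ds ((0 : ℕ), (0 : ℝ), (none : Option (ℝ × ℕ))) (fun s x => do
    let k ← step (s.1 + 1)
    let sum ← (s.2.1 + x.d : Timed ℝ)
    let two ← step (decide (2 ≤ k))
    if two then
      let q ← (sum / (ofNatT k - 1) : Timed ℝ)
      match s.2.2 with
      | none => return (k, sum, some (q, k))
      | some b =>
        let less ← ltT q b.1
        return if less then (k, sum, some (q, k)) else (k, sum, some b)
    else return (k, sum, none))
  match r.2.2 with
  | none => return none
  | some b =>
    let chosen ← forT (List.range b.2) (([] : List TreeDist), ds) (fun s _ =>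
      match s.2 with
      | [] => return s
      | x :: xs => do
        let l ← push x s.1
        return (l, xs))
    return some ⟨b.1, v, chosen.1⟩

/-- A node of minimum quotient cost. -/
def minQuotient (V : ℕ) (pos : ℕ → Pt) (G : Forest) : Timed (Option Quotient) :=
  forT (List.range V) none (fun best v => do
    let ds ← treeDists V pos G v
    let q ← quotientCost v ds
    match best, q with
    | none, q => return q
    | some b, none => return some b
    | some b, some c => do
      let less ← ltT c.cost b.cost
      return if less then some c else some b)

/-- Merge the chosen trees, and the tree of the chosen node if there is one, into one tree, by
joining the chosen node to the closest node of each other chosen tree. -/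
def merge (V : ℕ) (G : Forest) (Q : Quotient) : Timed Forest := do
  let own ← rd G.label Q.node
  let new := match own, Q.trees with
    | some l, _ => l
    | none, x :: _ => x.label
    | none, [] => 0
  let mark ← alloc (ι := ℕ) V false
  let mark ← wr mark new true
  let r ← forT Q.trees (mark, G.edges) (fun s x => do
    let mark ← wr s.1 x.label true
    let same ← step (decide (own = some x.label))
    if same then return (mark, s.2)
    else
      let es ← push (Q.node, x.node) s.2
      return (mark, es))
  let lab ← wr G.label Q.node (some new)
  let lab ← forT (List.range V) lab (fun lab u => do
    let lu ← rd lab u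
    match lu with
    | none => return lab
    | some l =>
      let b ← rd r.1 l
      if b then wr lab u (some new) else return lab)
  let trees ← forT G.trees [new] (fun acc l => do
    let b ← rd r.1 l
    if b then return acc else push l acc)
  return ⟨lab, trees, r.2⟩

/-- The modified Klein-Ravi algorithm on the complete graph with nodes `0, …, V - 1` at the given
positions, whose terminal nodes are `0, …, k - 1`: it returns the edges of a tree that spans the
terminal nodes. -/
def kleinRavi (V : ℕ) (pos : ℕ → Pt) (k : ℕ) : Timed (List (ℕ × ℕ)) := do
  let lab ← alloc (ι := ℕ) V (none : Option ℕ)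
  let G ← forT (List.range k) (⟨lab, [], []⟩ : Forest) (fun G i => do
    let lab ← wr G.label i (some i)
    let trees ← push i G.trees
    return ⟨lab, trees, []⟩)
  let G ← whileT
    (fun G : Forest => do
      let t ← lenT G.trees
      step (decide (2 ≤ t)))
    (fun G => do
      let q ← minQuotient V pos G
      match q with
      | none => return G
      | some Q => merge V G Q)
    G
  return G.edges

/-! ## The Hungarian method -/

/-- The state of the Hungarian method on an `n × n` matrix. Rows and columns are numbered from
`1` to `n`; column `0` is a virtual column. `u` and `v` are the dual variables of rows and columns,
`row j` is the row assigned to column `j` (`0` if there is none). -/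
structure Dual where
  u : ℕ → ℝ
  v : ℕ → ℝ
  row : ℕ → ℕ

/-- The state of the search for an augmenting path: the dual variables, the columns that have been
reached, the smallest reduced cost known for each column (`none` is infinite), the predecessor of
each column, and the current column. -/
structure Search where
  u : ℕ → ℝ
  v : ℕ → ℝ
  used : ℕ → Bool
  minv : ℕ → Option ℝ
  way : ℕ → ℕ
  cur : ℕ

/-- The state of the scan of all columns: smallest reduced costs, predecessors, and the smallest
reduced cost of a column that has not been reached, with that column. -/
structure Scan where
  minv : ℕ → Option ℝ
  way : ℕ → ℕ
  best : Option (ℝ × ℕ)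

/-- Update the reduced cost of column `j` through row `i`, which is assigned to column `s.cur`. -/
def scanColumn (a : ℕ × ℕ → ℝ) (s : Search) (i : ℕ) (r : Scan) (j : ℕ) : Timed Scan := do
  let us ← rd s.used j
  if us then return r
  else
    let aij ← rd a (i, j)
    let ui ← rd s.u i
    let vj ← rd s.v j
    let c ← (aij - ui - vj : Timed ℝ)
    let old ← rd r.minv j
    let better ← match old with
      | none => (step true : Timed Bool)
      | some o => ltT c o
    let minv ← if better then wr r.minv j (some c) else (return r.minv)
    let way ← if better then wr r.way j s.cur else (return r.way)
    let mj ← rd minv j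
    match mj, r.best with
    | none, b => return ⟨minv, way, b⟩
    | some x, none => return ⟨minv, way, some (x, j)⟩
    | some x, some b => do
      let less ← ltT x b.1
      return ⟨minv, way, if less then some (x, j) else some b⟩

/-- Decrease the reduced costs of all columns that have not been reached by `δ`, by a change of the
dual variables. -/
def shiftDual (n : ℕ) (row : ℕ → ℕ) (δ : ℝ) (s : Search) : Timed Search :=
  forT (List.range (n + 1)) s (fun s j => do
    let us ← rd s.used j
    if us then
      let i ← rd row j
      let ui ← rd s.u i
      let ui ← (ui + δ : Timed ℝ)
      let u ← wr s.u i ui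
      let vj ← rd s.v j
      let vj ← (vj - δ : Timed ℝ)
      let v ← wr s.v j vj
      return { s with u := u, v := v }
    else
      let mj ← rd s.minv j
      match mj with
      | none => return s
      | some x =>
        let x ← (x - δ : Timed ℝ)
        let minv ← wr s.minv j (some x)
        return { s with minv := minv })

/-- One step of the search: scan the columns from the row assigned to the current column, change
the dual variables, and move to the closest column that has not been reached. -/
def searchStep (n : ℕ) (a : ℕ × ℕ → ℝ) (row : ℕ → ℕ) (s : Search) : Timed Search := do
  let used ← wr s.used s.cur true
  let s := { s with used := used }
  let i ← rd row s.cur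
  let r ← forT (List.range n) (⟨s.minv, s.way, none⟩ : Scan) (fun r j => scanColumn a s i r (j + 1))
  let s := { s with minv := r.minv, way := r.way }
  match r.best with
  | none => return s
  | some b =>
    let s ← shiftDual n row b.1 s
    return { s with cur := b.2 }

/-- Assign row `i` by means of a shortest augmenting path. -/
def assignRow (n : ℕ) (a : ℕ × ℕ → ℝ) (D : Dual) (i : ℕ) : Timed Dual := do
  let row ← wr D.row 0 i
  let used ← alloc (ι := ℕ) (n + 1) false
  let minv ← alloc (ι := ℕ) (n + 1) (none : Option ℝ)
  let way ← alloc (ι := ℕ) (n + 1) (0 : ℕ)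
  let s ← whileT
    (fun s : Search => do
      let r ← rd row s.cur
      step (decide (r ≠ 0)))
    (searchStep n a row)
    ⟨D.u, D.v, used, minv, way, 0⟩
  let r ← whileT
    (fun r : (ℕ → ℕ) × ℕ => step (decide (r.2 ≠ 0)))
    (fun r => do
      let j ← rd s.way r.2
      let i ← rd r.1 j
      let row ← wr r.1 r.2 i
      return (row, j))
    (row, s.cur)
  return ⟨s.u, s.v, r.1⟩

/-- The Hungarian method: for each column of the `n × n` cost matrix `a`, the row that is assigned
to it in an assignment of minimum total cost. -/
def hungarian (n : ℕ) (a : ℕ × ℕ → ℝ) : Timed (ℕ → ℕ) := do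
  let u ← alloc (ι := ℕ) (n + 1) (0 : ℝ)
  let v ← alloc (ι := ℕ) (n + 1) (0 : ℝ)
  let row ← alloc (ι := ℕ) (n + 1) (0 : ℕ)
  let D ← forT (List.range n) (⟨u, v, row⟩ : Dual) (fun D i => assignRow n a D (i + 1))
  return D.row

/-! ## Instances, reference points and potential points -/

/-- A mobile wireless sensor network with `m` targets and `n` mobile sensors: the sensing range,
the transmission range, the data sink, the positions and the weights of the targets, and the
positions of the sensors. -/
structure Network (m n : ℕ) where
  Rs : ℝ
  Rt : ℝ
  sink : Pt
  target : Fin m → Pt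
  weight : Fin m → ℝ
  sensor : Fin n → Pt

variable {m n : ℕ}

/-- A reference point: its position, whether it is an intersection point of two circles (rather
than the location of a target), and the list of the targets that it stands for. -/
structure Ref (m : ℕ) where
  pos : Pt
  inter : Bool
  cov : List (Fin m)

/-- The targets within distance `Rs` of the point `p`. -/
def targetsNear (I : Network m n) (p : Pt) : Timed (List (Fin m)) :=
  forT (List.finRange m) [] (fun acc i => do
    let t ← rd I.target i
    let b ← within I.Rs t p
    if b then push i acc else return acc)

/-- All reference points: the locations of the targets, each of which stands for its target only,
and the intersection points of two circles of radius `Rs` around targets, each of which stands for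
all targets within distance `Rs`. -/
def references (I : Network m n) : Timed (List (Ref m)) := do
  let X ← forT (List.finRange m) [] (fun X i => do
    let t ← rd I.target i
    push (⟨t, false, [i]⟩ : Ref m) X)
  forT (List.finRange m) X (fun X i =>
    forT (List.finRange m) X (fun X j => do
      let ordered ← step (decide (i < j))
      if ordered then
        let p ← rd I.target i
        let q ← rd I.target j
        let ps ← circleInter I.Rs p q
        forT ps X (fun X z => do
          let cov ← targetsNear I z
          push (⟨z, true, cov⟩ : Ref m) X)
      else return X))

/-- Record in `c` that all targets within distance `Rs` of `p` are covered. -/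
def markCovered (I : Network m n) (p : Pt) (c : Fin m → Bool) : Timed (Fin m → Bool) :=
  forT (List.finRange m) c (fun c i => do
    let t ← rd I.target i
    let b ← within I.Rs t p
    if b then wr c i true else return c)

/-- Which targets are within distance `Rs` of some point in `L`? -/
def coverage (I : Network m n) (L : List Pt) : Timed (Fin m → Bool) := do
  let c ← alloc (ι := Fin m) m false
  forT L c (fun c p => markCovered I p c)

/-- Are all targets in the list `ts` marked in `c`? -/
def allMarked (c : Fin m → Bool) (ts : List (Fin m)) : Timed Bool :=
  forT ts true (fun b i => do
    let ci ← rd c i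
    return (b && ci))

/-- Is there a target that is not within distance `Rs` of any point in `L`? -/
def someUncovered (I : Network m n) (L : List Pt) : Timed Bool := do
  let c ← coverage I L
  let b ← allMarked c (List.finRange m)
  return !b

/-- The point among `sink` and `L` that is closest to `p`, and its distance to `p`. -/
def nearest (sink : Pt) (L : List Pt) (p : Pt) : Timed (Pt × ℝ) := do
  let d₀ ← distT sink p
  forT L (sink, d₀) (fun b q => do
    let d ← distT q p
    let less ← ltT d b.2
    return if less then (q, d) else b)

/-- The point reached from `p` by moving a distance `r` straight towards `q`, or `q` itself if it is
not farther away than that. -/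
def advance (r : ℝ) (p q : Pt) : Timed Pt := do
  let d ← distT p q
  let close ← leT d r
  if close then return q
  else
    let x ← (p.x + r * (q.x - p.x) / d : Timed ℝ)
    let y ← (p.y + r * (q.y - p.y) / d : Timed ℝ)
    return ⟨x, y⟩

/-- The state of the generation of potential points along a line: the last point, the potential
points that have been generated, and the targets that are covered. -/
structure Trail (m : ℕ) where
  cur : Pt
  pts : List Pt
  covered : Fin m → Bool

/-- Generate the next potential point on the line from the last point to `q`. -/
def extend (I : Network m n) (q : Pt) (s : Trail m) : Timed (Trail m) := do
  let z ← advance I.Rt s.cur q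
  let c ← markCovered I z s.covered
  let pts ← push z s.pts
  return ⟨z, pts, c⟩

/-- Generate potential points on the line to the reference point `r` until it is reached or all
targets that it stands for are covered. -/
def walkToRef (I : Network m n) (r : Ref m) : Trail m → Timed (Trail m) :=
  whileT
    (fun s => do
      let reached ← leT (distT s.cur r.pos) 0
      let cov ← allMarked s.covered r.cov
      return !(reached || cov))
    (extend I r.pos)

/-- Generate potential points on the line to the Fermat point `f` until it is reached or is within
distance `Rs` of the last point. -/
def walkToFermat (I : Network m n) (f : Pt) : Trail m → Timed (Trail m) :=
  whileT
    (fun s => do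
      let reached ← leT (distT s.cur f) 0
      let cov ← within I.Rs f s.cur
      return !(reached || cov))
    (extend I f)

/-! ## The function ReGeneratePotentialPoints -/

/-- The nodes of the graph: the data sink, the selected reference points, and Fermat points. -/
inductive Node (m : ℕ) where
  | sink (p : Pt)
  | ref (r : Ref m)
  | fermat (p : Pt)

def Node.pos : Node m → Pt
  | .sink p => p
  | .ref r => r.pos
  | .fermat p => p

/-- The state of the deployment along tree edges: for each node the point that represents it
(`none` is null), the edges that are left, the potential points, and the covered targets. -/
structure Deploy (m : ℕ) where
  rep : ℕ → Option Pt
  rest : List (ℕ × ℕ)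
  pts : List Pt
  covered : Fin m → Bool

/-- Deploy potential points from the point `g`, which represents the other end of the edge, to the
node `j`. -/
def deployEdge (I : Network m n) (node : ℕ → Node m) (s : Deploy m) (g : Pt) (j : ℕ) :
    Timed (Deploy m) := do
  let z ← rd node j
  let t ← match z with
    | .sink _ => (return ⟨g, s.pts, s.covered⟩ : Timed (Trail m))
    | .ref r => walkToRef I r ⟨g, s.pts, s.covered⟩
    | .fermat f => walkToFermat I f ⟨g, s.pts, s.covered⟩
  let rep ← wr s.rep j (some t.cur)
  return ⟨rep, s.rest, t.pts, t.covered⟩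

/-- Go through the list of the edges that are left, use those with a represented end node, and keep
the others. -/
def deployPass (I : Network m n) (node : ℕ → Node m) (s : Deploy m) : Timed (Deploy m) :=
  forT s.rest { s with rest := [] } (fun s e => do
    let gi ← rd s.rep e.1
    let gj ← rd s.rep e.2
    match gi, gj with
    | some g, _ => deployEdge I node s g e.2
    | none, some g => deployEdge I node s g e.1
    | none, none => do
      let rest ← push e s.rest
      return { s with rest := rest })

/-- Potential points that cover all targets of the reference points in `Y` and form a network
connected with the sink. -/
def regenerate (I : Network m n) (Y : List (Ref m)) : Timed (List Pt) := do
  let posY ← forT Y [I.sink] (fun acc r => push r.pos acc)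
  let sites ← distinctPts posY
  let F ← fermatPoints sites
  let nodes ← forT F [] (fun acc p => push (Node.fermat p : Node m) acc)
  let nodes ← forT Y nodes (fun acc r => push (Node.ref r) acc)
  let nodes ← push (Node.sink I.sink) nodes
  let V ← lenT nodes
  let k ← lenT Y
  let node ← toArr (Node.sink I.sink) nodes
  let pos ← alloc (ι := ℕ) V I.sink
  let pos ← forT (List.range V) pos (fun pos i => do
    let z ← rd node i
    wr pos i z.pos)
  let E ← kleinRavi V pos (k + 1)
  let rep ← alloc (ι := ℕ) V (none : Option Pt)
  let rep ← wr rep 0 (some I.sink)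
  let c ← coverage I [I.sink]
  let s ← whileT
    (fun s : Deploy m => step (!s.rest.isEmpty))
    (deployPass I node)
    ⟨rep, E, [], c⟩
  return s.pts

/-! ## The Steiner-tree-based algorithm -/

/-- The state of the main loops: the potential points `L`, the selected reference points `Y`, the
targets that the points in `Y` stand for, and whether the current loop goes on. -/
structure State (m : ℕ) where
  L : List Pt
  Y : List (Ref m)
  chosen : Fin m → Bool
  go : Bool

/-- The number of additional potential points that the reference point `p` at distance `eta` from
the network requires. -/
def phi (I : Network m n) (p : Ref m) (eta : ℝ) : Timed ℕ :=
  if p.inter then ceilT (eta / I.Rt) else ceilT ((eta - I.Rs) / I.Rt)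

/-- The profit of `p`, where `none` stands for `∞`: the total weight of the targets of `p` that are
not covered (`c` marks the covered ones), per additional potential point. -/
def rho (I : Network m n) (c : Fin m → Bool) (p : Ref m) (ph : ℕ) : Timed (Option ℝ) := do
  let zero ← step (decide (ph = 0))
  if zero then return none
  else
    let w ← forT p.cov (0 : ℝ) (fun w i => do
      let ci ← rd c i
      if ci then return w
      else
        let wi ← rd I.weight i
        (w + wi : Timed ℝ))
    let q ← (w / ofNatT ph : Timed ℝ)
    return some q

/-- A candidate for selection. -/
structure Cand (m : ℕ) where
  ref : Ref m
  rho : Option ℝ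
  eta : ℝ
  src : Pt

/-- Is the profit of `a` larger than that of `b`, or equal to it with `a` not farther away? -/
def Cand.better (a b : Cand m) : Timed Bool :=
  match a.rho, b.rho with
  | none, none => leT a.eta b.eta
  | none, some _ => step true
  | some _, none => step false
  | some x, some y => do
    let gt ← ltT y x
    let ge ← leT y x
    let close ← leT a.eta b.eta
    return (gt || (ge && close))

/-- The reference point to be selected: among the points that stand for at least one target that no
point in `Y` stands for, and that do not require too many potential points, one of maximum profit;
in case of a tie a closest one. -/
def select (I : Network m n) (X : List (Ref m)) (s : State m) : Timed (Option (Cand m)) := do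
  let l ← lenT s.L
  let c ← coverage I s.L
  forT X none (fun best p => do
    let old ← allMarked s.chosen p.cov
    let near ← nearest I.sink s.L p.pos
    let ph ← phi I p near.2
    let fits ← step (decide (ph ≤ n - l))
    if !old && fits then
      let r ← rho I c p ph
      let a : Cand m := ⟨p, r, near.2, near.1⟩
      match best with
      | none => return some a
      | some b =>
        let bt ← a.better b
        return if bt then some a else some b
    else return best)

/-- The body of the inner loop: select a reference point and generate potential points for it, or
end the loop if there is nothing to select. -/
def innerBody (I : Network m n) (X : List (Ref m)) (s : State m) : Timed (State m) := do
  let a ← select I X s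
  match a with
  | none => return { s with go := false }
  | some a =>
    let c ← coverage I (I.sink :: s.L)
    let t ← walkToRef I a.ref ⟨a.src, [], c⟩
    let L ← pushAll t.pts s.L
    let Y ← push a.ref s.Y
    let ch ← forT a.ref.cov s.chosen (fun ch i => wr ch i true)
    return ⟨L, Y, ch, true⟩

/-- The condition of both loops. -/
def unfinished (I : Network m n) (s : State m) : Timed Bool := do
  if s.go then someUncovered I s.L else return false

/-- The body of the outer loop. -/
def outerBody (I : Network m n) (X : List (Ref m)) (s : State m) : Timed (State m) := do
  let s ← whileT (unfinished I) (innerBody I X) s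
  let L' ← regenerate I s.Y
  let l ← lenT s.L
  let l' ← lenT L'
  let less ← step (decide (l' < l))
  if less then return { s with L := L', go := true }
  else return { s with go := false }

/-- The deployment orders, each of which sends a sensor (given by its number, from `0` to `n - 1`) to
a potential point in `L`: the costs are the distances, and dummy points of cost zero are added
to `L`. -/
def deploymentOrders (I : Network m n) (L : List Pt) : Timed (List (ℕ × Pt)) := do
  let l ← lenT L
  let pt ← toArr I.sink L
  let a ← alloc (ι := ℕ × ℕ) ((n + 1) * (n + 1)) (0 : ℝ)
  let a ← forT (List.finRange n) a (fun a i => do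
    let s ← rd I.sensor i
    forT (List.range l) a (fun a j => do
      let p ← rd pt j
      let d ← distT s p
      wr a (i.val + 1, j + 1) d))
  let row ← hungarian n a
  forT (List.range l) [] (fun D j => do
    let i ← rd row (j + 1)
    let p ← rd pt j
    push (i - 1, p) D)

/-- The Steiner-tree-based algorithm. -/
def stba (I : Network m n) : Timed (List (ℕ × Pt)) := do
  let X ← references I
  let ch ← alloc (ι := Fin m) m false
  let s ← whileT (unfinished I) (outerBody I X) ⟨[], [], ch, true⟩
  deploymentOrders I s.L

end STBA

end

/-! The bound rests on four facts: how often the loops can run, how large the graph for the Steiner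
tree is, how many points can be generated, and what the Hungarian method costs.

Loops. A selection requires a target that no earlier selection stands for, so all runs of the inner
loop together make at most `m` selections. The outer loop continues only after `L` was replaced by
the regeneration of `Y`. If the next inner loop selects nothing, regeneration from the same `Y`
gives a family of the same length, the test `|L'| < |L|` fails, and the loop stops. Hence every
iteration of the outer loop except the last marks a new target (`runs_outerBody`). An inner
iteration costs `O(m^3 + m^2 n)`, because there are `O(m^2)` reference points and each is tested in
time `O(m + n)`.

Size of the graph. Neighboring Voronoi cells have an empty circle through their two sites, centered
on the common edge. Edges with empty circles neither cross nor overlap, and this charges every edge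
to one of eight slots at one of its ends (`Edge.top`, `exists_slot`). In a triangle two of the edges
so oriented form a directed path, so there are at most `64 k` triangles on `k` sites, and therefore
only `O(m)` Fermat points (`card_triangles_le`, `runs_fermatPoints`). The Klein–Ravi algorithm makes
at most `m` mergers, each of which examines `O(m)` nodes at a cost of `O(m^2)` per node. This gives
`O(m^4)` per regeneration and `O(m^5)` in total.

Number of points. A reference point is selected only if at most `n` points in a row reach it, so its
distance from the sink is at most `n * Rt` plus its stopping radius (`0` or `Rs`). Fermat points lie
in the triangles of their sites, hence in the same ball around the sink (`runs_fermat`). A walk may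
stop far from its goal, and the triangle inequality alone would allow the distance from the sink to
double at every edge of the tree. `Pt.dist_mix_le` shows that it grows by at most `(n + 1) * Rt` per
edge. So the `O(m)` edges generate `O(m n)` points each, and a regeneration `O(m^2 n)` points at
cost `O(m)` each. Only the last regeneration needs this bound: all others yield fewer than `n`
points.

Assignment. A search of the Hungarian method reaches a new column in each step, and predecessors
were reached earlier, so a row costs `O(n^2)` and the method `O(n^3)` (`runs_assignRow`).

Altogether this is `O(m^5 + m^3 n + n^3)`, and `m^3 n` is dominated by `m^5` if `n ≤ m^2` and by
`n^3` otherwise. Optimality of the trees or of the assignment plays no role; each loop invariant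
keeps only what termination and cost require. -/

namespace STBA

/-! ### Hoare-style rules for values and running times -/

section Framework

/-- The computation `c` terminates, and its value and its running time satisfy `Q`. -/
def Runs {α : Type} (c : Timed α) (Q : α → ℕ → Prop) : Prop :=
  ∃ t : ℕ, c.time = (t : ℕ∞) ∧ Q c.val t

variable {α β σ : Type}

theorem Runs.mono {c : Timed α} {P Q : α → ℕ → Prop} (h : Runs c P)
    (hPQ : ∀ a t, P a t → Q a t) : Runs c Q := by
  obtain ⟨t, ht, hp⟩ := h
  exact ⟨t, ht, hPQ _ _ hp⟩

/-- Identifies the result with the value of the program; needed to compare two regenerations from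
the same `Y`. -/
theorem Runs.and_val {c : Timed α} {P : α → ℕ → Prop} (h : Runs c P) :
    Runs c (fun a t => P a t ∧ a = c.val) := by
  obtain ⟨t, ht, hp⟩ := h
  exact ⟨t, ht, hp, rfl⟩

theorem runs_mk_iff {x : α} {t : ℕ∞} {k : ℕ} (h : t = k) {Q : α → ℕ → Prop} :
    Runs ⟨x, t⟩ Q ↔ Q x k := by
  subst h
  constructor
  · rintro ⟨t, ht, hq⟩
    obtain rfl : k = t := by
      simp only at ht
      exact_mod_cast ht
    exact hq
  · exact fun h => ⟨k, rfl, h⟩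

@[simp] theorem runs_mk_zero {x : α} {Q : α → ℕ → Prop} : Runs ⟨x, 0⟩ Q ↔ Q x 0 :=
  runs_mk_iff (by simp)

@[simp] theorem runs_pure {x : α} {Q : α → ℕ → Prop} : Runs (pure x) Q ↔ Q x 0 :=
  runs_mk_zero

@[simp] theorem runs_step {x : α} {Q : α → ℕ → Prop} : Runs (step x) Q ↔ Q x 1 :=
  runs_mk_iff (by simp)

@[simp] theorem runs_rd {ι : Type} {a : ι → α} {i : ι} {Q : α → ℕ → Prop} :
    Runs (rd a i) Q ↔ Q (a i) 1 := runs_step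

@[simp] theorem runs_wr {ι : Type} [DecidableEq ι] {a : ι → α} {i : ι} {x : α}
    {Q : (ι → α) → ℕ → Prop} : Runs (wr a i x) Q ↔ Q (Function.update a i x) 1 := runs_step

@[simp] theorem runs_push {x : α} {l : List α} {Q : List α → ℕ → Prop} :
    Runs (push x l) Q ↔ Q (x :: l) 1 := runs_step

-- A sum in `ℕ∞` is finite only if both summands are. Being equivalences, this rule and those for
-- the primitive operations let `simp` compute the exact time of straight-line code.
@[simp] theorem runs_bind {c : Timed α} {f : α → Timed β} {Q : β → ℕ → Prop} :
    Runs (c >>= f) Q ↔ Runs c (fun a t => Runs (f a) (fun b t' => Q b (t + t'))) := by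
  have e : (c >>= f) = ⟨(f c.val).val, c.time + (f c.val).time⟩ := rfl
  rw [e]
  constructor
  · rintro ⟨t, ht, hq⟩
    have h1 : c.time ≠ ⊤ := by
      intro h; simp only [h, top_add] at ht; exact ENat.top_ne_natCast t ht
    have h2 : (f c.val).time ≠ ⊤ := by
      intro h; simp only [h, add_top] at ht; exact ENat.top_ne_natCast t ht
    obtain ⟨t1, h1⟩ := ENat.ne_top_iff_exists.1 h1
    obtain ⟨t2, h2⟩ := ENat.ne_top_iff_exists.1 h2
    refine ⟨t1, h1.symm, t2, h2.symm, ?_⟩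
    have : t = t1 + t2 := by
      simp only [← h1, ← h2] at ht
      exact_mod_cast ht.symm
    subst this
    exact hq
  · rintro ⟨t1, h1, t2, h2, hq⟩
    exact ⟨t1 + t2, by simp [h1, h2], hq⟩

@[simp] theorem runs_ite {p : Prop} [Decidable p] {a b : Timed α} {Q : α → ℕ → Prop} :
    Runs (if p then a else b) Q ↔ (p → Runs a Q) ∧ (¬ p → Runs b Q) := by
  by_cases h : p <;> simp [h]

section Arithmetic

variable {Q : ℝ → ℕ → Prop}

/-- The operation has the same value and cost as evaluating both operands and then performing one
step, so the rule for sequencing applies. -/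
theorem runs_op2 {op : α → α → β} {a b : Timed α} {Q : β → ℕ → Prop} :
    Runs ⟨op a.val b.val, a.time + b.time + 1⟩ Q ↔
      Runs a (fun x t => Runs b (fun y t' => Q (op x y) (t + t' + 1))) := by
  have h := @runs_bind α β a (fun x => b >>= fun y => step (op x y)) Q
  rw [show (a >>= fun x => b >>= fun y => step (op x y)) =
    ⟨op a.val b.val, a.time + (b.time + 1)⟩ from rfl, ← add_assoc] at h
  rw [h]
  simp only [runs_bind, runs_step, add_assoc]

@[simp] theorem runs_add {a b : Timed ℝ} : Runs (a + b) Q ↔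
    Runs a (fun x t => Runs b (fun y t' => Q (x + y) (t + t' + 1))) := runs_op2

@[simp] theorem runs_sub {a b : Timed ℝ} : Runs (a - b) Q ↔
    Runs a (fun x t => Runs b (fun y t' => Q (x - y) (t + t' + 1))) := runs_op2

@[simp] theorem runs_mul {a b : Timed ℝ} : Runs (a * b) Q ↔
    Runs a (fun x t => Runs b (fun y t' => Q (x * y) (t + t' + 1))) := runs_op2

@[simp] theorem runs_div {a b : Timed ℝ} : Runs (a / b) Q ↔
    Runs a (fun x t => Runs b (fun y t' => Q (x / y) (t + t' + 1))) := runs_op2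

@[simp] theorem runs_leT {a b : Timed ℝ} {Q : Bool → ℕ → Prop} : Runs (leT a b) Q ↔
    Runs a (fun x t => Runs b (fun y t' => Q (decide (x ≤ y)) (t + t' + 1))) :=
  runs_op2 (op := fun x y : ℝ => decide (x ≤ y))

@[simp] theorem runs_ltT {a b : Timed ℝ} {Q : Bool → ℕ → Prop} : Runs (ltT a b) Q ↔
    Runs a (fun x t => Runs b (fun y t' => Q (decide (x < y)) (t + t' + 1))) :=
  runs_op2 (op := fun x y : ℝ => decide (x < y))

theorem runs_op1 {op : α → β} {a : Timed α} {Q : β → ℕ → Prop} :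
    Runs ⟨op a.val, a.time + 1⟩ Q ↔ Runs a (fun x t => Q (op x) (t + 1)) := by
  have h := @runs_bind α β a (fun x => step (op x)) Q
  simp only [runs_step] at h
  exact h

@[simp] theorem runs_sqrtT {a : Timed ℝ} : Runs (sqrtT a) Q ↔
    Runs a (fun x t => Q (Real.sqrt x) (t + 1)) := runs_op1

@[simp] theorem runs_ceilT {a : Timed ℝ} {Q : ℕ → ℕ → Prop} : Runs (ceilT a) Q ↔
    Runs a (fun x t => Q ⌈x⌉₊ (t + 1)) := runs_op1

@[simp] theorem runs_ofNatT {k : ℕ} : Runs (ofNatT k) Q ↔ Q k 1 := runs_mk_iff (by simp)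

@[simp] theorem runs_zero : Runs (0 : Timed ℝ) Q ↔ Q 0 0 := by
  rw [show (0 : Timed ℝ) = ⟨((0 : ℕ) : ℝ), 0⟩ from rfl, runs_mk_zero, Nat.cast_zero]

@[simp] theorem runs_one : Runs (1 : Timed ℝ) Q ↔ Q 1 0 := by
  rw [show (1 : Timed ℝ) = ⟨((1 : ℕ) : ℝ), 0⟩ from rfl, runs_mk_zero, Nat.cast_one]

@[simp] theorem runs_two : Runs (2 : Timed ℝ) Q ↔ Q 2 0 := by
  rw [show (2 : Timed ℝ) = ⟨((2 : ℕ) : ℝ), 0⟩ from rfl, runs_mk_zero, Nat.cast_ofNat]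

@[simp] theorem runs_three : Runs (3 : Timed ℝ) Q ↔ Q 3 0 := by
  rw [show (3 : Timed ℝ) = ⟨((3 : ℕ) : ℝ), 0⟩ from rfl, runs_mk_zero, Nat.cast_ofNat]

@[simp] theorem runs_four : Runs (4 : Timed ℝ) Q ↔ Q 4 0 := by
  rw [show (4 : Timed ℝ) = ⟨((4 : ℕ) : ℝ), 0⟩ from rfl, runs_mk_zero, Nat.cast_ofNat]

end Arithmetic

/-- The rule for loops over a list, with an invariant that refers to the elements that are left
and to the time used so far. -/
theorem runs_forT_acc {body : σ → α → Timed σ} {Q : σ → ℕ → Prop}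
    (Inv : List α → σ → ℕ → Prop)
    (hbody : ∀ x l s t, Inv (x :: l) s t →
      Runs (body s x) (fun s' t' => Inv l s' (t + 1 + t')))
    (hnil : ∀ s t, Inv [] s t → Q s (t + 1)) :
    ∀ (l : List α) (s : σ), Inv l s 0 → Runs (forT l s body) Q := by
  have key : ∀ (l : List α) (s : σ) (t : ℕ), Inv l s t →
      Runs (forT l s body) (fun s' t' => Q s' (t + t')) := by
    intro l
    induction l with
    | nil => intro s t h; simpa [forT] using hnil s t h
    | cons x l ih =>
      intro s t h
      simp only [forT, runs_bind, runs_step]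
      refine (hbody x l s t h).mono fun s' t' h' => ?_
      refine (ih s' _ h').mono fun s'' t'' h'' => ?_
      simpa only [add_assoc] using h''
  intro l s h
  simpa only [zero_add] using key l s 0 h

theorem runs_forT {body : σ → α → Timed σ} {Q : σ → ℕ → Prop}
    (k : ℕ) (Inv : List α → σ → Prop) {l : List α} {s : σ}
    (hbody : ∀ x l s, Inv (x :: l) s → Runs (body s x) (fun s' t => Inv l s' ∧ t ≤ k))
    (h0 : Inv l s)
    (hnil : ∀ s t, Inv [] s → t ≤ l.length * (k + 1) + 1 → Q s t) :
    Runs (forT l s body) Q := by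
  refine runs_forT_acc (fun l' s t => Inv l' s ∧ t + l'.length * (k + 1) ≤ l.length * (k + 1))
    ?_ ?_ l s ⟨h0, by simp⟩
  · rintro x l' s t ⟨hs, ht⟩
    refine (hbody x l' s hs).mono ?_
    rintro s' t' ⟨h1, h2⟩
    refine ⟨h1, ?_⟩
    rw [List.length_cons, Nat.succ_mul] at ht
    omega
  · rintro s t ⟨hs, ht⟩
    exact hnil s _ hs (by simp at ht; omega)

theorem runs_forT_mem {body : σ → α → Timed σ} {Q : σ → ℕ → Prop}
    (k : ℕ) (Inv : σ → Prop) {l : List α} {s : σ}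
    (hbody : ∀ x s, x ∈ l → Inv s → Runs (body s x) (fun s' t => Inv s' ∧ t ≤ k))
    (h0 : Inv s)
    (hnil : ∀ s t, Inv s → t ≤ l.length * (k + 1) + 1 → Q s t) :
    Runs (forT l s body) Q := by
  refine runs_forT k (fun l' s => l' ⊆ l ∧ Inv s) ?_ ⟨List.Subset.refl _, h0⟩
    (fun s t h ht => hnil s t h.2 ht)
  rintro x l' s ⟨h1, h2⟩
  refine (hbody x s (h1 List.mem_cons_self) h2).mono fun s' t h => ⟨⟨?_, h.1⟩, h.2⟩
  exact fun y hy => h1 (List.mem_cons_of_mem _ hy)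

/-- The rule for unbounded loops. A bound on the time used so far makes the loop terminate. -/
theorem runs_whileT {cond : σ → Timed Bool} {body : σ → Timed σ} {Q : σ → ℕ → Prop}
    (Inv : σ → ℕ → Prop) (B : ℕ) (hB : ∀ s t, Inv s t → t ≤ B)
    (hstep : ∀ s t, Inv s t → Runs (cond s) (fun b t1 =>
      (b = true → Runs (body s) (fun s' t2 => Inv s' (t + t1 + 1 + t2))) ∧
      (b = false → Q s (t + t1 + 1))))
    {s : σ} (h0 : Inv s 0) : Runs (whileT cond body s) Q := by
  classical
  set it : ℕ → σ := fun k => (fun x => (body x).val)^[k] s with hit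
  have hsucc : ∀ k, it (k + 1) = (body (it k)).val := fun k =>
    Function.iterate_succ_apply' (fun x => (body x).val) k s
  have key : ∀ k, (∀ j < k, (cond (it j)).val = true) → ∃ t : ℕ,
      (∑ i ∈ Finset.range k, ((cond (it i)).time + 1 + (body (it i)).time)) = (t : ℕ∞) ∧
      k ≤ t ∧ Inv (it k) t := by
    intro k
    induction k with
    | zero => intro _; exact ⟨0, by simp, le_rfl, h0⟩
    | succ k ih =>
      intro hk
      obtain ⟨t, ht, hkt, hinv⟩ := ih (fun j hj => hk j (by omega))
      obtain ⟨t1, ht1, hb, -⟩ := hstep _ _ hinv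
      obtain ⟨t2, ht2, hq⟩ := hb (hk k (by omega))
      refine ⟨t + t1 + 1 + t2, ?_, by omega, ?_⟩
      · rw [Finset.sum_range_succ, ht, ht1, ht2]
        push_cast
        ring
      · rw [hsucc]; exact hq
  have hex : ∃ k, (cond (it k)).val = false := by
    by_contra hne
    push Not at hne
    -- Every iteration costs at least one for its test, so `B + 1` iterations would take more time
    -- than the invariant admits.
    obtain ⟨t, -, h1, h2⟩ := key (B + 1) (fun j _ => by simpa using hne j)
    have := hB _ _ h2
    omega
  have hval : whileT cond body s = ⟨it (Nat.find hex),
      (∑ i ∈ Finset.range (Nat.find hex), ((cond (it i)).time + 1 + (body (it i)).time))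
        + ((cond (it (Nat.find hex))).time + 1)⟩ := by
    unfold whileT
    rw [dif_pos hex]
  obtain ⟨t, ht, -, hinv⟩ := key (Nat.find hex) (fun j hj => by
    simpa using Nat.find_min hex hj)
  obtain ⟨t1, ht1, -, hb⟩ := hstep _ _ hinv
  rw [hval]
  refine ⟨t + t1 + 1, ?_, hb (Nat.find_spec hex)⟩
  simp only [ht, ht1]
  push_cast
  ring

/-! ### Arrays and lists -/

theorem runs_alloc {ι : Type} {N : ℕ} {x : α} {Q : (ι → α) → ℕ → Prop}
    (h : ∀ t, t ≤ N + 1 → Q (fun _ => x) t) : Runs (alloc N x) Q := by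
  unfold alloc
  refine runs_forT 0 (fun _ a => a = fun _ => x) ?_ rfl ?_
  · rintro y l s rfl; simp
  · rintro s t rfl ht; exact h t (by simpa using ht)

theorem runs_lenT {l : List α} {Q : ℕ → ℕ → Prop}
    (h : ∀ t, t ≤ l.length + 1 → Q l.length t) : Runs (lenT l) Q := by
  unfold lenT
  refine runs_forT 0 (fun l' k => k + l'.length = l.length) ?_ (by simp) ?_
  · intro y l' s hs
    simp only [runs_pure, le_refl, and_true]
    simp at hs; omega
  · intro s t hs ht
    simp only [List.length_nil, add_zero] at hs
    subst hs
    exact h t (by simpa using ht)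

theorem runs_pushAll {l l' : List α} {Q : List α → ℕ → Prop}
    (h : ∀ t, t ≤ 2 * l.length + 1 → Q (l.reverse ++ l') t) : Runs (pushAll l l') Q := by
  unfold pushAll
  refine runs_forT 1 (fun r acc => r.reverse ++ acc = l.reverse ++ l') ?_ rfl ?_
  · intro y r s hs
    simpa using hs
  · intro s t hs ht
    simp only [List.reverse_nil, List.nil_append] at hs
    subst hs
    exact h t (by omega)

theorem runs_toArr {x₀ : α} {l : List α} {Q : (ℕ → α) → ℕ → Prop}
    (h : ∀ t, t ≤ 2 * l.length + 1 → Q (fun i => l.getD i x₀) t) : Runs (toArr x₀ l) Q := by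
  unfold toArr
  simp only [runs_bind, runs_pure]
  refine runs_forT 1 (fun r s => ∃ p, l = p ++ r ∧ s.1 = p.length ∧
    s.2 = fun i => p.getD i x₀) ?_ ⟨[], by simp⟩ ?_
  · rintro y r ⟨k, a⟩ ⟨p, hp, rfl, rfl⟩
    simp only [runs_bind, runs_wr, runs_pure]
    refine ⟨⟨p ++ [y], by simp [hp], by simp, ?_⟩, by simp⟩
    funext i
    rcases lt_trichotomy i p.length with hi | hi | hi
    · simp [Function.update_of_ne hi.ne, List.getD, List.getElem?_append, hi]
    · subst hi; simp [List.getD]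
    · rw [Function.update_of_ne hi.ne', List.getD_eq_default _ _ hi.le,
        List.getD_eq_default _ _ (by simp; omega)]
  · rintro ⟨k, a⟩ t ⟨p, hp, hk, ha⟩ ht
    simp only [List.append_nil] at hp
    subst hp
    simp only at ha
    subst ha
    simpa using h t (by omega)

end Framework

/-! ### Distances -/

def Pt.toC (p : Pt) : ℂ := ⟨p.x, p.y⟩

theorem Pt.toC_inj {p q : Pt} (h : p.toC = q.toC) : p = q := by
  cases p; cases q
  simpa [Pt.toC, Complex.ext_iff] using h

noncomputable def Pt.dist (p q : Pt) : ℝ :=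
  Real.sqrt ((p.x - q.x) * (p.x - q.x) + (p.y - q.y) * (p.y - q.y))

namespace Pt

theorem dist_eq (p q : Pt) : p.dist q = ‖p.toC - q.toC‖ := by
  rw [Complex.norm_eq_sqrt_sq_add_sq]
  simp [dist, toC, sq]

theorem dist_nonneg (p q : Pt) : 0 ≤ p.dist q := Real.sqrt_nonneg _

theorem dist_comm (p q : Pt) : p.dist q = q.dist p := by
  rw [dist_eq, dist_eq, norm_sub_rev]

theorem dist_self (p : Pt) : p.dist p = 0 := by simp [dist_eq]

theorem dist_triangle (p q r : Pt) : p.dist r ≤ p.dist q + q.dist r := by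
  simp only [dist_eq]; exact norm_sub_le_norm_sub_add_norm_sub _ _ _

theorem eq_of_dist_le_zero {p q : Pt} (h : p.dist q ≤ 0) : p = q := by
  rw [dist_eq] at h
  exact toC_inj (sub_eq_zero.1 (norm_le_zero_iff.1 h))

theorem dist_sq (p q : Pt) : p.dist q ^ 2 = (p.x - q.x) ^ 2 + (p.y - q.y) ^ 2 := by
  rw [dist, Real.sq_sqrt (add_nonneg (mul_self_nonneg _) (mul_self_nonneg _))]; ring

theorem dist_le_of_sq {p q : Pt} {r : ℝ} (hr : 0 ≤ r)
    (h : (p.x - q.x) ^ 2 + (p.y - q.y) ^ 2 ≤ r ^ 2) : p.dist q ≤ r := by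
  rw [← dist_sq] at h
  exact abs_le_of_sq_le_sq' h hr |>.2

/-- The point that divides the segment from `p` to `q` in the ratio `s : 1 - s`. -/
def mix (s : ℝ) (p q : Pt) : Pt := ⟨p.x + s * (q.x - p.x), p.y + s * (q.y - p.y)⟩

theorem toC_mix (s : ℝ) (p q : Pt) : (mix s p q).toC = p.toC + s * (q.toC - p.toC) := by
  simp [mix, toC, Complex.ext_iff]

theorem dist_mix_left {s : ℝ} (hs : 0 ≤ s) (p q : Pt) : p.dist (mix s p q) = s * p.dist q := by
  rw [dist_eq, toC_mix, dist_eq, ← norm_neg,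
    show -(p.toC - (p.toC + s * (q.toC - p.toC))) = s * (q.toC - p.toC) by ring,
    norm_mul, norm_sub_rev q.toC]
  simp [abs_of_nonneg hs]

theorem dist_mix_right {s : ℝ} (hs : s ≤ 1) (p q : Pt) :
    (mix s p q).dist q = (1 - s) * p.dist q := by
  rw [dist_eq, toC_mix, dist_eq,
    show (p.toC + s * (q.toC - p.toC) - q.toC) = ((1 - s : ℝ) : ℂ) * (p.toC - q.toC) by
      push_cast; ring, norm_mul, Complex.norm_real, Real.norm_of_nonneg (by linarith)]

/-- If the end `t` of a segment is not much farther from `o` than from a point `c` of the segment,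
then `c` is not much farther from `o` than the other end. -/
theorem dist_mix_le {o g t : Pt} {s r : ℝ} (h0 : 0 ≤ s) (h1 : s ≤ 1) (hr : 0 ≤ r)
    (h : o.dist t ≤ (mix s g t).dist t + r) : o.dist (mix s g t) ≤ o.dist g + r := by
  rw [dist_mix_right h1] at h
  have hD := dist_nonneg g t
  have hD2 := dist_sq g t
  have ht2 := dist_sq o t
  have hg2 := dist_sq o g
  have hg0 := dist_nonneg o g
  have ht0 := dist_nonneg o t
  generalize g.dist t = D at *
  generalize o.dist t = T at *
  generalize o.dist g = G at *
  apply dist_le_of_sq (by linarith)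
  have hT : T ^ 2 ≤ ((1 - s) * D + r) ^ 2 := pow_le_pow_left₀ ht0 h 2
  simp only [mix]
  rcases eq_or_lt_of_le hD with hD0 | hD0
  · have hx : (g.x - t.x) = 0 := by nlinarith [sq_nonneg (g.x - t.x), sq_nonneg (g.y - t.y)]
    have hy : (g.y - t.y) = 0 := by nlinarith [sq_nonneg (g.x - t.x), sq_nonneg (g.y - t.y)]
    rw [show t.x - g.x = 0 by linarith, show t.y - g.y = 0 by linarith]
    nlinarith
  -- `X` is the component of `c - o` along `t - g`, scaled by `D`
  set X := (g.x + s * (t.x - g.x) - o.x) * (t.x - g.x) +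
    (g.y + s * (t.y - g.y) - o.y) * (t.y - g.y) with hX
  set N := (o.x - (g.x + s * (t.x - g.x))) ^ 2 + (o.y - (g.y + s * (t.y - g.y))) ^ 2 with hN
  have e1 : T ^ 2 = N + 2 * (1 - s) * X + (1 - s) ^ 2 * D ^ 2 := by
    rw [ht2, hD2, hN, hX]; ring
  have e2 : G ^ 2 = N - 2 * s * X + s ^ 2 * D ^ 2 := by
    rw [hg2, hD2, hN, hX]; ring
  have hs1 : 0 ≤ 1 - s := by linarith
  -- If `X ≤ D r`, the formula for `G ^ 2` gives `N ≤ G ^ 2 + 2 s D r - s ^ 2 D ^ 2 ≤ G ^ 2 + r ^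
  -- 2`. If `X > D r`, comparing the formula for `T ^ 2` with `((1 - s) D + r) ^ 2` leaves `N ≤ r ^
  -- 2`.
  rcases le_or_gt X (D * r) with hx | hx
  · have h2 := mul_le_mul_of_nonneg_left hx h0
    have h3 : N ≤ G ^ 2 + r ^ 2 := by linarith [sq_nonneg (s * D - r)]
    linarith [mul_nonneg hg0 hr, add_sq G r]
  · have h2 := mul_le_mul_of_nonneg_left hx.le hs1
    have h3 : N ≤ r ^ 2 := by linarith
    linarith [mul_nonneg hg0 hr, add_sq G r, sq_nonneg G]

end Pt

@[simp] theorem runs_distT {p q : Pt} {Q : ℝ → ℕ → Prop} :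
    Runs (distT p q) Q ↔ Q (p.dist q) 6 := by
  simp [distT, Pt.dist]

@[simp] theorem runs_within {r : ℝ} {p q : Pt} {Q : Bool → ℕ → Prop} :
    Runs (within r p q) Q ↔ Q (decide (p.dist q ≤ r)) 7 := by
  simp [within]

theorem runs_circleInter (r : ℝ) (p q : Pt) :
    Runs (circleInter r p q) (fun l t => l.length ≤ 2 ∧ t ≤ 50) := by
  simp [circleInter]

/-! ### Fermat points -/

noncomputable def dot (a b c : Pt) : ℝ := (b.x - a.x) * (c.x - a.x) + (b.y - a.y) * (c.y - a.y)

noncomputable def crs (a b c : Pt) : ℝ := (b.x - a.x) * (c.y - a.y) - (b.y - a.y) * (c.x - a.x)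

@[simp] theorem runs_wideAngle {a b c : Pt} {Q : Bool → ℕ → Prop} :
    Runs (wideAngle a b c) Q ↔ Q (decide (dot a b c ≤ -(a.dist b * a.dist c / 2))) 23 := by
  simp only [wideAngle, runs_bind, runs_distT, runs_leT, runs_add, runs_mul, runs_sub, runs_mk_zero,
    runs_zero, runs_div, runs_two, zero_sub, dot]
  exact Iff.of_eq (by congr!)

/-- For an angle `θ` at `a` this is `√3 cos θ + |sin θ| > 0`, scaled by the two side lengths, which
holds for `θ < 120°`. The identity `dot ^ 2 + crs ^ 2 = (|ab| |ac|) ^ 2` replaces trigonometry; the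
hypothesis also excludes sides of length zero. -/
theorem narrow_pos {a b c : Pt} (h : ¬ dot a b c ≤ -(a.dist b * a.dist c / 2)) :
    0 < Real.sqrt 3 * dot a b c + |crs a b c| := by
  have h3 : Real.sqrt 3 ^ 2 = 3 := Real.sq_sqrt (by norm_num)
  have h30 : 0 < Real.sqrt 3 := by positivity
  have hid : dot a b c ^ 2 + crs a b c ^ 2 = (a.dist b * a.dist c) ^ 2 := by
    rw [mul_pow, Pt.dist_sq, Pt.dist_sq, dot, crs]; ring
  have hP : 0 ≤ a.dist b * a.dist c := mul_nonneg (Pt.dist_nonneg _ _) (Pt.dist_nonneg _ _)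
  generalize a.dist b * a.dist c = P at *
  generalize dot a b c = d at *
  have hab := abs_nonneg (crs a b c)
  rw [← sq_abs (crs a b c)] at hid
  generalize |crs a b c| = s at *
  push Not at h
  rcases lt_or_ge d 0 with hd | hd
  · by_contra hcon
    push Not at hcon
    have h1 : s ^ 2 ≤ 3 * d ^ 2 := by
      have : s ≤ Real.sqrt 3 * (-d) := by linarith
      calc s ^ 2 ≤ (Real.sqrt 3 * (-d)) ^ 2 := pow_le_pow_left₀ hab this 2
        _ = 3 * d ^ 2 := by rw [mul_pow, h3]; ring
    nlinarith
  · rcases eq_or_lt_of_le hd with hd0 | hd0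
    · subst hd0
      have : 0 < P := by linarith
      have : 0 < s := by
        rcases eq_or_lt_of_le hab with h | h
        · subst h; nlinarith
        · exact h
      linarith [mul_zero (Real.sqrt 3)]
    · nlinarith [mul_pos h30 hd0]

/-- The ball around `o` of radius `r` contains all convex combinations of its points. -/
theorem Pt.dist_bary_le {o a b c z : Pt} {α β γ r : ℝ} (hα : 0 ≤ α) (hβ : 0 ≤ β) (hγ : 0 ≤ γ)
    (hs : 0 < α + β + γ)
    (hx : (α + β + γ) * z.x = α * a.x + β * b.x + γ * c.x)
    (hy : (α + β + γ) * z.y = α * a.y + β * b.y + γ * c.y)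
    (ha : o.dist a ≤ r) (hb : o.dist b ≤ r) (hc : o.dist c ≤ r) : o.dist z ≤ r := by
  have e : ((α + β + γ : ℝ) : ℂ) * (o.toC - z.toC) =
      (α : ℂ) * (o.toC - a.toC) + β * (o.toC - b.toC) + γ * (o.toC - c.toC) := by
    apply Complex.ext
    · simp [Pt.toC]; linarith
    · simp [Pt.toC]; linarith
  have h := congrArg norm e
  rw [norm_mul, Complex.norm_real, Real.norm_of_nonneg hs.le, ← Pt.dist_eq] at h
  have h' : (α + β + γ) * o.dist z ≤ α * o.dist a + β * o.dist b + γ * o.dist c := by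
    rw [h]
    refine (norm_add₃_le).trans ?_
    simp only [norm_mul, Complex.norm_real, Real.norm_of_nonneg hα, Real.norm_of_nonneg hβ,
      Real.norm_of_nonneg hγ, Pt.dist_eq]
    exact le_rfl
  by_contra hcon
  push Not at hcon
  nlinarith [mul_le_mul_of_nonneg_left ha hα, mul_le_mul_of_nonneg_left hb hβ,
    mul_le_mul_of_nonneg_left hc hγ, mul_lt_mul_of_pos_left hcon hs]

/-- The intersection point has barycentric coordinates `1/α : 1/β : 1/γ`, cleared of denominators to
`βγ : αγ : αβ`. If these are positive, the point is a convex combination of the vertices. The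
parameter `τ` will be `√3` or `-√3`, according to the orientation. -/
theorem fermat_inside {a b c : Pt} {τ α β γ D t ux uy vx vy : ℝ}
    (hα : α = τ * dot a b c + crs a b c) (hβ : β = τ * dot b c a + crs a b c)
    (hγ : γ = τ * dot c a b + crs a b c)
    (hux : ux = b.x + (c.x - b.x) / 2 + τ / 2 * (c.y - b.y) - a.x)
    (huy : uy = b.y + (c.y - b.y) / 2 - τ / 2 * (c.x - b.x) - a.y)
    (hvx : vx = c.x + (a.x - c.x) / 2 + τ / 2 * (a.y - c.y) - b.x)
    (hvy : vy = c.y + (a.y - c.y) / 2 - τ / 2 * (a.x - c.x) - b.y)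
    (hD : D = ux * vy - uy * vx)
    (ht : t = ((b.x - a.x) * vy - (b.y - a.y) * vx) / D)
    (h1 : 0 < β * γ) (h2 : 0 < α * γ) (h3 : 0 < α * β)
    {o : Pt} {r : ℝ} (ha : o.dist a ≤ r) (hb : o.dist b ≤ r) (hc : o.dist c ≤ r) :
    o.dist ⟨a.x + t * ux, a.y + t * uy⟩ ≤ r := by
  have hsum : β * γ + α * γ + α * β = 4 * crs a b c * D := by
    rw [hD, hα, hβ, hγ, hux, huy, hvx, hvy, dot, dot, dot, crs]; ring
  -- The sum of the coordinates is positive and a multiple of `D`, so the two lines do intersect.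
  have hD0 : D ≠ 0 := by
    rintro h
    rw [h] at hsum
    linarith
  have htD : t * D = α / 2 := by
    rw [ht, div_mul_cancel₀ _ hD0, hα, hvx, hvy, dot, crs]; ring
  have hx : 2 * crs a b c * ux = γ * (b.x - a.x) + β * (c.x - a.x) := by
    rw [hux, hβ, hγ, dot, dot, crs]; ring
  have hy : 2 * crs a b c * uy = γ * (b.y - a.y) + β * (c.y - a.y) := by
    rw [huy, hβ, hγ, dot, dot, crs]; ring
  refine Pt.dist_bary_le h1.le h2.le h3.le (by linarith) ?_ ?_ ha hb hc
  · simp only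
    linear_combination (t * ux) * hsum + 4 * crs a b c * ux * htD + α * hx
  · simp only
    linear_combination (t * uy) * hsum + 4 * crs a b c * uy * htD + α * hy

theorem crs_rotate (a b c : Pt) : crs b c a = crs a b c := by simp only [crs]; ring

/-- Containment in every ball around the three vertices is all that the running time requires of a
Fermat point. -/
theorem runs_fermat (a b c : Pt) : Runs (fermat a b c) (fun f t => t ≤ 200 ∧
    ∀ (o : Pt) (r : ℝ), o.dist a ≤ r → o.dist b ≤ r → o.dist c ≤ r → o.dist f ≤ r) := by
  have hA := @narrow_pos a b c
  have hB := @narrow_pos b c a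
  have hC := @narrow_pos c a b
  rw [crs_rotate] at hB
  rw [← crs_rotate] at hC
  simp only [fermat, runs_bind, runs_wideAngle, runs_ite, runs_pure, decide_eq_true_eq]
  refine ⟨fun _ => ⟨by norm_num, fun o r h _ _ => h⟩, fun ha => ⟨fun _ => ⟨by norm_num,
    fun o r _ h _ => h⟩, fun hb => ⟨fun _ => ⟨by norm_num, fun o r _ _ h => h⟩, fun hc => ?_⟩⟩⟩
  specialize hA ha
  specialize hB hb
  specialize hC hc
  simp only [apex, runs_ltT, runs_sub, runs_mul, runs_add, runs_mk_zero, runs_bind, runs_zero,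
    runs_one, runs_two, runs_three, runs_sqrtT, runs_div, runs_pure, decide_eq_true_eq]
  constructor
  · intro h
    have hS : 0 < crs a b c := h
    rw [abs_of_pos hS] at hA hB hC
    refine ⟨by norm_num, fun o r h1 h2 h3 => ?_⟩
    refine fermat_inside (τ := Real.sqrt 3) rfl rfl rfl ?_ ?_ ?_ ?_ rfl rfl
      (mul_pos hB hC) (mul_pos hA hC) (mul_pos hA hB) h1 h2 h3 <;> ring
  · intro h
    have hS : crs a b c ≤ 0 := not_lt.1 h
    rw [abs_of_nonpos hS] at hA hB hC
    refine ⟨by norm_num, fun o r h1 h2 h3 => ?_⟩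
    -- Here `α`, `β`, `γ` are all negative, so their pairwise products are positive as before.
    refine fermat_inside (τ := -Real.sqrt 3) rfl rfl rfl ?_ ?_ ?_ ?_ rfl rfl
      (mul_pos_of_neg_of_neg ?_ ?_) (mul_pos_of_neg_of_neg ?_ ?_) (mul_pos_of_neg_of_neg ?_ ?_)
      h1 h2 h3 <;> first | ring1 | linarith

/-! ### Steps towards a point -/

theorem runs_advance {r : ℝ} (hr : 0 < r) (p q : Pt) : Runs (advance r p q) (fun z t =>
    t ≤ 30 ∧ p.dist z ≤ r ∧ (z.dist q ≤ max 0 (p.dist q - r)) ∧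
      ∃ s, 0 ≤ s ∧ s ≤ 1 ∧ z = Pt.mix s p q) := by
  simp only [advance, runs_bind, runs_distT, runs_leT, runs_mk_zero, runs_ite, runs_pure,
    decide_eq_true_eq, runs_add, runs_mul, runs_sub, runs_div]
  constructor
  · intro h
    exact ⟨by norm_num, h, by simp [Pt.dist_self], 1, by norm_num, le_rfl, by simp [Pt.mix]⟩
  · intro h
    push Not at h
    have hD : 0 < p.dist q := hr.trans h
    have e : (⟨p.x + r * (q.x - p.x) / p.dist q, p.y + r * (q.y - p.y) / p.dist q⟩ : Pt) =
        Pt.mix (r / p.dist q) p q := by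
      simp only [Pt.mix, Pt.mk.injEq]
      constructor <;> ring
    have hs : r / p.dist q ≤ 1 := (div_le_one hD).2 h.le
    refine ⟨by norm_num, ?_, ?_, r / p.dist q, by positivity, hs, e⟩
    · rw [e, Pt.dist_mix_left (by positivity), div_mul_cancel₀ _ hD.ne']
    · rw [e, Pt.dist_mix_right hs, sub_mul, div_mul_cancel₀ _ hD.ne', one_mul]
      exact le_max_right _ _

theorem runs_nearest (sink : Pt) (L : List Pt) (p : Pt) : Runs (nearest sink L p) (fun b t =>
    t ≤ 8 * L.length + 7 ∧ b.1 ∈ sink :: L ∧ b.2 = b.1.dist p) := by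
  simp only [nearest, runs_bind, runs_distT]
  refine runs_forT_mem 7 (fun b : Pt × ℝ => b.1 ∈ sink :: L ∧ b.2 = b.1.dist p) ?_ ?_ ?_
  · rintro x s hx ⟨h1, h2⟩
    simp only [runs_bind, runs_distT, runs_ltT, runs_mk_zero, runs_pure]
    refine ⟨?_, by norm_num⟩
    split
    · exact ⟨List.mem_cons_of_mem _ hx, rfl⟩
    · exact ⟨h1, h2⟩
  · simp
  · rintro s t h ht
    exact ⟨by omega, h⟩

/-! ### Neighbors in a Voronoi diagram -/

namespace Pt

noncomputable def sqd (p q : Pt) : ℝ := (p.x - q.x) ^ 2 + (p.y - q.y) ^ 2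

/-- `w` is equally far from `p` and `q`, and strictly farther from all other points of `S`. -/
def Witness (S : Set Pt) (p q w : Pt) : Prop :=
  w.sqd p = w.sqd q ∧ ∀ r ∈ S, r ≠ p → r ≠ q → w.sqd p < w.sqd r

theorem Witness.symm {S : Set Pt} {p q w : Pt} (h : Witness S p q w) : Witness S q p w :=
  ⟨h.1.symm, fun r hr h1 h2 => h.1 ▸ h.2 r hr h2 h1⟩

theorem Witness.le {S : Set Pt} {p q w r : Pt} (h : Witness S p q w) (hr : r ∈ S) :
    w.sqd p ≤ w.sqd r := by
  by_cases h1 : r = p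
  · rw [h1]
  by_cases h2 : r = q
  · rw [h2, h.1]
  exact (h.2 r hr h1 h2).le

theorem sq_add_sq_pos_of_dot_pos {ux uy vx vy : ℝ} (hd : 0 < ux * vx + uy * vy) :
    0 < ux ^ 2 + uy ^ 2 := by
  rcases eq_or_ne ux 0 with h | h
  · rcases eq_or_ne uy 0 with h' | h'
    · subst h h'
      simp at hd
    · positivity
  · positivity

/-- The circle with center `z` through the origin and `u` meets the ray of `u` only up to `u`. A
parallel vector `v` of the same direction that ends outside the circle is therefore longer than `u`.
-/
theorem sq_lt_dot_of_cross_eq_zero {ux uy vx vy zx zy : ℝ} (hd : 0 < ux * vx + uy * vy)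
    (hc : ux * vy - uy * vx = 0) (f1 : ux ^ 2 + uy ^ 2 = 2 * (ux * zx + uy * zy))
    (f2 : 2 * (vx * zx + vy * zy) < vx ^ 2 + vy ^ 2) :
    ux ^ 2 + uy ^ 2 < ux * vx + uy * vy := by
  have hu := sq_add_sq_pos_of_dot_pos hd
  have g1 : (ux ^ 2 + uy ^ 2) * (vx ^ 2 + vy ^ 2) =
      (ux * vx + uy * vy) * (ux * vx + uy * vy) := by
    linear_combination (ux * vy - uy * vx) * hc
  have g2 : (ux ^ 2 + uy ^ 2) * (2 * (vx * zx + vy * zy)) =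
      (ux * vx + uy * vy) * (ux ^ 2 + uy ^ 2) := by
    linear_combination 2 * (ux * zy - uy * zx) * hc - (ux * vx + uy * vy) * f1
  have g3 := mul_lt_mul_of_pos_left f2 hu
  rw [g1, g2] at g3
  exact lt_of_mul_lt_mul_left g3 hd.le

/-- Two vectors `v` and `w` from the ends of a base `u`, that point to the same side of it, beyond
the circle through both ends of `u`, and that form an acute angle, intersect. -/
theorem crossing_ratio {ux uy vx vy wx wy zx zy σ K a b a' b' c : ℝ} (hσ : σ ^ 2 = 1)
    (hK : K = ux ^ 2 + uy ^ 2) (ha : a = ux * vx + uy * vy)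
    (hb : b = σ * (ux * vy - uy * vx)) (ha' : a' = ux * wx + uy * wy)
    (hb' : b' = -(σ * (ux * wy - uy * wx))) (hcc : c = σ * (ux * zy - uy * zx))
    (ap : 0 < a) (ap' : 0 < a') (bp : 0 < b) (bp' : 0 < b') (cp : 0 ≤ c)
    (hz : 2 * (ux * zx + uy * zy) = K) (hvz : 2 * (vx * zx + vy * zy) < vx ^ 2 + vy ^ 2)
    (hwz : 2 * (wx * (ux - zx) + wy * (uy - zy)) < wx ^ 2 + wy ^ 2)
    (hvw : 0 < vx * wx + vy * wy) :
    0 < K ∧ K * b' < a * b' + b * a' ∧ K * b < a * b' + b * a' := by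
  have hKp : 0 < K := by
    rw [hK]
    rw [ha] at ap
    exact sq_add_sq_pos_of_dot_pos ap
  -- `K (v · w) = a a' - b b'`, and the angle between `v` and `w` is acute.
  have hbb : b * b' < a * a' := by
    have e : a * a' - b * b' = K * (vx * wx + vy * wy) := by
      rw [ha, ha', hb, hb', hK]
      linear_combination (ux * vy - uy * vx) * (ux * wy - uy * wx) * hσ
    linarith [mul_pos hKp hvw]
  -- Since the center of the circle lies on the side of `v`, the end of `v` is also outside the
  -- circle with diameter `u`, that is, `u · v < |v| ^ 2`.
  have r1 : a * K < a ^ 2 + b ^ 2 := by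
    have e1 : K * (vx ^ 2 + vy ^ 2) = a ^ 2 + b ^ 2 := by
      rw [ha, hb, hK]
      linear_combination (-(ux * vy - uy * vx) ^ 2) * hσ
    have e2 : K * (2 * (vx * zx + vy * zy)) = a * K + 2 * b * c := by
      rw [ha, hb, hcc]
      linear_combination (-2 * (ux * vy - uy * vx) * (ux * zy - uy * zx)) * hσ +
        (2 * (vx * zx + vy * zy)) * hK + (ux * vx + uy * vy) * hz
    have := mul_lt_mul_of_pos_left hvz hKp
    rw [e1, e2] at this
    linarith [mul_nonneg bp.le cp]
  have r2 : a' * K < a' ^ 2 + b' ^ 2 := by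
    have e1 : K * (wx ^ 2 + wy ^ 2) = a' ^ 2 + b' ^ 2 := by
      rw [ha', hb', hK]
      linear_combination (-(ux * wy - uy * wx) ^ 2) * hσ
    have e2 : K * (2 * (wx * (ux - zx) + wy * (uy - zy))) = a' * K + 2 * b' * c := by
      rw [ha', hb', hcc]
      linear_combination (2 * (ux * wy - uy * wx) * (ux * zy - uy * zx)) * hσ +
        (-2 * (wx * zx + wy * zy)) * hK - (ux * wx + uy * wy) * hz
    have := mul_lt_mul_of_pos_left hwz hKp
    rw [e1, e2] at this
    linarith [mul_nonneg bp'.le cp]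
  -- `a K b' < (a ^ 2 + b ^ 2) b' < a (a b' + b a')`, where the second inequality uses `b b' < a
  -- a'`; likewise with the roles exchanged.
  refine ⟨hKp, lt_of_mul_lt_mul_left (a := a) ?_ ap.le, lt_of_mul_lt_mul_left (a := a') ?_ ap'.le⟩
  · linarith [mul_lt_mul_of_pos_right r1 bp', mul_lt_mul_of_pos_left hbb bp]
  · linarith [mul_lt_mul_of_pos_right r2 bp, mul_lt_mul_of_pos_left hbb bp']

/-- Delaunay edges do not overlap. -/
theorem not_collinear_of_witness {S : Set Pt} {o a b w₁ w₂ : Pt} (h₁ : Witness S o a w₁)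
    (h₂ : Witness S o b w₂) (ha : a ∈ S) (hb : b ∈ S) (hao : a ≠ o) (hbo : b ≠ o) (hab : a ≠ b)
    (hdot : 0 < dot o a b) : crs o a b ≠ 0 := by
  intro hc
  have e1 := h₁.1
  have e2 := h₁.2 b hb hbo hab.symm
  have e3 := h₂.1
  have e4 := h₂.2 a ha hao hab
  simp only [sqd, dot, crs] at *
  obtain ⟨ux, hux⟩ : ∃ ux, ux = a.x - o.x := ⟨_, rfl⟩
  obtain ⟨uy, huy⟩ : ∃ uy, uy = a.y - o.y := ⟨_, rfl⟩
  obtain ⟨vx, hvx⟩ : ∃ vx, vx = b.x - o.x := ⟨_, rfl⟩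
  obtain ⟨vy, hvy⟩ : ∃ vy, vy = b.y - o.y := ⟨_, rfl⟩
  obtain ⟨zx, hzx⟩ : ∃ z, z = w₁.x - o.x := ⟨_, rfl⟩
  obtain ⟨zy, hzy⟩ : ∃ z, z = w₁.y - o.y := ⟨_, rfl⟩
  obtain ⟨yx, hyx⟩ : ∃ z, z = w₂.x - o.x := ⟨_, rfl⟩
  obtain ⟨yy, hyy⟩ : ∃ z, z = w₂.y - o.y := ⟨_, rfl⟩
  rw [← hux, ← huy, ← hvx, ← hvy] at hdot hc
  have f1 : ux ^ 2 + uy ^ 2 = 2 * (ux * zx + uy * zy) := by subst_vars; linarith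
  have f2 : 2 * (vx * zx + vy * zy) < vx ^ 2 + vy ^ 2 := by subst_vars; linarith
  have f3 : vx ^ 2 + vy ^ 2 = 2 * (vx * yx + vy * yy) := by subst_vars; linarith
  have f4 : 2 * (ux * yx + uy * yy) < ux ^ 2 + uy ^ 2 := by subst_vars; linarith
  -- Each vector would be shorter than the other: the two strict bounds multiply to `|u|² |v|² < (u
  -- · v)²`, whereas equality holds for parallel vectors.
  have k1 := sq_lt_dot_of_cross_eq_zero hdot hc f1 f2
  have k2 := sq_lt_dot_of_cross_eq_zero (by linarith) (by linarith) f3 f4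
  have k3 := mul_lt_mul'' k1 k2 (by positivity) (by positivity)
  have k4 : (ux ^ 2 + uy ^ 2) * (vx ^ 2 + vy ^ 2) =
      (ux * vx + uy * vy) * (vx * ux + vy * uy) := by
    linear_combination (ux * vy - uy * vx) * hc
  exact k3.ne k4

/-- Delaunay edges do not cross. -/
theorem no_crossing {S : Set Pt} {p q p' q' w₁ w₂ w₃ : Pt} {σ : ℝ} (hσ : σ ^ 2 = 1)
    (hp : p ∈ S) (hq : q ∈ S) (hp' : p' ∈ S) (hq' : q' ∈ S)
    (h₁ : Witness S p q w₁) (h₂ : Witness S p q' w₂) (h₃ : Witness S p' q w₃)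
    (hside : 0 ≤ σ * crs p q w₁)
    (hd₁ : 0 < (q.x - p.x) * (q'.x - p.x) + (q.y - p.y) * (q'.y - p.y))
    (hd₂ : 0 < (q.x - p.x) * (q.x - p'.x) + (q.y - p.y) * (q.y - p'.y))
    (hd₃ : 0 < (q'.x - p.x) * (q.x - p'.x) + (q'.y - p.y) * (q.y - p'.y))
    (hc₁ : 0 < σ * crs p q q') (hc₂ : 0 < σ * crs p q p') : False := by
  have hqp : q ≠ p := by rintro rfl; simp [crs] at hc₁
  have hq'q : q' ≠ q := by rintro rfl; rw [crs] at hc₁; ring_nf at hc₁; exact hc₁.false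
  have hq'p : q' ≠ p := by rintro rfl; simp [crs] at hc₁
  have hp'q : p' ≠ q := by rintro rfl; rw [crs] at hc₂; ring_nf at hc₂; exact hc₂.false
  have hp'p : p' ≠ p := by rintro rfl; simp [crs] at hc₂
  have a1 := h₁.1
  have a2 := h₁.2 q' hq' hq'p hq'q
  have a3 := h₁.2 p' hp' hp'p hp'q
  have b1 := h₂.1
  have b2 := h₂.2 q hq hqp hq'q.symm
  have b3 := h₂.le hp'
  have c1 := h₃.1
  have c2 := h₃.2 p hp hp'p.symm hqp.symm
  have c3 := h₃.le hq'
  simp only [sqd, crs] at *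
  obtain ⟨ux, hux⟩ : ∃ ux, ux = q.x - p.x := ⟨_, rfl⟩
  obtain ⟨uy, huy⟩ : ∃ uy, uy = q.y - p.y := ⟨_, rfl⟩
  obtain ⟨vx, hvx⟩ : ∃ vx, vx = q'.x - p.x := ⟨_, rfl⟩
  obtain ⟨vy, hvy⟩ : ∃ vy, vy = q'.y - p.y := ⟨_, rfl⟩
  obtain ⟨wx, hwx⟩ : ∃ w, w = q.x - p'.x := ⟨_, rfl⟩
  obtain ⟨wy, hwy⟩ : ∃ w, w = q.y - p'.y := ⟨_, rfl⟩
  obtain ⟨zx, hzx⟩ : ∃ z, z = w₁.x - p.x := ⟨_, rfl⟩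
  obtain ⟨zy, hzy⟩ : ∃ z, z = w₁.y - p.y := ⟨_, rfl⟩
  obtain ⟨K, hK⟩ : ∃ K, K = ux ^ 2 + uy ^ 2 := ⟨_, rfl⟩
  obtain ⟨a, ha⟩ : ∃ a, a = ux * vx + uy * vy := ⟨_, rfl⟩
  obtain ⟨b, hb⟩ : ∃ b, b = σ * (ux * vy - uy * vx) := ⟨_, rfl⟩
  obtain ⟨a', ha'⟩ : ∃ a', a' = ux * wx + uy * wy := ⟨_, rfl⟩
  obtain ⟨b', hb'⟩ : ∃ b', b' = -(σ * (ux * wy - uy * wx)) := ⟨_, rfl⟩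
  obtain ⟨c, hcc⟩ : ∃ c, c = σ * (ux * zy - uy * zx) := ⟨_, rfl⟩
  have ap : 0 < a := by rw [ha, hux, huy, hvx, hvy]; exact hd₁
  have ap' : 0 < a' := by rw [ha', hux, huy, hwx, hwy]; exact hd₂
  have bp : 0 < b := by rw [hb, hux, huy, hvx, hvy]; exact hc₁
  have bp' : 0 < b' := by rw [hb', hux, huy, hwx, hwy]; linarith
  have cp : 0 ≤ c := by rw [hcc, hux, huy, hzx, hzy]; exact hside
  have hz : 2 * (ux * zx + uy * zy) = K := by rw [hK]; subst_vars; linarith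
  have hvz : 2 * (vx * zx + vy * zy) < vx ^ 2 + vy ^ 2 := by subst_vars; linarith
  have hwz : 2 * (wx * (ux - zx) + wy * (uy - zy)) < wx ^ 2 + wy ^ 2 := by subst_vars; linarith
  have hvw : 0 < vx * wx + vy * wy := by subst_vars; exact hd₃
  obtain ⟨hKp, s1, s2⟩ := crossing_ratio hσ hK ha hb ha' hb' hcc ap ap' bp bp' cp hz hvz hwz hvw
  -- Division by `a * b' + b * a'` writes `u` as `s v + t w` with `s` and `t` between 0 and 1, so
  -- the segments `p q'` and `p' q` meet.
  have X : (a * b' + b * a') * ux = K * (b' * vx + b * wx) := by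
    rw [ha, ha', hb, hb', hK]; ring
  have Y : (a * b' + b * a') * uy = K * (b' * vy + b * wy) := by
    rw [ha, ha', hb, hb', hK]; ring
  -- The difference of the powers with respect to the circles around `w₂` through `p` and around
  -- `w₃` through `p'`. The quadratic terms cancel, so `F` is affine. Empty circles make it negative
  -- at `p` and nonpositive at `q'`, positive at `q` and nonnegative at `p'`; at the common point of
  -- the segments it would have both signs.
  obtain ⟨F, hF⟩ : ∃ F : Pt → ℝ, ∀ z, F z = ((w₂.x - z.x) ^ 2 + (w₂.y - z.y) ^ 2 -
    ((w₂.x - p.x) ^ 2 + (w₂.y - p.y) ^ 2)) - ((w₃.x - z.x) ^ 2 + (w₃.y - z.y) ^ 2 -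
    ((w₃.x - p'.x) ^ 2 + (w₃.y - p'.y) ^ 2)) := ⟨_, fun _ => rfl⟩
  have Fp : F p < 0 := by rw [hF]; linarith
  have Fq' : F q' ≤ 0 := by rw [hF]; linarith
  have Fq : 0 < F q := by rw [hF]; linarith
  have Fp' : 0 ≤ F p' := by rw [hF]; linarith
  have hlin : (a * b' + b * a' - K * b') * F p + K * b' * F q' =
      (a * b' + b * a' - K * b) * F q + K * b * F p' := by
    rw [hF, hF, hF, hF]
    rw [hux, hvx, hwx] at X
    rw [huy, hvy, hwy] at Y
    linear_combination 2 * (w₂.x - w₃.x) * X + 2 * (w₂.y - w₃.y) * Y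
  linarith [mul_pos (sub_pos.2 s1) (neg_pos.2 Fp), mul_pos (sub_pos.2 s2) Fq,
    mul_nonneg (mul_pos hKp bp').le (neg_nonneg.2 Fq'), mul_nonneg (mul_pos hKp bp).le Fp']

end Pt

/-! ### The number of triangles of Delaunay edges -/

namespace Pt

/-- The edge from `p` to `q` has a direction in a certain quadrant, and the center of an empty
circle through `p` and `q` on a certain side. -/
def Edge (S : Set Pt) (dir : Pt → Pt → Prop) (σ : ℝ) (p q : Pt) : Prop :=
  p ∈ S ∧ q ∈ S ∧ dir p q ∧ ∃ w, Witness S p q w ∧ 0 ≤ σ * crs p q w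

def TopAtStart (S : Set Pt) (dir : Pt → Pt → Prop) (σ : ℝ) (p q : Pt) : Prop :=
  Edge S dir σ p q ∧ ∀ q', Edge S dir σ p q' → σ * crs p q q' ≤ 0

def TopAtEnd (S : Set Pt) (dir : Pt → Pt → Prop) (σ : ℝ) (q p : Pt) : Prop :=
  Edge S dir σ p q ∧ ∀ p', Edge S dir σ p' q → σ * crs p q p' ≤ 0

/-- Two vectors of the same class form an acute angle. -/
def IsQuadrant (dir : Pt → Pt → Prop) : Prop :=
  ∀ p q p' q', dir p q → dir p' q' →
    0 < (q.x - p.x) * (q'.x - p'.x) + (q.y - p.y) * (q'.y - p'.y)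

theorem IsQuadrant.ne {dir : Pt → Pt → Prop} (h : IsQuadrant dir) {p q : Pt} (hpq : dir p q) :
    p ≠ q := by
  rintro rfl
  have := h _ _ _ _ hpq hpq
  simp at this

/-- Otherwise an edge from `p` and an edge into `q` both lie beyond the edge `p q`, on the side of
its circle center, and these two would cross. -/
theorem Edge.top {S : Set Pt} {dir : Pt → Pt → Prop} {σ : ℝ} {p q : Pt} (hdir : IsQuadrant dir)
    (hσ : σ ^ 2 = 1) (h : Edge S dir σ p q) :
    TopAtStart S dir σ p q ∨ TopAtEnd S dir σ q p := by
  by_contra hcon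
  simp only [not_or, TopAtStart, TopAtEnd, h, true_and, not_forall, not_le] at hcon
  obtain ⟨⟨q', hq', h1⟩, ⟨p', hp', h2⟩⟩ := hcon
  obtain ⟨hp, hq, d1, w₁, hw₁, hs⟩ := h
  obtain ⟨-, hq'S, d2, w₂, hw₂, -⟩ := hq'
  obtain ⟨hp'S, -, d3, w₃, hw₃, -⟩ := hp'
  exact no_crossing hσ hp hq hp'S hq'S hw₁ hw₂ hw₃ hs (hdir _ _ _ _ d1 d2) (hdir _ _ _ _ d1 d3)
    (hdir _ _ _ _ d2 d3) h1 h2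

/-- Two extreme edges at the same vertex are not beyond each other, hence collinear and in the same
direction, which empty circles forbid. -/
theorem TopAtStart.unique {S : Set Pt} {dir : Pt → Pt → Prop} {σ : ℝ} {p a b : Pt}
    (hdir : IsQuadrant dir) (hσ : σ ^ 2 = 1) (ha : TopAtStart S dir σ p a)
    (hb : TopAtStart S dir σ p b) : a = b := by
  by_contra hne
  have h1 := ha.2 b hb.1
  have h2 := hb.2 a ha.1
  obtain ⟨⟨hp, haS, d1, w₁, hw₁, -⟩, -⟩ := ha
  obtain ⟨⟨-, hbS, d2, w₂, hw₂, -⟩, -⟩ := hb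
  refine not_collinear_of_witness hw₁ hw₂ haS hbS (hdir.ne d1).symm (hdir.ne d2).symm hne
    (hdir _ _ _ _ d1 d2) ?_
  have e : crs p b a = -crs p a b := by simp only [crs]; ring
  rw [e] at h2
  have h0 : σ * crs p a b = 0 := by linarith
  rcases mul_eq_zero.1 h0 with h | h
  · rw [h] at hσ; norm_num at hσ
  · exact h

theorem TopAtEnd.unique {S : Set Pt} {dir : Pt → Pt → Prop} {σ : ℝ} {q a b : Pt}
    (hdir : IsQuadrant dir) (hσ : σ ^ 2 = 1) (ha : TopAtEnd S dir σ q a)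
    (hb : TopAtEnd S dir σ q b) : a = b := by
  by_contra hne
  have h1 := ha.2 b hb.1
  have h2 := hb.2 a ha.1
  obtain ⟨⟨haS, hq, d1, w₁, hw₁, -⟩, -⟩ := ha
  obtain ⟨⟨hbS, -, d2, w₂, hw₂, -⟩, -⟩ := hb
  have hd := hdir _ _ _ _ d1 d2
  refine not_collinear_of_witness hw₁.symm hw₂.symm haS hbS (hdir.ne d1) (hdir.ne d2) hne
    (by rw [dot]; linarith) ?_
  have e1 : crs a q b = -crs q a b := by simp only [crs]; ring
  have e2 : crs b q a = crs q a b := by simp only [crs]; ring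
  rw [e1] at h1
  rw [e2] at h2
  have h0 : σ * crs q a b = 0 := by linarith
  rcases mul_eq_zero.1 h0 with h | h
  · rw [h] at hσ; norm_num at hσ
  · exact h

/-- The two classes of directions: to the right or up-right, and up or up-left. -/
def quadrant (b : Bool) (p q : Pt) : Prop :=
  if b then 0 < q.x - p.x ∧ 0 ≤ q.y - p.y else q.x - p.x ≤ 0 ∧ 0 < q.y - p.y

theorem isQuadrant_quadrant (b : Bool) : IsQuadrant (quadrant b) := by
  rintro p q p' q' h1 h2
  cases b
  · simp only [quadrant, Bool.false_eq_true, if_false] at h1 h2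
    nlinarith [mul_pos h1.2 h2.2, mul_nonneg_of_nonpos_of_nonpos h1.1 h2.1]
  · simp only [quadrant, if_true] at h1 h2
    nlinarith [mul_pos h1.1 h2.1, mul_nonneg h1.2 h2.2]

theorem exists_quadrant {p q : Pt} (h : p ≠ q) : ∃ b, quadrant b p q ∨ quadrant b q p := by
  have hne : q.x - p.x ≠ 0 ∨ q.y - p.y ≠ 0 := by
    by_contra hcon
    push Not at hcon
    apply h
    cases p; cases q
    simp only [mk.injEq]
    constructor <;> simp at hcon <;> linarith
  rcases lt_trichotomy (q.x - p.x) 0 with hx | hx | hx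
  · rcases le_or_gt (q.y - p.y) 0 with hy | hy
    · exact ⟨true, Or.inr (by simp only [quadrant, if_true]; constructor <;> linarith)⟩
    · exact ⟨false, Or.inl (by
        simp only [quadrant, Bool.false_eq_true, if_false]; constructor <;> linarith)⟩
  · rcases lt_trichotomy (q.y - p.y) 0 with hy | hy | hy
    · exact ⟨false, Or.inr (by
        simp only [quadrant, Bool.false_eq_true, if_false]; constructor <;> linarith)⟩
    · exact absurd hy (hne.resolve_left (by simp [hx]))
    · exact ⟨false, Or.inl (by
        simp only [quadrant, Bool.false_eq_true, if_false]; constructor <;> linarith)⟩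
  · rcases lt_or_ge (q.y - p.y) 0 with hy | hy
    · exact ⟨false, Or.inr (by
        simp only [quadrant, Bool.false_eq_true, if_false]; constructor <;> linarith)⟩
    · exact ⟨true, Or.inl (by simp only [quadrant, if_true]; constructor <;> linarith)⟩

noncomputable def sgn (b : Bool) : ℝ := if b then 1 else -1

/-- Is `q` the other end of the edge that is assigned to `p` in the slot `c`? -/
def Slot (S : Set Pt) (c : Bool × Bool × Bool) (p q : Pt) : Prop :=
  if c.1 then TopAtStart S (quadrant c.2.1) (sgn c.2.2) p q
  else TopAtEnd S (quadrant c.2.1) (sgn c.2.2) p q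

theorem Slot.unique {S : Set Pt} {c : Bool × Bool × Bool} {p a b : Pt} (ha : Slot S c p a)
    (hb : Slot S c p b) : a = b := by
  have hσ : sgn c.2.2 ^ 2 = 1 := by rw [sgn]; split <;> norm_num
  unfold Slot at ha hb
  split at ha
  · rename_i h
    rw [if_pos h] at hb
    exact ha.unique (isQuadrant_quadrant _) hσ hb
  · rename_i h
    rw [if_neg h] at hb
    exact ha.unique (isQuadrant_quadrant _) hσ hb

/-- The slots record the direction class, the side of the circle center, and whether the edge is
extreme at its start or at its end. The two classes cover a half-plane of directions, and reversing
the edge covers the other half. -/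
theorem exists_slot {S : Set Pt} {p q w : Pt} (hp : p ∈ S) (hq : q ∈ S) (hpq : p ≠ q)
    (hw : Witness S p q w) : ∃ c, Slot S c p q ∨ Slot S c q p := by
  have key : ∀ {p q : Pt} {b : Bool}, p ∈ S → q ∈ S → Witness S p q w → quadrant b p q →
      ∃ c, Slot S c p q ∨ Slot S c q p := by
    intro p q b hp hq hw hb
    obtain ⟨s, hs⟩ : ∃ s, 0 ≤ sgn s * crs p q w := by
      rcases le_total 0 (crs p q w) with h | h
      · exact ⟨true, by simpa [sgn] using h⟩
      · exact ⟨false, by simpa [sgn] using h⟩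
    have hσ : sgn s ^ 2 = 1 := by rw [sgn]; split <;> norm_num
    have hE : Edge S (quadrant b) (sgn s) p q := ⟨hp, hq, hb, w, hw, hs⟩
    rcases hE.top (isQuadrant_quadrant _) hσ with h | h
    · exact ⟨(true, b, s), Or.inl (by simpa [Slot] using h)⟩
    · exact ⟨(false, b, s), Or.inr (by simpa [Slot] using h)⟩
  obtain ⟨b, h | h⟩ := exists_quadrant hpq
  · exact key hp hq hw h
  · obtain ⟨c, hc⟩ := key hq hp hw.symm h
    exact ⟨c, hc.symm⟩

end Pt

/-- If the edges of a graph are assigned to slots of their ends, `8` slots per vertex, then the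
graph has at most `64 k` triangles. -/
theorem card_triangles_le {k : ℕ} {adj : ℕ → ℕ → Prop} (f : Bool × Bool × Bool → ℕ → ℕ)
    (hf : ∀ i j, adj i j → ∃ c, f c i = j ∨ f c j = i) (T : Finset (ℕ × ℕ × ℕ))
    (hT : ∀ x ∈ T, x.1 < x.2.1 ∧ x.2.1 < x.2.2 ∧ x.2.2 < k ∧ adj x.1 x.2.1 ∧ adj x.2.1 x.2.2 ∧
      adj x.1 x.2.2) : T.card ≤ 64 * k := by
  let D : Finset (ℕ × (Bool × Bool × Bool) × (Bool × Bool × Bool)) :=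
    Finset.range k ×ˢ Finset.univ ×ˢ Finset.univ
  have hD : D.card = 64 * k := by
    simp [D, Finset.card_product]
    ring
  -- Orient every edge away from a vertex in whose slot it lies. In any orientation of a triangle
  -- two edges form a directed path `x → y → z`, which is determined by `x` and two slots: `k * 8 *
  -- 8` possibilities.
  let g : ℕ × (Bool × Bool × Bool) × (Bool × Bool × Bool) → Finset ℕ :=
    fun x => {x.1, f x.2.1 x.1, f x.2.2 (f x.2.1 x.1)}
  let h : ℕ × ℕ × ℕ → Finset ℕ := fun x => {x.1, x.2.1, x.2.2}
  have hinj : Set.InjOn h T := by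
    rintro ⟨i, j, l⟩ hx ⟨i', j', l'⟩ hy hxy
    obtain ⟨a1, a2, -⟩ := hT _ hx
    obtain ⟨b1, b2, -⟩ := hT _ hy
    simp only [h, Finset.ext_iff, Finset.mem_insert, Finset.mem_singleton] at hxy a1 a2 b1 b2
    have := hxy i
    have := hxy j
    have := hxy l
    have := hxy i'
    have := hxy j'
    have := hxy l'
    simp only [Prod.mk.injEq]
    omega
  have hsub : T.image h ⊆ D.image g := by
    intro s hs
    obtain ⟨⟨i, j, l⟩, hx, rfl⟩ := Finset.mem_image.1 hs
    obtain ⟨a1, a2, a3, h1, h2, h3⟩ := hT _ hx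
    simp only at a1 a2 a3 h1 h2 h3
    have mk : ∀ x y z c c', x < k → f c x = y → f c' y = z →
        ({x, y, z} : Finset ℕ) = {i, j, l} → ({i, j, l} : Finset ℕ) ∈ D.image g := by
      rintro x y z c c' hx rfl rfl he
      exact Finset.mem_image.2 ⟨(x, c, c'), by simp [D, hx], he⟩
    obtain ⟨c1, h1⟩ := hf _ _ h1
    obtain ⟨c2, h2⟩ := hf _ _ h2
    obtain ⟨c3, h3⟩ := hf _ _ h3
    have hi : i < k := by omega
    have hj : j < k := by omega
    rcases h1 with h1 | h1 <;> rcases h2 with h2 | h2 <;> rcases h3 with h3 | h3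
    · exact mk i j l c1 c2 hi h1 h2 rfl
    · exact mk i j l c1 c2 hi h1 h2 rfl
    · exact mk i l j c3 c2 hi h3 h2 (by ext; simp; tauto)
    · exact mk l i j c3 c1 a3 h3 h1 (by ext; simp; tauto)
    · exact mk j i l c1 c3 hj h1 h3 (by ext; simp; tauto)
    · exact mk j l i c2 c3 hj h2 h3 (by ext; simp; tauto)
    · exact mk l j i c2 c1 a3 h2 h1 (by ext; simp; tauto)
    · exact mk l j i c2 c1 a3 h2 h1 (by ext; simp; tauto)
  calc T.card = (T.image h).card := (Finset.card_image_of_injOn hinj).symm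
    _ ≤ (D.image g).card := Finset.card_le_card hsub
    _ ≤ D.card := Finset.card_image_le
    _ = 64 * k := hD

theorem card_delaunay_triangles_le {k : ℕ} {P : ℕ → Pt} (hP : Set.InjOn P (Set.Iio k))
    {adj : ℕ → ℕ → Prop} (hadj : ∀ i j, adj i j → i < k ∧ j < k ∧ i ≠ j ∧
      ∃ w, Pt.Witness (P '' Set.Iio k) (P i) (P j) w) (T : Finset (ℕ × ℕ × ℕ))
    (hT : ∀ x ∈ T, x.1 < x.2.1 ∧ x.2.1 < x.2.2 ∧ x.2.2 < k ∧ adj x.1 x.2.1 ∧ adj x.2.1 x.2.2 ∧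
      adj x.1 x.2.2) : T.card ≤ 64 * k := by
  classical
  refine card_triangles_le (adj := adj) (fun c i =>
    if h : ∃ j < k, Pt.Slot (P '' Set.Iio k) c (P i) (P j) then h.choose else 0) ?_ T hT
  have key : ∀ c i j, j < k → Pt.Slot (P '' Set.Iio k) c (P i) (P j) →
      (if h : ∃ j < k, Pt.Slot (P '' Set.Iio k) c (P i) (P j) then h.choose else 0) = j := by
    intro c i j hj hs
    have hex : ∃ j < k, Pt.Slot (P '' Set.Iio k) c (P i) (P j) := ⟨j, hj, hs⟩
    rw [dif_pos hex]
    exact hP hex.choose_spec.1 hj (hex.choose_spec.2.unique hs)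
  intro i j hij
  obtain ⟨hi, hj, hne, w, hw⟩ := hadj i j hij
  obtain ⟨c, hc | hc⟩ := Pt.exists_slot (Set.mem_image_of_mem P (Set.mem_Iio.2 hi))
    (Set.mem_image_of_mem P (Set.mem_Iio.2 hj))
    (fun h => hne (hP hi hj h)) hw
  · exact ⟨c, Or.inl (key c i j hj hc)⟩
  · exact ⟨c, Or.inr (key c j i hi hc)⟩

/-! ### Voronoi neighbors and the number of Fermat points -/

theorem runs_forT_sum {α σ : Type} {body : σ → α → Timed σ} {Q : σ → ℕ → Prop}
    (k : ℕ) (μ : σ → ℕ) (w : α → ℕ) (Inv : σ → Prop) {l : List α} {s : σ}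
    (hbody : ∀ x s, x ∈ l → Inv s →
      Runs (body s x) (fun s' t => (Inv s' ∧ μ s' ≤ μ s + w x) ∧ t ≤ k))
    (h0 : Inv s)
    (hnil : ∀ s' t, Inv s' → μ s' ≤ μ s + (l.map w).sum → t ≤ l.length * (k + 1) + 1 → Q s' t) :
    Runs (forT l s body) Q := by
  refine runs_forT k (fun r s' => r ⊆ l ∧ Inv s' ∧ μ s' + (r.map w).sum ≤ μ s + (l.map w).sum)
    ?_ ⟨List.Subset.refl _, h0, le_rfl⟩ ?_
  · rintro x r s' ⟨h1, h2, h3⟩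
    refine (hbody x s' (h1 List.mem_cons_self) h2).mono ?_
    rintro s'' t ⟨⟨h4, h5⟩, h6⟩
    refine ⟨⟨fun y hy => h1 (List.mem_cons_of_mem _ hy), h4, ?_⟩, h6⟩
    simp only [List.map_cons, List.sum_cons] at h3
    omega
  · rintro s' t ⟨-, h1, h2⟩ ht
    exact hnil s' t h1 (by simpa using h2) ht

theorem runs_distinctPts (l : List Pt) : Runs (distinctPts l) (fun d t =>
    d.Nodup ∧ d ⊆ l ∧ d.length ≤ l.length ∧ t ≤ 20 * (l.length + 1) ^ 2) := by
  unfold distinctPts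
  refine runs_forT (8 * l.length + 2) (fun r d => d.Nodup ∧ r ⊆ l ∧ d ⊆ l ∧
    d.length + r.length ≤ l.length) ?_ ⟨by simp, by simp, by simp, by simp⟩ ?_
  · rintro x r d ⟨h1, h2, h3, h4⟩
    simp only [runs_bind]
    refine runs_forT 7 (fun r b => b = false → ∀ y ∈ d, y ∉ r → y ≠ x) ?_ ?_ ?_
    · rintro y r b hb
      simp only [runs_bind, runs_leT, runs_distT, runs_zero, runs_pure]
      refine ⟨?_, by norm_num⟩
      intro h z hz hzr
      simp only [Bool.or_eq_false_iff, decide_eq_false_iff_not] at h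
      by_cases hzy : z = y
      · subst hzy
        rintro rfl
        exact h.2 (Pt.dist_self _).le
      · exact hb h.1 z hz (by simp [hzy, hzr])
    · intro _ y hy hy'
      exact absurd hy hy'
    · intro b t hb ht
      rw [List.length_cons] at h4
      have hr : r ⊆ l := fun y hy => h2 (List.mem_cons_of_mem _ hy)
      simp only [runs_ite, runs_pure, runs_push]
      refine ⟨fun _ => ⟨⟨h1, hr, h3, by omega⟩, by omega⟩, fun h => ⟨⟨?_, hr, ?_, ?_⟩, by omega⟩⟩
      · rw [List.nodup_cons]
        exact ⟨fun hx => hb (by simpa using h) x hx (by simp) rfl, h1⟩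
      · exact List.cons_subset.2 ⟨h2 List.mem_cons_self, h3⟩
      · rw [List.length_cons]; omega
  · rintro d t ⟨h1, -, h3, h4⟩ ht
    refine ⟨h1, h3, by simpa using h4, ?_⟩
    nlinarith

/-- The parameter `t` belongs to the interior of the boundary `s`. -/
def Boundary.Mem (s : Boundary) (t : ℝ) : Prop :=
  s.nonempty = true ∧ (∀ l, s.lo = some l → l < t) ∧ (∀ h, s.hi = some h → t < h)

/-- Passing to the interior makes the constraint strict, as an empty circle demands. Only a
constraint that does not involve `t` may hold with equality. -/
theorem runs_cut (s : Boundary) (a b : ℝ) : Runs (s.cut a b) (fun s' T => T ≤ 5 ∧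
    ∀ t, s'.Mem t → s.Mem t ∧ (a = 0 ∧ 0 ≤ b ∨ a * t < b)) := by
  obtain ⟨ne, lo, hi⟩ := s
  simp only [Boundary.cut, runs_bind, runs_ltT, runs_zero, runs_mk_zero, runs_ite, runs_div,
    decide_eq_true_eq]
  refine ⟨fun ha => ?_, fun ha => ⟨fun hb => ?_, fun hb => ?_⟩⟩
  · cases hi with
    | none =>
      simp only [runs_pure, Boundary.Mem]
      refine ⟨by norm_num, ?_⟩
      rintro t ⟨h1, h2, h3⟩
      refine ⟨⟨h1, h2, by simp⟩, Or.inr ?_⟩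
      have := h3 _ rfl
      rw [lt_div_iff₀ ha] at this
      linarith
    | some h =>
      simp only [runs_bind, runs_ltT, runs_mk_zero, runs_pure, decide_eq_true_eq, Boundary.Mem]
      refine ⟨by norm_num, ?_⟩
      split
      · rename_i hlt
        rintro t ⟨h1, h2, h3⟩
        have h3 := h3 _ rfl
        refine ⟨⟨h1, h2, ?_⟩, Or.inr ?_⟩
        · rintro _ ⟨⟩
          linarith
        · rw [lt_div_iff₀ ha] at h3
          linarith
      · rename_i hlt
        rintro t ⟨h1, h2, h3⟩
        have h4 := h3 _ rfl
        refine ⟨⟨h1, h2, h3⟩, Or.inr ?_⟩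
        have : t < b / a := by linarith
        rw [lt_div_iff₀ ha] at this
        linarith
  · cases lo with
    | none =>
      simp only [runs_pure, Boundary.Mem]
      refine ⟨by norm_num, ?_⟩
      rintro t ⟨h1, h2, h3⟩
      refine ⟨⟨h1, by simp, h3⟩, Or.inr ?_⟩
      have := h2 _ rfl
      rw [div_lt_iff_of_neg hb] at this
      linarith
    | some h =>
      simp only [runs_bind, runs_ltT, runs_mk_zero, runs_pure, decide_eq_true_eq, Boundary.Mem]
      refine ⟨by norm_num, ?_⟩
      split
      · rename_i hlt
        rintro t ⟨h1, h2, h3⟩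
        have h2 := h2 _ rfl
        refine ⟨⟨h1, ?_, h3⟩, Or.inr ?_⟩
        · rintro _ ⟨⟩
          linarith
        · rw [div_lt_iff_of_neg hb] at h2
          linarith
      · rename_i hlt
        rintro t ⟨h1, h2, h3⟩
        have h4 := h2 _ rfl
        refine ⟨⟨h1, h2, h3⟩, Or.inr ?_⟩
        have : b / a < t := by linarith
        rw [div_lt_iff_of_neg hb] at this
        linarith
  · have ha0 : a = 0 := le_antisymm (not_lt.1 ha) (not_lt.1 hb)
    simp only [runs_pure, Boundary.Mem]
    refine ⟨by norm_num, ?_⟩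
    split
    · rintro t ⟨h1, -⟩
      simp at h1
    · rename_i h
      rintro t ht
      exact ⟨ht, Or.inl ⟨ha0, not_lt.1 h⟩⟩

theorem Boundary.exists_mem {s : Boundary} (h1 : s.nonempty = true)
    (h2 : ∀ l h, s.lo = some l → s.hi = some h → l < h) : ∃ t, s.Mem t := by
  obtain ⟨ne, lo, hi⟩ := s
  cases lo with
  | none =>
    cases hi with
    | none => exact ⟨0, h1, by simp, by simp⟩
    | some h => exact ⟨h - 1, h1, by simp, by simp⟩
  | some l =>
    cases hi with
    | none => exact ⟨l + 1, h1, by simp, by simp⟩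
    | some h =>
      have := h2 l h rfl rfl
      exact ⟨(l + h) / 2, h1, by simp; linarith, by simp; linarith⟩

/-- The hypotheses put `r` on the line through `p` and `q` and on the circle with diameter `p q`. By
Lagrange's identity `|r - p|² |r - q|²` is the sum of the squares of a dot and a cross product, and
both vanish. -/
theorem eq_or_eq_of_circle_line {p q r : Pt}
    (h1 : (p.y - q.y) * (r.x - p.x) + (q.x - p.x) * (r.y - p.y) = 0)
    (h2 : r.x * r.x + r.y * r.y - (p.x * p.x + p.y * p.y) -
      2 * ((p.x + q.x) / 2 * (r.x - p.x) + (p.y + q.y) / 2 * (r.y - p.y)) = 0) :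
    r = p ∨ r = q := by
  have h : ((r.x - p.x) ^ 2 + (r.y - p.y) ^ 2) * ((r.x - q.x) ^ 2 + (r.y - q.y) ^ 2) = 0 := by
    have e : ∀ u v x y : ℝ, (u ^ 2 + v ^ 2) * (x ^ 2 + y ^ 2) =
      (u * x + v * y) ^ 2 + (u * y - v * x) ^ 2 := by intros; ring
    rw [e]
    have e1 : (r.x - p.x) * (r.x - q.x) + (r.y - p.y) * (r.y - q.y) = 0 := by
      linear_combination h2
    have e2 : (r.x - p.x) * (r.y - q.y) - (r.y - p.y) * (r.x - q.x) = 0 := by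
      linear_combination h1
    rw [e1, e2]
    ring
  have z : ∀ u v : Pt, (u.x - v.x) ^ 2 + (u.y - v.y) ^ 2 = 0 → u = v := by
    intro u v huv
    apply Pt.eq_of_dist_le_zero
    apply Pt.dist_le_of_sq le_rfl
    rw [huv]; norm_num
  exact (mul_eq_zero.1 h).imp (z r p) (z r q)

/-- A boundary of positive length has an interior point, which is the center of an empty circle. The
converse is not needed for an upper bound on the number of neighbors. -/
theorem runs_voronoiNeighbors (sites : List Pt) (p q : Pt) :
    Runs (voronoiNeighbors sites p q) (fun b t => t ≤ 40 * (sites.length + 1) ∧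
      (b = true → ∃ w, Pt.Witness {r | r ∈ sites} p q w)) := by
  simp only [voronoiNeighbors, runs_bind, runs_div, runs_add, runs_sub, runs_mk_zero, runs_two]
  refine runs_forT 30 (fun l s => ∀ t, s.Mem t → ∀ r ∈ sites, r ∉ l → r ≠ p → r ≠ q →
    Pt.sqd ⟨(p.x + q.x) / 2 + t * (p.y - q.y), (p.y + q.y) / 2 + t * (q.x - p.x)⟩ p <
    Pt.sqd ⟨(p.x + q.x) / 2 + t * (p.y - q.y), (p.y + q.y) / 2 + t * (q.x - p.x)⟩ r) ?_ ?_ ?_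
  · intro x l s hs
    simp only [runs_bind, runs_mul, runs_add, runs_sub, runs_mk_zero, runs_two]
    refine (runs_cut s _ _).mono ?_
    rintro s' T ⟨hT, h⟩
    refine ⟨?_, by omega⟩
    intro t ht r hr hrl hrp hrq
    obtain ⟨h1, h2⟩ := h t ht
    by_cases hrx : r = x
    · subst hrx
      simp only [Pt.sqd]
      rcases h2 with ⟨h3, h4⟩ | h3
      · have h3' : (p.y - q.y) * (r.x - p.x) + (q.x - p.x) * (r.y - p.y) = 0 := by linarith
        rcases eq_or_lt_of_le h4 with h5 | h5
        · exact absurd (eq_or_eq_of_circle_line h3' h5.symm) (by simp [hrp, hrq])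
        · linarith [congrArg (fun z => t * z) h3]
      · linarith
    · exact hs t h1 r hr (by simp [hrx, hrl]) hrp hrq
  · intro t _ r hr hr'
    exact absurd hr hr'
  · intro s T hs hT
    have key : ∀ t, s.Mem t → ∃ w, Pt.Witness {r | r ∈ sites} p q w := by
      intro t ht
      refine ⟨_, ?_, fun r hr h1 h2 => hs t ht r hr (by simp) h1 h2⟩
      simp only [Pt.sqd]
      ring
    have hb : ∀ b : Bool, (b = true → s.nonempty = true ∧
        ∀ l h, s.lo = some l → s.hi = some h → l < h) →
        b = true → ∃ w, Pt.Witness {r | r ∈ sites} p q w := by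
      intro b h1 h2
      obtain ⟨h3, h4⟩ := h1 h2
      obtain ⟨t, ht⟩ := Boundary.exists_mem h3 h4
      exact key t ht
    split
    · rename_i l h hl hh
      simp only [runs_bind, runs_ltT, runs_mk_zero, runs_pure]
      refine ⟨by omega, hb _ ?_⟩
      simp only [Bool.and_eq_true, decide_eq_true_eq, hl, hh]
      rintro ⟨h1, h2⟩
      refine ⟨h1, ?_⟩
      rintro _ _ ⟨⟩ ⟨⟩
      exact h2
    · rename_i hno
      simp only [runs_pure]
      refine ⟨by omega, hb _ fun h => ⟨h, ?_⟩⟩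
      intro l h hl hh
      exact (hno l h hl hh).elim

theorem sum_map_range (k : ℕ) (f : ℕ → ℕ) :
    ((List.range k).map f).sum = ∑ i ∈ Finset.range k, f i := by
  rw [Finset.sum_range, ← List.sum_ofFn, List.ofFn_eq_map]
  congr 1
  rw [← List.map_coe_finRange_eq_range, List.map_map]
  rfl

theorem runs_fermatPoints {sites : List Pt} (hnd : sites.Nodup) {o : Pt} {r : ℝ}
    (hball : ∀ p ∈ sites, o.dist p ≤ r) :
    Runs (fermatPoints sites) (fun F t => F.length ≤ 64 * sites.length ∧
      (∀ f ∈ F, o.dist f ≤ r) ∧ t ≤ 500 * (sites.length + 1) ^ 3) := by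
  set k := sites.length with hk
  set P : ℕ → Pt := fun i => sites.getD i ⟨0, 0⟩ with hP
  have hPmem : ∀ i, i < k → P i ∈ sites := by
    intro i hi
    have : P i = sites[i] := by exact List.getD_eq_getElem _ _ hi
    rw [this]
    exact List.getElem_mem hi
  have hinj : Set.InjOn P (Set.Iio k) := by
    intro i hi j hj hij
    simp only [hP, List.getD_eq_getElem _ _ (Set.mem_Iio.1 hi : i < sites.length),
      List.getD_eq_getElem _ _ (Set.mem_Iio.1 hj : j < sites.length)] at hij
    exact (hnd.getElem_inj_iff).1 hij
  have himg : P '' Set.Iio k ⊆ {r | r ∈ sites} := by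
    rintro _ ⟨i, hi, rfl⟩
    exact hPmem i hi
  let adj : ℕ → ℕ → Prop := fun i j =>
    i < k ∧ j < k ∧ i ≠ j ∧ ∃ w, Pt.Witness (P '' Set.Iio k) (P i) (P j) w
  simp only [fermatPoints, runs_bind]
  refine runs_lenT fun t₁ ht₁ => runs_toArr fun t₂ ht₂ => runs_alloc fun t₃ ht₃ => ?_
  rw [← hk] at ht₁ ht₂ ht₃ ⊢
  refine runs_forT_mem (k * (40 * (k + 1) + 5) + 1)
    (fun nb : ℕ × ℕ → Bool => ∀ i j, nb (i, j) = true → adj i j) ?_ (by simp) ?_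
  · intro i nb hi hnb
    refine runs_forT_mem (40 * (k + 1) + 4)
      (fun nb : ℕ × ℕ → Bool => ∀ i j, nb (i, j) = true → adj i j) ?_ hnb ?_
    · intro j nb hj hnb
      simp only [runs_bind, runs_step, runs_ite, runs_rd, decide_eq_true_eq, runs_pure]
      refine ⟨fun hij => ?_, fun _ => ⟨hnb, by omega⟩⟩
      refine (runs_voronoiNeighbors sites _ _).mono ?_
      rintro b t ⟨ht, hb⟩
      rw [← hk] at ht
      simp only [runs_wr]
      refine ⟨?_, by omega⟩
      intro i' j' h
      by_cases he : (i', j') = (i, j)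
      · rw [he, Function.update_self] at h
        obtain ⟨rfl, rfl⟩ := Prod.mk.injEq .. ▸ he
        obtain ⟨w, hw⟩ := hb h
        exact ⟨List.mem_range.1 hi, List.mem_range.1 hj, hij, w, hw.1,
          fun r hr => hw.2 r (himg hr)⟩
      · rw [Function.update_of_ne he] at h
        exact hnb i' j' h
    · intro s t hs ht
      rw [List.length_range] at ht
      exact ⟨hs, by simpa using ht⟩
  · intro nb t₄ hnb ht₄
    rw [List.length_range] at ht₄
    -- The indicator of the triples for which a point is added: its sum is the number of triangles,
    -- although the loops run through all `k ^ 3` triples.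
    let w : ℕ → ℕ → ℕ → ℕ := fun i j l =>
      if i < j ∧ j < l ∧ nb (i, j) = true ∧ nb (j, l) = true ∧ nb (i, l) = true then 1 else 0
    refine runs_forT_sum (k * (k * 209 + 2) + 1) List.length
      (fun i => ((List.range k).map fun j => ((List.range k).map (w i j)).sum).sum)
      (fun F => ∀ f ∈ F, o.dist f ≤ r) ?_ (by simp) ?_
    · intro i F hi hF
      refine runs_forT_sum (k * 209 + 1) List.length
        (fun j => ((List.range k).map (w i j)).sum) (fun F => ∀ f ∈ F, o.dist f ≤ r) ?_ hF ?_
      · intro j F hj hF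
        refine runs_forT_sum 208 List.length (w i j) (fun F => ∀ f ∈ F, o.dist f ≤ r) ?_ hF ?_
        · intro l F hl hF
          simp only [runs_bind, runs_step, runs_ite, runs_rd, runs_pure]
          refine ⟨fun h => ?_, fun _ => ⟨⟨hF, by omega⟩, by omega⟩⟩
          simp only [Bool.and_eq_true, decide_eq_true_eq] at h
          refine (runs_fermat _ _ _).mono ?_
          rintro f t ⟨ht, hf⟩
          simp only [runs_push]
          refine ⟨⟨?_, ?_⟩, by omega⟩
          · intro g hg
            rcases List.mem_cons.1 hg with rfl | hg
            · refine hf o r ?_ ?_ ?_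
              · exact hball _ (hPmem i (List.mem_range.1 hi))
              · exact hball _ (hPmem j (List.mem_range.1 hj))
              · exact hball _ (hPmem l (List.mem_range.1 hl))
            · exact hF g hg
          · have : w i j l = 1 := by
              simp only [w]
              rw [if_pos ⟨h.1.1.1.1, h.1.1.1.2, h.1.1.2, h.1.2, h.2⟩]
            rw [this, List.length_cons]
        · intro F' t h1 h2 ht
          rw [List.length_range] at ht
          exact ⟨⟨h1, h2⟩, by simpa using ht⟩
      · intro F' t h1 h2 ht
        rw [List.length_range] at ht
        exact ⟨⟨h1, h2⟩, by simpa using ht⟩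
    · intro F t h1 h2 ht
      rw [List.length_range] at ht
      refine ⟨?_, h1, ?_⟩
      · let T : Finset (ℕ × ℕ × ℕ) :=
          (Finset.range k ×ˢ Finset.range k ×ˢ Finset.range k).filter fun x =>
            x.1 < x.2.1 ∧ x.2.1 < x.2.2 ∧ nb (x.1, x.2.1) = true ∧ nb (x.2.1, x.2.2) = true ∧
              nb (x.1, x.2.2) = true
        have hT : T.card ≤ 64 * k := by
          refine card_delaunay_triangles_le hinj (adj := adj) (fun _ _ h => h) T ?_
          rintro ⟨i, j, l⟩ hx
          simp only [T, Finset.mem_filter, Finset.mem_product, Finset.mem_range] at hx ⊢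
          obtain ⟨⟨-, -, hl⟩, h1, h2, h3, h4, h5⟩ := hx
          exact ⟨h1, h2, hl, hnb _ _ h3, hnb _ _ h4, hnb _ _ h5⟩
        refine h2.trans (le_trans (le_of_eq ?_) hT)
        rw [Finset.card_filter, Finset.sum_product]
        simp only [Finset.sum_product, sum_map_range, List.length_nil, zero_add, w]
      · nlinarith

/-! ### The modified Klein-Ravi algorithm -/

theorem runs_insertT (x : TreeDist) (l : List TreeDist) :
    Runs (insertT x l) (fun l' t => l'.Perm (x :: l) ∧ t ≤ 2 * l.length + 2) := by
  induction l with
  | nil => simp [insertT]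
  | cons y ys ih =>
    simp only [insertT, runs_bind, runs_leT, runs_mk_zero, runs_ite, runs_push]
    refine ⟨fun _ => ⟨List.Perm.refl _, by simp⟩, fun _ => ih.mono ?_⟩
    rintro l' t ⟨h1, h2⟩
    rw [List.length_cons]
    exact ⟨(h1.cons y).trans (List.Perm.swap x y ys), by omega⟩

/-- Every tree has a node, so its array entry is filled and the list contains exactly one entry per
tree. The square in the time bound comes from insertion sort; that the result is sorted is
irrelevant here. -/
theorem runs_treeDists {V : ℕ} {pos : ℕ → Pt} {G : Forest} (v : ℕ)
    (hinh : ∀ l ∈ G.trees, ∃ u < V, G.label u = some l) :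
    Runs (treeDists V pos G v) (fun ds t => (ds.map TreeDist.label).Perm G.trees ∧
      (∀ x ∈ ds, G.label x.node = some x.label) ∧
      t ≤ 20 * (V + (G.trees.length + 1) ^ 2)) := by
  simp only [treeDists, runs_bind, runs_rd]
  refine runs_alloc fun t₁ ht₁ => ?_
  refine runs_forT 12 (fun r (a : ℕ → Option TreeDist) =>
    (∀ l x, a l = some x → x.label = l ∧ G.label x.node = some l) ∧
    (∀ u < V, u ∉ r → ∀ l, G.label u = some l → a l ≠ none)) ?_ ⟨by simp, ?_⟩ ?_
  · rintro u r a ⟨h1, h2⟩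
    simp only [runs_bind, runs_rd]
    have hstep : ∀ l d, G.label u = some l →
        (∀ l' x, Function.update a l (some (⟨d, u, l⟩ : TreeDist)) l' = some x →
          x.label = l' ∧ G.label x.node = some l') ∧
        (∀ u' < V, u' ∉ r → ∀ l', G.label u' = some l' →
          Function.update a l (some (⟨d, u, l⟩ : TreeDist)) l' ≠ none) := by
      intro l d hl
      constructor
      · intro l' x hx
        by_cases hll : l' = l
        · subst hll
          rw [Function.update_self] at hx
          obtain rfl := Option.some.inj hx
          exact ⟨rfl, hl⟩
        · rw [Function.update_of_ne hll] at hx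
          exact h1 l' x hx
      · intro u' hu' hr l' hl'
        by_cases hll : l' = l
        · subst hll
          simp
        · rw [Function.update_of_ne hll]
          refine h2 u' hu' ?_ l' hl'
          rw [List.mem_cons, not_or]
          refine ⟨?_, hr⟩
          rintro rfl
          rw [hl] at hl'
          exact hll (Option.some.inj hl').symm
    cases hlu : G.label u with
    | none =>
      simp only [runs_pure]
      refine ⟨⟨h1, fun u' hu' hr l' hl' => h2 u' hu' ?_ l' hl'⟩, by norm_num⟩
      rw [List.mem_cons, not_or]
      refine ⟨?_, hr⟩
      rintro rfl
      rw [hlu] at hl'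
      simp at hl'
    | some l =>
      simp only [runs_bind, runs_rd, runs_distT]
      cases hal : a l with
      | none =>
        simp only [runs_wr]
        exact ⟨hstep l _ hlu, by norm_num⟩
      | some o =>
        simp only [runs_bind, runs_ltT, runs_mk_zero, runs_ite, runs_wr, runs_pure]
        refine ⟨fun _ => ⟨hstep l _ hlu, by norm_num⟩, fun _ => ⟨⟨h1, ?_⟩, by norm_num⟩⟩
        intro u' hu' hr l' hl'
        by_cases hll : l' = l
        · rw [hll, hal]; simp
        · refine h2 u' hu' ?_ l' hl'
          rw [List.mem_cons, not_or]
          refine ⟨?_, hr⟩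
          rintro rfl
          rw [hlu] at hl'
          exact hll (Option.some.inj hl').symm
  · intro u hu hu'
    exact absurd (List.mem_range.2 hu) hu'
  · rintro a t₂ ⟨h1, h2⟩ ht₂
    rw [List.length_range] at ht₂
    refine runs_forT (2 * G.trees.length + 3) (fun r acc => ∃ p, G.trees = p ++ r ∧
      (acc.map TreeDist.label).Perm p ∧ ∀ x ∈ acc, G.label x.node = some x.label) ?_
      ⟨[], by simp⟩ ?_
    · rintro l r acc ⟨p, hp, hperm, hacc⟩
      simp only [runs_bind, runs_rd]
      have hl : l ∈ G.trees := by rw [hp]; simp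
      obtain ⟨u, hu, hlu⟩ := hinh l hl
      have hne := h2 u hu (by simp) l hlu
      obtain ⟨x, hx⟩ := Option.ne_none_iff_exists'.1 hne
      obtain ⟨h3, h4⟩ := h1 l x hx
      rw [hx]
      refine (runs_insertT x acc).mono ?_
      rintro acc' t ⟨h5, h6⟩
      have hlen : acc.length ≤ G.trees.length := by
        rw [← List.length_map TreeDist.label, hperm.length_eq, hp, List.length_append]
        omega
      refine ⟨⟨p ++ [l], by simp [hp], ?_, ?_⟩, by omega⟩
      · refine (h5.map _).trans ?_
        rw [List.map_cons, h3]
        exact (hperm.cons l).trans (List.perm_append_singleton l p).symm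
      · intro y hy
        rcases List.mem_cons.1 (h5.mem_iff.1 hy) with rfl | hy
        · rw [h3]; exact h4
        · exact hacc y hy
    · rintro ds t ⟨p, hp, h3, h4⟩ ht
      rw [List.append_nil] at hp
      refine ⟨hp ▸ h3, h4, ?_⟩
      nlinarith

theorem runs_quotientCost (v : ℕ) {ds : List TreeDist} (hds : 2 ≤ ds.length) :
    Runs (quotientCost v ds) (fun q t => t ≤ 20 * (ds.length + 1) ∧
      ∃ Q, q = some Q ∧ Q.node = v ∧ 2 ≤ Q.trees.length ∧ ∃ r, Q.trees.reverse ++ r = ds) := by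
  simp only [quotientCost, runs_bind]
  refine runs_forT 10 (fun r s => s.1 + r.length = ds.length ∧ (s.2.2 = none → s.1 < 2) ∧
    ∀ b, s.2.2 = some b → 2 ≤ b.2 ∧ b.2 ≤ s.1) ?_ (by simp) ?_
  · rintro x r ⟨k, sum, best⟩ ⟨h1, h2, h3⟩
    simp only [runs_bind, runs_step, runs_add, runs_mk_zero, runs_ite, decide_eq_true_eq,
      runs_pure, runs_div, runs_sub, runs_ofNatT, runs_one]
    simp only [List.length_cons] at h1
    refine ⟨fun hk => ?_, fun hk => ?_⟩
    · cases best with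
      | none =>
        simp only [runs_pure]
        refine ⟨⟨by omega, by simp, ?_⟩, by norm_num⟩
        rintro b ⟨⟩
        exact ⟨hk, le_rfl⟩
      | some b =>
        obtain ⟨h4, h5⟩ := h3 b rfl
        simp only [runs_bind, runs_ltT, runs_mk_zero, runs_pure]
        refine ⟨?_, by norm_num⟩
        simp only at h5
        split
        · refine ⟨by simp only; omega, by simp, ?_⟩
          rintro b ⟨⟩
          exact ⟨hk, le_rfl⟩
        · refine ⟨by simp only; omega, by simp, ?_⟩
          rintro b ⟨⟩
          exact ⟨h4, by simp only; omega⟩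
    · refine ⟨⟨by omega, fun _ => by omega, by simp⟩, by norm_num⟩
  · rintro ⟨k, sum, best⟩ t₁ ⟨h1, h2, h3⟩ ht₁
    simp only [List.length_nil, add_zero] at h1
    cases best with
    | none =>
      have := h2 rfl
      simp only at this
      omega
    | some b =>
      obtain ⟨h4, h5⟩ := h3 b rfl
      simp only at h5
      simp only [runs_bind]
      refine runs_forT 1 (fun r (s : List TreeDist × List TreeDist) =>
        s.1.reverse ++ s.2 = ds ∧ s.1.length + r.length = b.2) ?_ (by simp) ?_
      · rintro i r ⟨c, rest⟩ ⟨h6, h7⟩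
        simp only [List.length_cons] at h6 h7
        cases rest with
        | nil =>
          have := congrArg List.length h6
          simp at this
          omega
        | cons x xs =>
          simp only [runs_bind, runs_push, runs_pure]
          exact ⟨⟨by simpa using h6, by simp only [List.length_cons]; omega⟩, by norm_num⟩
      · rintro ⟨c, rest⟩ t₂ ⟨h6, h7⟩ ht₂
        simp only [List.length_nil, add_zero] at h6 h7
        rw [List.length_range] at ht₂
        simp only [runs_pure]
        exact ⟨by omega, _, rfl, rfl, by simp only; omega, rest, h6⟩

/-- The choice `Q` consists of a node and of at least two trees of the forest. -/
structure Quotient.Valid (V : ℕ) (G : Forest) (Q : Quotient) : Prop where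
  node_lt : Q.node < V
  two_le : 2 ≤ Q.trees.length
  nodup : (Q.trees.map TreeDist.label).Nodup
  mem : ∀ x ∈ Q.trees, x.label ∈ G.trees
  label : ∀ x ∈ Q.trees, G.label x.node = some x.label

theorem runs_minQuotient {V : ℕ} {pos : ℕ → Pt} {G : Forest} (hV : 0 < V)
    (hnd : G.trees.Nodup) (hinh : ∀ l ∈ G.trees, ∃ u < V, G.label u = some l)
    (hT : 2 ≤ G.trees.length) :
    Runs (minQuotient V pos G) (fun q t => (∃ Q, q = some Q ∧ Q.Valid V G) ∧
      t ≤ 50 * V * (V + (G.trees.length + 1) ^ 2) + 1) := by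
  unfold minQuotient
  refine runs_forT (20 * (V + (G.trees.length + 1) ^ 2) + 20 * (G.trees.length + 1) + 1)
    (fun r best => (∀ v ∈ r, v < V) ∧ (best = none → r ≠ []) ∧
      ∀ Q, best = some Q → Q.Valid V G) ?_ ?_ ?_
  · rintro v r best ⟨h1, -, h3⟩
    simp only [runs_bind]
    refine (runs_treeDists v hinh).mono ?_
    rintro ds t₁ ⟨hperm, hlab, ht₁⟩
    have hlen : ds.length = G.trees.length := by
      rw [← List.length_map TreeDist.label, hperm.length_eq]
    refine (runs_quotientCost v (hlen ▸ hT)).mono ?_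
    rintro q t₂ ⟨ht₂, Q, rfl, hQv, hQ2, rest, hrest⟩
    rw [hlen] at ht₂
    have hsub : ∀ x ∈ Q.trees, x ∈ ds := by
      intro x hx
      rw [← hrest]
      simp [hx]
    have hQ : Q.Valid V G := by
      refine ⟨hQv ▸ h1 v List.mem_cons_self, hQ2, ?_, ?_, fun x hx => hlab x (hsub x hx)⟩
      · have h := hperm.nodup_iff.2 hnd
        rw [← hrest, List.map_append, List.nodup_append] at h
        have h := h.1
        rwa [List.map_reverse, List.nodup_reverse] at h
      · intro x hx
        exact hperm.mem_iff.1 (List.mem_map_of_mem (hsub x hx))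
    have h1' : ∀ v ∈ r, v < V := fun u hu => h1 u (List.mem_cons_of_mem _ hu)
    cases best with
    | none =>
      simp only [runs_pure]
      refine ⟨⟨h1', by simp, ?_⟩, by omega⟩
      rintro _ ⟨⟩
      exact hQ
    | some b =>
      simp only [runs_bind, runs_ltT, runs_mk_zero, runs_pure]
      refine ⟨⟨h1', ?_, ?_⟩, by omega⟩
      · split <;> simp
      · intro Q' hQ'
        split at hQ'
        · obtain rfl := Option.some.inj hQ'
          exact hQ
        · exact h3 Q' hQ'
  · exact ⟨fun v => List.mem_range.1, fun _ => by simp [hV.ne'], by simp⟩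
  · rintro best t ⟨-, h2, h3⟩ ht
    rw [List.length_range] at ht
    refine ⟨?_, ?_⟩
    · cases best with
      | none => exact absurd rfl (h2 rfl)
      | some Q => exact ⟨Q, rfl, h3 Q rfl⟩
    · refine ht.trans ?_
      have : 20 * (V + (G.trees.length + 1) ^ 2) + 20 * (G.trees.length + 1) + 1 + 1 ≤
        50 * (V + (G.trees.length + 1) ^ 2) := by nlinarith
      have := Nat.mul_le_mul_left V this
      nlinarith

/-- The invariant of the growing forest; connectedness of its trees is expressed by means of sets
of nodes that are closed under adjacency. -/
structure Forest.Good (V : ℕ) (G : Forest) : Prop where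
  nodup : G.trees.Nodup
  inhabited : ∀ l ∈ G.trees, ∃ u < V, G.label u = some l
  label_mem : ∀ u l, G.label u = some l → u < V ∧ l ∈ G.trees
  edge : ∀ e ∈ G.edges, ∃ l, G.label e.1 = some l ∧ G.label e.2 = some l
  conn : ∀ S : ℕ → Prop, (∀ e ∈ G.edges, (S e.1 ↔ S e.2)) →
    ∀ u v l, G.label u = some l → G.label v = some l → (S u ↔ S v)
  root : G.label 0 ≠ none

/-- The relabelling of a node: marked labels are replaced by `new`. -/
def relabel (M : ℕ → Bool) (new : ℕ) : Option ℕ → Option ℕ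
  | none => none
  | some l => if M l then some new else some l

/-- The label of the tree that is the result of a merger. -/
def Quotient.new (G : Forest) (Q : Quotient) : ℕ :=
  match G.label Q.node, Q.trees with
  | some l, _ => l
  | none, x :: _ => x.label
  | none, [] => 0

theorem Quotient.Valid.new_spec {V : ℕ} {G : Forest} {Q : Quotient} (hQ : Q.Valid V G)  :
    G.label Q.node = some (Q.new G) ∨
      (G.label Q.node = none ∧ ∃ x ∈ Q.trees, x.label = Q.new G) := by
  obtain ⟨h1, h2, -, -, -⟩ := hQ
  obtain ⟨cost, node, trees⟩ := Q
  unfold Quotient.new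
  simp only at *
  cases hl : G.label node with
  | some l => exact Or.inl rfl
  | none =>
    cases trees with
    | nil => simp at h2
    | cons x xs => exact Or.inr ⟨rfl, x, by simp, rfl⟩

/-- `G'` arises from `G` by merging the trees in `Q`; `M` marks the labels of these trees. -/
structure Merged (G : Forest) (Q : Quotient) (M : ℕ → Bool) (G' : Forest) : Prop where
  mark : ∀ l, M l = true ↔ l = Q.new G ∨ ∃ x ∈ Q.trees, x.label = l
  label : ∀ u, G'.label u = relabel M (Q.new G) (Function.update G.label Q.node (some (Q.new G)) u)
  trees : G'.trees = (G.trees.filter fun l => !M l).reverse ++ [Q.new G]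
  edges : ∀ e, e ∈ G'.edges ↔
    e ∈ G.edges ∨ ∃ x ∈ Q.trees, G.label Q.node ≠ some x.label ∧ e = (Q.node, x.node)
  length : G'.edges.length ≤ G.edges.length + Q.trees.length

/-- The chosen trees have distinct labels, all of them marked; the marked labels disappear and one
label comes back. -/
theorem Merged.trees_length {V : ℕ} {G G' : Forest} {Q : Quotient} {M : ℕ → Bool}
    (h : Merged G Q M G') (hQ : Q.Valid V G) :
    G'.trees.length + Q.trees.length ≤ G.trees.length + 1 := by
  have h1 : Q.trees.length ≤ (G.trees.filter M).length := by
    rw [← List.length_map TreeDist.label]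
    refine (hQ.nodup.subperm ?_).length_le
    intro l hl
    obtain ⟨x, hx, rfl⟩ := List.mem_map.1 hl
    exact List.mem_filter.2 ⟨hQ.mem x hx, (h.mark _).2 (Or.inr ⟨x, hx, rfl⟩)⟩
  have h2 := List.length_eq_length_filter_add (l := G.trees) M
  rw [h.trees, List.length_append, List.length_reverse]
  simp only [List.length_cons, List.length_nil]
  omega

/-- Every node of the new tree either is the chosen node or had a marked label. For connectedness, a
set closed under adjacency treats all nodes of a chosen tree alike, and like the chosen node, either
through the new edge or because that node was in the tree already. -/
theorem Merged.good {V : ℕ} {G G' : Forest} {Q : Quotient} {M : ℕ → Bool}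
    (h : Merged G Q M G') (hQ : Q.Valid V G) (hG : G.Good V) : G'.Good V := by
  have hMnew : M (Q.new G) = true := (h.mark _).2 (Or.inl rfl)
  have hnode : G'.label Q.node = some (Q.new G) := by
    rw [h.label, Function.update_self, relabel, if_pos hMnew]
  have hmarked : ∀ u l, G.label u = some l → M l = true → G'.label u = some (Q.new G) := by
    intro u l hu hl
    by_cases hun : u = Q.node
    · rw [hun, hnode]
    · rw [h.label, Function.update_of_ne hun, hu, relabel, if_pos hl]
  have hown : ∀ l, G.label Q.node = some l → M l = true := by
    intro l hl
    rcases hQ.new_spec with h1 | ⟨h1, -⟩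
    · rw [hl] at h1
      rw [Option.some.inj h1]
      exact hMnew
    · rw [hl] at h1; simp at h1
  have hunmarked : ∀ u l, G.label u = some l → ¬ M l = true → G'.label u = some l := by
    intro u l hu hl
    have hun : u ≠ Q.node := by
      rintro rfl
      exact hl (hown l hu)
    rw [h.label, Function.update_of_ne hun, hu, relabel, if_neg hl]
  have hinv : ∀ u l, G'.label u = some l →
      (l = Q.new G ∧ (u = Q.node ∨ ∃ l', G.label u = some l' ∧ M l' = true)) ∨
      (¬ M l = true ∧ G.label u = some l) := by
    intro u l hu
    by_cases hun : u = Q.node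
    · subst hun
      rw [hnode] at hu
      exact Or.inl ⟨(Option.some.inj hu).symm, Or.inl rfl⟩
    · cases hl : G.label u with
      | none =>
        rw [h.label, Function.update_of_ne hun, hl] at hu
        simp [relabel] at hu
      | some l' =>
        by_cases hM : M l' = true
        · rw [hmarked u l' hl hM] at hu
          exact Or.inl ⟨(Option.some.inj hu).symm, Or.inr ⟨l', rfl, hM⟩⟩
        · rw [hunmarked u l' hl hM] at hu
          obtain rfl := Option.some.inj hu
          exact Or.inr ⟨hM, rfl⟩
  have hnewmem : Q.new G ∈ G'.trees := by rw [h.trees]; simp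
  have holdmem : ∀ l ∈ G.trees, ¬ M l = true → l ∈ G'.trees := by
    intro l hl hM
    rw [h.trees]
    simp [hl, hM]
  refine ⟨?_, ?_, ?_, ?_, ?_, ?_⟩
  · rw [h.trees, List.nodup_append, List.nodup_reverse]
    refine ⟨hG.nodup.filter _, by simp, ?_⟩
    intro a ha b hb
    simp only [List.mem_reverse, List.mem_filter, List.mem_singleton] at ha hb
    rintro rfl
    simp [hb, hMnew] at ha
  · intro l hl
    rw [h.trees] at hl
    simp only [List.mem_append, List.mem_reverse, List.mem_filter, List.mem_singleton] at hl
    rcases hl with ⟨hl, hM⟩ | rfl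
    · obtain ⟨u, hu, hlu⟩ := hG.inhabited l hl
      exact ⟨u, hu, hunmarked u l hlu (by simpa using hM)⟩
    · exact ⟨Q.node, hQ.node_lt, hnode⟩
  · intro u l hu
    rcases hinv u l hu with ⟨rfl, rfl | ⟨l', hl', -⟩⟩ | ⟨hM, hl⟩
    · exact ⟨hQ.node_lt, hnewmem⟩
    · exact ⟨(hG.label_mem u l' hl').1, hnewmem⟩
    · exact ⟨(hG.label_mem u l hl).1, holdmem l (hG.label_mem u l hl).2 hM⟩
  · intro e he
    rcases (h.edges e).1 he with he | ⟨x, hx, -, rfl⟩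
    · obtain ⟨l, h1, h2⟩ := hG.edge e he
      by_cases hM : M l = true
      · exact ⟨_, hmarked _ l h1 hM, hmarked _ l h2 hM⟩
      · exact ⟨_, hunmarked _ l h1 hM, hunmarked _ l h2 hM⟩
    · exact ⟨_, hnode, hmarked _ _ (hQ.label x hx) ((h.mark _).2 (Or.inr ⟨x, hx, rfl⟩))⟩
  · intro S hS
    have hS' : ∀ e ∈ G.edges, (S e.1 ↔ S e.2) := fun e he => hS e ((h.edges e).2 (Or.inl he))
    have hchosen : ∀ x ∈ Q.trees, ∀ u, G.label u = some x.label → (S u ↔ S Q.node) := by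
      intro x hx u hu
      rw [hG.conn S hS' u x.node _ hu (hQ.label x hx)]
      by_cases hxl : G.label Q.node = some x.label
      · exact hG.conn S hS' _ _ _ (hQ.label x hx) hxl
      · exact (hS _ ((h.edges (Q.node, x.node)).2 (Or.inr ⟨x, hx, hxl, rfl⟩))).symm
    have hall : ∀ u, (u = Q.node ∨ ∃ l', G.label u = some l' ∧ M l' = true) →
        (S u ↔ S Q.node) := by
      rintro u (rfl | ⟨l', hl', hM⟩)
      · rfl
      rcases (h.mark l').1 hM with rfl | ⟨x, hx, rfl⟩
      · rcases hQ.new_spec with h1 | ⟨-, x, hx, h1⟩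
        · exact hG.conn S hS' _ _ _ hl' h1
        · exact hchosen x hx u (h1 ▸ hl')
      · exact hchosen x hx u hl'
    intro u v l hu hv
    rcases hinv u l hu with ⟨rfl, hu'⟩ | ⟨hM, hu'⟩
    · rcases hinv v _ hv with ⟨-, hv'⟩ | ⟨hM, -⟩
      · rw [hall u hu', hall v hv']
      · exact absurd hMnew hM
    · rcases hinv v _ hv with ⟨rfl, -⟩ | ⟨-, hv'⟩
      · exact absurd hMnew hM
      · exact hG.conn S hS' _ _ _ hu' hv'
  · obtain ⟨l, hl⟩ := Option.ne_none_iff_exists'.1 hG.root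
    by_cases hM : M l = true
    · rw [hmarked _ l hl hM]; simp
    · rw [hunmarked _ l hl hM]; simp

/-- The function `merge` with a given label of the new tree. -/
noncomputable def mergeInto (V : ℕ) (G : Forest) (Q : Quotient) (new : ℕ) : Timed Forest := do
  let own ← rd G.label Q.node
  let mark ← alloc (ι := ℕ) V false
  let mark ← wr mark new true
  let r ← forT Q.trees (mark, G.edges) (fun s x => do
    let mark ← wr s.1 x.label true
    let same ← step (decide (own = some x.label))
    if same then return (mark, s.2)
    else
      let es ← push (Q.node, x.node) s.2
      return (mark, es))
  let lab ← wr G.label Q.node (some new)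
  let lab ← forT (List.range V) lab (fun lab u => do
    let lu ← rd lab u
    match lu with
    | none => return lab
    | some l =>
      let b ← rd r.1 l
      if b then wr lab u (some new) else return lab)
  let trees ← forT G.trees [new] (fun acc l => do
    let b ← rd r.1 l
    if b then return acc else push l acc)
  return ⟨lab, trees, r.2⟩

theorem merge_eq (V : ℕ) (G : Forest) (Q : Quotient) :
    merge V G Q = mergeInto V G Q (Q.new G) := rfl

theorem runs_merge {V : ℕ} {G : Forest} {Q : Quotient} (hQ : Q.Valid V G) (hG : G.Good V) :
    Runs (merge V G Q) (fun G' t => (∃ M, Merged G Q M G') ∧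
      t ≤ 10 * (V + G.trees.length + Q.trees.length + 1)) := by
  rw [merge_eq]
  unfold mergeInto
  simp only [runs_bind, runs_rd]
  refine runs_alloc fun t₁ ht₁ => ?_
  simp only [runs_wr]
  refine runs_forT 3 (fun r (s : (ℕ → Bool) × List (ℕ × ℕ)) => ∃ p, Q.trees = p ++ r ∧
    (∀ l, s.1 l = true ↔ l = Q.new G ∨ ∃ x ∈ p, x.label = l) ∧
    (∀ e, e ∈ s.2 ↔
      e ∈ G.edges ∨ ∃ x ∈ p, G.label Q.node ≠ some x.label ∧ e = (Q.node, x.node)) ∧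
    s.2.length ≤ G.edges.length + p.length) ?_ ⟨[], by simp, ?_, by simp, by simp⟩ ?_
  · rintro x r ⟨mark, es⟩ ⟨p, hp, h1, h2, h3⟩
    simp only at h1 h2 h3
    simp only [runs_bind, runs_wr, runs_step, runs_ite, decide_eq_true_eq, runs_pure, runs_push]
    have hmark : ∀ l, Function.update mark x.label true l = true ↔
        l = Q.new G ∨ ∃ y ∈ p ++ [x], y.label = l := by
      intro l
      by_cases hl : l = x.label
      · subst hl
        simp
      · rw [Function.update_of_ne hl, h1]
        simp only [List.mem_append, List.mem_singleton, or_and_right, exists_or, exists_eq_left]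
        simp [Ne.symm hl]
    refine ⟨fun hown => ⟨⟨p ++ [x], by simp [hp], hmark, ?_, ?_⟩, by norm_num⟩,
      fun hown => ⟨⟨p ++ [x], by simp [hp], hmark, ?_, ?_⟩, by norm_num⟩⟩
    · intro e
      simp only [h2, List.mem_append, List.mem_singleton, or_and_right, exists_or, exists_eq_left]
      simp [hown]
    · simp only [List.length_append, List.length_cons]; omega
    · intro e
      simp only [List.mem_cons (a := e), h2, List.mem_append, List.mem_singleton, or_and_right,
        exists_or, exists_eq_left, ne_eq, hown, not_false_eq_true, true_and]
      exact or_comm.trans or_assoc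
    · simp only [List.length_append, List.length_cons]; omega
  · intro l
    by_cases hl : l = Q.new G
    · subst hl; simp
    · simp [hl]
  · rintro ⟨M, es⟩ t₂ ⟨p, hp, h1, h2, h3⟩ ht₂
    rw [List.append_nil] at hp
    subst hp
    simp only at h1 h2 h3
    have hMnew : M (Q.new G) = true := (h1 _).2 (Or.inl rfl)
    set lab₀ := Function.update G.label Q.node (some (Q.new G)) with hlab₀
    -- Relabelling is idempotent, because the new label is itself marked. So the array may be
    -- overwritten in place: the relabelled values never change.
    refine runs_forT 3 (fun r (lab : ℕ → Option ℕ) =>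
      (∀ u, relabel M (Q.new G) (lab u) = relabel M (Q.new G) (lab₀ u)) ∧
      (∀ u < V, u ∉ r → lab u = relabel M (Q.new G) (lab₀ u)) ∧
      (∀ u, ¬ u < V → lab u = none)) ?_ ⟨by simp, ?_, ?_⟩ ?_
    · rintro u r lab ⟨h4, h5, h6⟩
      simp only [runs_bind, runs_rd]
      have hskip : lab u = relabel M (Q.new G) (lab u) →
          ∀ u' < V, u' ∉ r → lab u' = relabel M (Q.new G) (lab₀ u') := by
        intro hu u' hu' hr
        by_cases huu : u' = u
        · subst huu
          rw [hu, h4]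
        · exact h5 u' hu' (by simp [huu, hr])
      cases hlu : lab u with
      | none =>
        simp only [runs_pure]
        exact ⟨⟨h4, hskip (by rw [hlu]; rfl), h6⟩, by norm_num⟩
      | some l =>
        simp only [runs_bind, runs_rd, runs_ite, runs_wr, runs_pure]
        refine ⟨fun hM => ⟨⟨?_, ?_, ?_⟩, by norm_num⟩, fun hM => ⟨⟨h4, hskip ?_, h6⟩, by norm_num⟩⟩
        · intro u'
          by_cases huu : u' = u
          · subst huu
            rw [Function.update_self, ← h4, hlu]
            simp [relabel, hM, hMnew]
          · rw [Function.update_of_ne huu, h4]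
        · intro u' hu' hr
          by_cases huu : u' = u
          · subst huu
            rw [Function.update_self, ← h4, hlu]
            simp [relabel, hM]
          · rw [Function.update_of_ne huu]
            exact h5 u' hu' (by simp [huu, hr])
        · intro u' hu'
          have huu : u' ≠ u := by
            rintro rfl
            rw [h6 _ hu'] at hlu
            simp at hlu
          rw [Function.update_of_ne huu, h6 _ hu']
        · rw [hlu]
          simp [relabel, hM]
    · intro u hu hu'
      exact absurd (List.mem_range.2 hu) hu'
    · intro u hu
      have huu : u ≠ Q.node := by
        rintro rfl
        exact hu hQ.node_lt
      rw [hlab₀, Function.update_of_ne huu]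
      cases hl : G.label u with
      | none => rfl
      | some l => exact absurd (hG.label_mem u l hl).1 hu
    · rintro lab t₃ ⟨h4, h5, h6⟩ ht₃
      rw [List.length_range] at ht₃
      refine runs_forT 2 (fun r acc => ∃ p, G.trees = p ++ r ∧
        acc = (p.filter fun l => !M l).reverse ++ [Q.new G]) ?_ ⟨[], by simp⟩ ?_
      · rintro l r acc ⟨p, hp, rfl⟩
        simp only [runs_bind, runs_rd, runs_ite, runs_pure, runs_push]
        refine ⟨fun hM => ⟨⟨p ++ [l], by simp [hp], by simp [hM]⟩, by norm_num⟩,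
          fun hM => ⟨⟨p ++ [l], by simp [hp], by simp [hM]⟩, by norm_num⟩⟩
      · rintro trees t₄ ⟨p, hp, rfl⟩ ht₄
        rw [List.append_nil] at hp
        subst hp
        simp only [runs_pure]
        refine ⟨⟨M, h1, ?_, rfl, h2, h3⟩, by omega⟩
        intro u
        by_cases hu : u < V
        · exact h5 u hu (by simp)
        · simp only [← hlab₀, ← h4]
          rw [h6 u hu]
          rfl

/-- Merging `j ≥ 2` trees adds at most `j ≤ 2 (j - 1)` edges and removes at least `j - 1` trees, so
the number of edges plus twice the number of trees does not increase. The clause on closed sets says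
that all edges are connected to the sink, which is node `0`. -/
theorem runs_kleinRavi {V k : ℕ} (pos : ℕ → Pt) (hk : 0 < k) (hkV : k ≤ V) :
    Runs (kleinRavi V pos k) (fun E t => E.length ≤ 2 * k ∧
      (∀ S : ℕ → Prop, S 0 → (∀ e ∈ E, (S e.1 ↔ S e.2)) → ∀ e ∈ E, S e.1) ∧
      t ≤ 200 * (k + 1) * (V + 1) * (V + (k + 1) ^ 2)) := by
  unfold kleinRavi
  simp only [runs_bind]
  refine runs_alloc fun t₁ ht₁ => ?_
  refine runs_forT 2 (fun r (G : Forest) => ∃ i, List.range k = List.range i ++ r ∧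
    G.trees = (List.range i).reverse ∧ G.edges = [] ∧
    ∀ u, G.label u = if u < i then some u else none) ?_ ⟨0, by simp⟩ ?_
  · rintro j r G ⟨i, hi, h1, h2, h3⟩
    simp only [runs_bind, runs_wr, runs_push, runs_pure]
    have hik : i < k := by
      have := congrArg List.length hi
      simp at this
      omega
    have hji : j = i := by
      have := congrArg (fun l => l[i]?) hi
      simpa [hik] using this.symm
    subst hji
    refine ⟨⟨j + 1, by simp [hi, List.range_succ], by simp [h1, List.range_succ], trivial, ?_⟩,
      by norm_num⟩
    intro u
    by_cases hu : u = j
    · subst hu; simp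
    · rw [Function.update_of_ne hu, h3]
      have : u < j ↔ u < j + 1 := by omega
      simp only [this]
  · rintro G₀ t₂ ⟨i, hi, h1, h2, h3⟩ ht₂
    rw [List.length_range] at ht₂
    rw [List.append_nil] at hi
    obtain rfl : k = i := by simpa using congrArg List.length hi
    have hgood : G₀.Good V := by
      refine ⟨by simp [h1, List.nodup_range], ?_, ?_, by simp [h2], ?_, by simp [h3, hk]⟩
      · intro l hl
        simp only [h1, List.mem_reverse, List.mem_range] at hl
        exact ⟨l, by omega, by simp [h3, hl]⟩
      · intro u l hu
        rw [h3] at hu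
        split at hu
        · rename_i hlt
          obtain rfl := Option.some.inj hu
          exact ⟨by omega, by simp [h1, hlt]⟩
        · simp at hu
      · intro S _ u v l hu hv
        rw [h3] at hu hv
        split at hu
        · split at hv
          · rw [Option.some.inj hu, Option.some.inj hv]
          · simp at hv
        · simp at hu
    have hT₀ : G₀.trees.length = k := by simp [h1]
    set A := 100 * (V + 1) * (V + (k + 1) ^ 2) with hA
    refine runs_whileT (fun (G : Forest) t => G.Good V ∧
      G.edges.length + 2 * G.trees.length ≤ 2 * k ∧
      t + G.trees.length * A ≤ k * A) (k * A) (fun _ _ h => by omega) ?_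
      ⟨hgood, by simp [h2, hT₀], by simp [hT₀]⟩
    rintro G t ⟨hG, hE, ht⟩
    simp only [runs_bind]
    refine runs_lenT fun t₃ ht₃ => ?_
    simp only [runs_step, decide_eq_true_eq, decide_eq_false_iff_not]
    have hTk : G.trees.length ≤ k := by omega
    refine ⟨fun hT => ?_, fun hT => ?_⟩
    · refine (runs_minQuotient (by omega) hG.nodup hG.inhabited hT).mono ?_
      rintro q t₄ ⟨⟨Q, rfl, hQ⟩, ht₄⟩
      refine (runs_merge hQ hG).mono ?_
      rintro G' t₅ ⟨⟨M, hM⟩, ht₅⟩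
      have hlen := hM.trees_length hQ
      have h5 := hM.length
      have h6 := hQ.two_le
      refine ⟨hM.good hQ hG, by omega, ?_⟩
      have hcost : t₃ + 1 + 1 + (t₄ + t₅) ≤ A := by
        have e1 : (G.trees.length + 1) ^ 2 ≤ (k + 1) ^ 2 := Nat.pow_le_pow_left (by omega) 2
        have e2 : 50 * V * (V + (G.trees.length + 1) ^ 2) ≤ 50 * V * (V + (k + 1) ^ 2) :=
          Nat.mul_le_mul_left _ (by omega)
        rw [hA]
        nlinarith
      have e3 : (G'.trees.length + 1) * A ≤ G.trees.length * A :=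
        Nat.mul_le_mul_right _ (by omega)
      nlinarith
    · simp only [runs_pure]
      obtain ⟨l₀, hl₀⟩ := Option.ne_none_iff_exists'.1 hG.root
      refine ⟨by omega, ?_, ?_⟩
      · intro S hS0 hS e he
        obtain ⟨l, hl, -⟩ := hG.edge e he
        have hll : l = l₀ := by
          have m1 := (hG.label_mem _ _ hl).2
          have m2 := (hG.label_mem _ _ hl₀).2
          revert m1 m2
          match hh : G.trees with
          | [] => simp
          | [a] => simp; rintro rfl rfl; rfl
          | a :: b :: r => simp [hh] at hT
        subst hll
        exact (hG.conn S hS _ _ _ hl hl₀).2 hS0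
      · have hX : k + 1 ≤ (V + 1) * (V + (k + 1) ^ 2) := by nlinarith
        rw [hA] at ht
        nlinarith

/-! ### The Hungarian method -/

theorem runs_scanColumn (a : ℕ × ℕ → ℝ) (s : Search) (i : ℕ) (r : Scan) (j : ℕ) :
    Runs (scanColumn a s i r j) (fun r' t => t ≤ 15 ∧
      (∀ l, r'.way l = r.way l ∨ r'.way l = s.cur) ∧
      (∀ l, s.used l = true → r'.way l = r.way l) ∧
      (∀ b, r'.best = some b → r.best = some b ∨ (b.2 = j ∧ s.used j = false)) ∧
      (r.best ≠ none → r'.best ≠ none) ∧ (s.used j = false → r'.best ≠ none)) := by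
  simp only [scanColumn, runs_bind, runs_rd, runs_ite, runs_pure]
  refine ⟨fun hu => ⟨by norm_num, by simp, by simp, fun _ => Or.inl, by simp, by simp [hu]⟩,
    fun hu => ?_⟩
  have hu' : s.used j = false := by simpa using hu
  simp only [runs_sub, runs_mk_zero]
  have main : ∀ (minv : ℕ → Option ℝ) (way : ℕ → ℕ) (T : ℕ), minv j ≠ none →
      (∀ l, way l = r.way l ∨ way l = s.cur) → (∀ l, s.used l = true → way l = r.way l) → T ≤ 11 →
      Runs (match minv j, r.best with
        | none, b => return ⟨minv, way, b⟩
        | some x, none => return ⟨minv, way, some (x, j)⟩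
        | some x, some b => do
          let less ← ltT x b.1
          return ⟨minv, way, if less then some (x, j) else some b⟩ : Timed Scan)
        (fun r' t => T + t ≤ 15 ∧
        (∀ l, r'.way l = r.way l ∨ r'.way l = s.cur) ∧
        (∀ l, s.used l = true → r'.way l = r.way l) ∧
        (∀ b, r'.best = some b → r.best = some b ∨ (b.2 = j ∧ s.used j = false)) ∧
        (r.best ≠ none → r'.best ≠ none) ∧ (s.used j = false → r'.best ≠ none)) := by
    intro minv way T h1 h2 h3 hT
    obtain ⟨x, hx⟩ := Option.ne_none_iff_exists'.1 h1
    rw [hx]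
    cases hb : r.best with
    | none =>
      simp only [runs_pure]
      refine ⟨by omega, h2, h3, ?_, by simp, by simp⟩
      rintro b hb
      rw [← Option.some.inj hb]
      exact Or.inr ⟨rfl, hu'⟩
    | some b =>
      simp only [runs_bind, runs_ltT, runs_mk_zero, runs_pure]
      refine ⟨by omega, h2, h3, ?_, ?_, ?_⟩
      · intro b' hb'
        split at hb'
        · rw [← Option.some.inj hb']
          exact Or.inr ⟨rfl, hu'⟩
        · exact Or.inl hb'
      · intro _; split <;> simp
      · intro _; split <;> simp
  have hw : ∀ l, Function.update r.way j s.cur l = r.way l ∨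
      Function.update r.way j s.cur l = s.cur := by
    intro l
    by_cases hl : l = j
    · subst hl; simp
    · exact Or.inl (Function.update_of_ne hl _ _)
  have hw' : ∀ l, s.used l = true → Function.update r.way j s.cur l = r.way l := by
    intro l hl
    refine Function.update_of_ne ?_ _ _
    rintro rfl
    exact hu hl
  cases hm : r.minv j with
  | none =>
    simp only [runs_bind, runs_step, if_true, runs_wr, runs_rd]
    refine (main (Function.update r.minv j (some (a (i, j) - s.u i - s.v j)))
      (Function.update r.way j s.cur) 11 (by simp) hw hw' (by norm_num)).mono ?_
    rintro r' t ⟨h, h'⟩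
    exact ⟨by omega, h'⟩
  | some o =>
    simp only [runs_bind, runs_ltT, runs_mk_zero, runs_ite, runs_wr, runs_pure, runs_rd,
      decide_eq_true_eq]
    refine ⟨fun h => ⟨fun _ => ?_, fun h' => absurd h h'⟩,
      fun h => ⟨fun h' => absurd h' h, fun _ => ?_⟩⟩
    · refine (main (Function.update r.minv j (some (a (i, j) - s.u i - s.v j)))
      (Function.update r.way j s.cur) 11 (by simp) hw hw' (by norm_num)).mono ?_
      rintro r' t ⟨h, h'⟩
      exact ⟨by omega, h'⟩
    · refine (main r.minv r.way 10 (by simp [hm]) (fun _ => Or.inl rfl) (fun _ _ => rfl)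
        (by norm_num)).mono ?_
      rintro r' t ⟨h, h'⟩
      exact ⟨by omega, h'⟩

theorem runs_shiftDual (n : ℕ) (row : ℕ → ℕ) (δ : ℝ) (s : Search) :
    Runs (shiftDual n row δ s) (fun s' t => s'.used = s.used ∧ s'.way = s.way ∧
      t ≤ 9 * (n + 1) + 1) := by
  unfold shiftDual
  refine runs_forT_mem 8 (fun s' => s'.used = s.used ∧ s'.way = s.way) ?_ ⟨rfl, rfl⟩ ?_
  · rintro j s' - ⟨h1, h2⟩
    simp only [runs_bind, runs_rd, runs_ite, runs_add, runs_sub, runs_mk_zero, runs_wr, runs_pure]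
    refine ⟨fun _ => ⟨⟨h1, h2⟩, by norm_num⟩, fun _ => ?_⟩
    cases s'.minv j with
    | none =>
      simp only [runs_pure]
      exact ⟨⟨h1, h2⟩, by norm_num⟩
    | some x =>
      simp only [runs_bind, runs_sub, runs_mk_zero, runs_wr, runs_pure]
      exact ⟨⟨h1, h2⟩, by norm_num⟩
  · rintro s' t ⟨h1, h2⟩ ht
    rw [List.length_range] at ht
    exact ⟨h1, h2, by omega⟩

/-- The invariant of the search for an augmenting path after `T` steps. -/
structure SearchInv (n : ℕ) (row : ℕ → ℕ) (T : ℕ) (s : Search) : Prop where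
  cur_le : s.cur ≤ n
  cur_unused : s.used s.cur = false
  used_le : ∀ j, s.used j = true → j ≤ n ∧ row j ≠ 0
  card : ∃ U : Finset ℕ, (∀ j, s.used j = true ↔ j ∈ U) ∧ U.card = T
  start : s.cur = 0 ∨ s.used 0 = true
  way : ∀ j, s.way j = 0 ∨ s.used (s.way j) = true
  rank : ∃ rank : ℕ → ℕ, (∀ j, s.used j = true → rank j < T) ∧
    ∀ j, s.used j = true → s.way j = 0 ∨ rank (s.way j) < rank j

/-- The `T` reached columns and the current one are `T + 1` distinct numbers from `0` to `n`. -/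
theorem SearchInv.le {n : ℕ} {row : ℕ → ℕ} {T : ℕ} {s : Search} (h : SearchInv n row T s) :
    T ≤ n := by
  obtain ⟨U, hU, rfl⟩ := h.card
  have h1 : insert s.cur U ⊆ Finset.range (n + 1) := by
    intro j hj
    rw [Finset.mem_range]
    rcases Finset.mem_insert.1 hj with rfl | hj
    · have := h.cur_le
      omega
    · have := (h.used_le j ((hU j).2 hj)).1
      omega
  have h2 := Finset.card_le_card h1
  rw [Finset.card_insert_of_notMem, Finset.card_range] at h2
  · omega
  · intro hc
    have := h.cur_unused
    rw [(hU _).2 hc] at this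
    simp at this

/-- Reached columns are assigned to rows, so a free column is never among them. The scan thus finds
a column to move to, whatever the reduced costs are. -/
theorem runs_searchStep {n : ℕ} (a : ℕ × ℕ → ℝ) {row : ℕ → ℕ} {T : ℕ} {s : Search}
    (hs : SearchInv n row T s) (hrow : row s.cur ≠ 0)
    (hfree : ∃ j, 1 ≤ j ∧ j ≤ n ∧ row j = 0) :
    Runs (searchStep n a row s) (fun s' t => SearchInv n row (T + 1) s' ∧ t ≤ 30 * (n + 1)) := by
  simp only [searchStep, runs_bind, runs_wr, runs_rd]
  set used := Function.update s.used s.cur true with hused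
  have hmono : ∀ j, s.used j = true → used j = true := by
    intro j hj
    by_cases h : j = s.cur
    · rw [h, hused, Function.update_self]
    · rw [hused, Function.update_of_ne h, hj]
  have hcur : used s.cur = true := by rw [hused, Function.update_self]
  have hused' : ∀ j, used j = true → j = s.cur ∨ s.used j = true := by
    intro j hj
    by_cases h : j = s.cur
    · exact Or.inl h
    · rw [hused, Function.update_of_ne h] at hj
      exact Or.inr hj
  obtain ⟨j₀, hj1, hjn, hj0⟩ := hfree
  have hj₀ : used j₀ = false := by
    by_contra hne
    rcases hused' j₀ (by simpa using hne) with rfl | h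
    · exact hrow hj0
    · exact (hs.used_le _ h).2 hj0
  -- The list element `j` stands for column `j + 1`; once the element `j₀ - 1` has been processed, a
  -- best column is known.
  refine runs_forT 15 (fun l (r : Scan) => (∀ j ∈ l, j < n) ∧
    (∀ j, r.way j = s.way j ∨ r.way j = s.cur) ∧ (∀ j, used j = true → r.way j = s.way j) ∧
    (∀ b, r.best = some b → b.2 ≤ n ∧ used b.2 = false) ∧
    (j₀ - 1 ∉ l → r.best ≠ none)) ?_ ?_ ?_
  · rintro j l r ⟨h0, h1, h1', h2, h3⟩
    refine (runs_scanColumn a _ _ _ _).mono ?_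
    rintro r' t ⟨ht, h4, h4', h5, h6, h7⟩
    refine ⟨⟨fun i hi => h0 i (List.mem_cons_of_mem _ hi), ?_,
      fun i hi => (h4' i hi).trans (h1' i hi), ?_, ?_⟩, ht⟩
    · intro i
      rcases h4 i with h | h
      · rw [h]; exact h1 i
      · exact Or.inr h
    · intro b hb
      rcases h5 b hb with h | ⟨h, h'⟩
      · exact h2 b h
      · have := h0 j List.mem_cons_self
        exact ⟨by omega, by rw [h]; exact h'⟩
    · intro hl
      by_cases hj : j₀ - 1 = j
      · apply h7
        rw [show j + 1 = j₀ by omega]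
        exact hj₀
      · exact h6 (h3 (by simp [hj, hl]))
  · refine ⟨fun j => List.mem_range.1, fun _ => Or.inl rfl, fun _ _ => rfl, by simp, ?_⟩
    intro h
    exact absurd (List.mem_range.2 (by omega)) h
  · rintro r t ⟨-, h1, h1', h2, h3⟩ ht
    rw [List.length_range] at ht
    obtain ⟨b, hb⟩ := Option.ne_none_iff_exists'.1 (h3 (by simp))
    obtain ⟨hbn, hbu⟩ := h2 b hb
    rw [hb]
    simp only [runs_bind]
    refine (runs_shiftDual _ _ _ _).mono ?_
    rintro s' t' ⟨h4, h5, ht'⟩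
    simp only [runs_pure]
    simp only at h4 h5
    have hused0 : used 0 = true := by
      rcases hs.start with h | h
      · rw [← h]; exact hcur
      · exact hmono 0 h
    refine ⟨⟨hbn, ?_, ?_, ?_, ?_, ?_, ?_⟩, by omega⟩
    · simp only [h4]; exact hbu
    · intro j hj
      rw [h4] at hj
      rcases hused' j hj with rfl | h
      · exact ⟨hs.cur_le, hrow⟩
      · exact hs.used_le j h
    · obtain ⟨U, hU, hc⟩ := hs.card
      refine ⟨insert s.cur U, ?_, ?_⟩
      · intro j
        rw [h4, Finset.mem_insert, ← hU]
        constructor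
        · exact hused' j
        · rintro (rfl | h)
          · exact hcur
          · exact hmono j h
      · rw [Finset.card_insert_of_notMem, hc]
        rw [← hU, hs.cur_unused]
        simp
    · exact Or.inr (by rw [h4]; exact hused0)
    · intro j
      simp only [h4, h5]
      rcases h1 j with h | h
      · rw [h]
        exact (hs.way j).imp id (hmono _)
      · rw [h]
        exact Or.inr hcur
    · obtain ⟨rank, hr1, hr2⟩ := hs.rank
      -- Columns are ranked in the order in which they are reached, so the current one gets rank
      -- `T`.
      refine ⟨fun j => if j = s.cur then T else rank j, ?_, ?_⟩
      · intro j hj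
        rw [h4] at hj
        rcases hused' j hj with rfl | h
        · simp
        · have := hr1 j h
          simp only
          split <;> omega
      · intro j hj
        rw [h4] at hj
        simp only [h5, h1' j hj]
        rcases hs.way j with h | h
        · exact Or.inl h
        have hne : s.way j ≠ s.cur := by
          intro hc
          rw [hc, hs.cur_unused] at h
          simp at h
        rw [if_neg hne]
        by_cases hjc : j = s.cur
        · rw [if_pos hjc]
          exact Or.inr (hr1 _ h)
        · rw [if_neg hjc]
          exact hr2 j ((hused' j hj).resolve_left hjc)

/-- The number of columns from `1` to `n` that are assigned to a row. -/
def assigned (n : ℕ) (row : ℕ → ℕ) : ℕ := ((Finset.Icc 1 n).filter fun j => row j ≠ 0).card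

theorem exists_free {n : ℕ} {row : ℕ → ℕ} (h : assigned n row < n) :
    ∃ j, 1 ≤ j ∧ j ≤ n ∧ row j = 0 := by
  by_contra hcon
  push Not at hcon
  have : (Finset.Icc 1 n).filter (fun j => row j ≠ 0) = Finset.Icc 1 n := by
    refine Finset.filter_true_of_mem fun j hj => ?_
    rw [Finset.mem_Icc] at hj
    exact hcon j hj.1 hj.2
  rw [assigned, this] at h
  simp at h

/-- At most `n` search steps of cost `O(n)` each. Shifting the rows along the path occupies only one
new column, the last one reached; hence a free column remains for each later row. -/
theorem runs_assignRow {n : ℕ} (a : ℕ × ℕ → ℝ) {D : Dual} {i : ℕ} (hi : i ≠ 0)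
    (hD : assigned n D.row < n) :
    Runs (assignRow n a D i) (fun D' t => assigned n D'.row ≤ assigned n D.row + 1 ∧
      t ≤ 100 * (n + 1) ^ 2) := by
  simp only [assignRow, runs_bind, runs_wr]
  refine runs_alloc fun t₁ ht₁ => runs_alloc fun t₂ ht₂ => runs_alloc fun t₃ ht₃ => ?_
  set row := Function.update D.row 0 i with hrow
  have hrow' : ∀ j, j ≠ 0 → row j = D.row j := fun j hj => Function.update_of_ne hj _ _
  have hfree : ∃ j, 1 ≤ j ∧ j ≤ n ∧ row j = 0 := by
    obtain ⟨j, h1, h2, h3⟩ := exists_free hD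
    exact ⟨j, h1, h2, by rw [hrow' j (by omega), h3]⟩
  refine runs_whileT (fun s t => ∃ T, SearchInv n row T s ∧ t ≤ T * (30 * (n + 1) + 3))
    (n * (30 * (n + 1) + 3)) ?_ ?_ ⟨0, ⟨by simp, rfl, by simp, ⟨∅, by simp⟩, Or.inl rfl,
      fun _ => Or.inl rfl, ⟨fun _ => 0, by simp⟩⟩, by simp⟩
  · rintro s t ⟨T, hs, ht⟩
    exact ht.trans (Nat.mul_le_mul_right _ hs.le)
  · rintro s t ⟨T, hs, ht⟩
    simp only [runs_bind, runs_rd, runs_step, decide_eq_true_eq, decide_eq_false_iff_not, not_not]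
    have hT := hs.le
    have ht' : t ≤ n * (30 * (n + 1) + 3) := ht.trans (Nat.mul_le_mul_right _ hT)
    refine ⟨fun h => ?_, fun h => ?_⟩
    · refine (runs_searchStep a hs h hfree).mono ?_
      rintro s' t' ⟨hs', ht'⟩
      exact ⟨T + 1, hs', by rw [Nat.succ_mul]; omega⟩
    · obtain ⟨rank, hr1, hr2⟩ := hs.rank
      have hc0 : s.cur ≠ 0 := by
        intro hc
        rw [hc, hrow, Function.update_self] at h
        exact hi h
      -- The potential for walking back: `0` at the virtual column, above all others at the
      -- unreached end of the path, and in between the rank shifted by one. Each step lowers it and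
      -- costs five.
      let R : ℕ → ℕ := fun j => if j = 0 then 0 else if s.used j = true then rank j + 1 else T + 1
      have hR : ∀ j, R j ≤ T + 1 := by
        intro j
        simp only [R]
        split
        · omega
        · split
          · have := hr1 j (by assumption)
            omega
          · omega
      have hRway : ∀ j, j ≠ 0 → R (s.way j) < R j := by
        intro j hj
        simp only [R, hj, if_false]
        rcases hs.way j with hw | hw
        · rw [if_pos hw]
          split <;> omega
        · have h1 := hr1 _ hw
          by_cases hw0 : s.way j = 0
          · rw [if_pos hw0]
            split <;> omega
          · rw [if_neg hw0, if_pos hw]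
            split
            · rename_i hu
              have := (hr2 j hu).resolve_left hw0
              omega
            · omega
      refine runs_whileT (fun (r : (ℕ → ℕ) × ℕ) t => (∀ j, r.1 j ≠ 0 → row j ≠ 0 ∨ j = s.cur) ∧
        (r.2 = s.cur ∨ s.used r.2 = true ∨ r.2 = 0) ∧ t + 5 * R r.2 ≤ 5 * (T + 1))
        (5 * (T + 1)) (fun _ _ h => by omega) ?_ ⟨fun j hj => Or.inl hj, Or.inl rfl, ?_⟩
      · rintro ⟨row', j⟩ t₄ ⟨h1, h2, h3⟩
        simp only at h1 h2 h3
        simp only [runs_step, runs_bind, runs_rd, runs_wr, runs_pure, decide_eq_true_eq,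
          decide_eq_false_iff_not, not_not]
        refine ⟨fun hj => ⟨?_, ?_, ?_⟩, fun hj => ⟨?_, ?_⟩⟩
        · intro l hl
          by_cases hlj : l = j
          · subst hlj
            rcases h2 with h2 | h2 | h2
            · exact Or.inr h2
            · exact Or.inl (hs.used_le _ h2).2
            · exact absurd h2 hj
          · rw [Function.update_of_ne hlj] at hl
            exact h1 l hl
        · rcases hs.way j with h | h
          · exact Or.inr (Or.inr h)
          · exact Or.inr (Or.inl h)
        · have := hRway j hj
          omega
        · have hsub : (Finset.Icc 1 n).filter (fun j => row' j ≠ 0) ⊆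
              insert s.cur ((Finset.Icc 1 n).filter fun j => D.row j ≠ 0) := by
            intro l hl
            rw [Finset.mem_filter, Finset.mem_Icc] at hl
            rw [Finset.mem_insert, Finset.mem_filter, Finset.mem_Icc]
            rcases h1 l hl.2 with h | h
            · rw [hrow' l (by omega)] at h
              exact Or.inr ⟨hl.1, h⟩
            · exact Or.inl h
          exact (Finset.card_le_card hsub).trans (Finset.card_insert_le _ _)
        · nlinarith
      · have := hR s.cur
        simp only
        omega

theorem runs_hungarian (n : ℕ) (a : ℕ × ℕ → ℝ) :
    Runs (hungarian n a) (fun _ t => t ≤ 200 * (n + 1) ^ 3) := by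
  simp only [hungarian, runs_bind]
  refine runs_alloc fun t₁ ht₁ => runs_alloc fun t₂ ht₂ => runs_alloc fun t₃ ht₃ => ?_
  refine runs_forT (100 * (n + 1) ^ 2)
    (fun l (D : Dual) => assigned n D.row + l.length ≤ n) ?_ (by simp [assigned]) ?_
  · rintro i l D h
    rw [List.length_cons] at h
    refine (runs_assignRow a (Nat.succ_ne_zero i) (by omega)).mono ?_
    rintro D' t ⟨h1, h2⟩
    exact ⟨by omega, h2⟩
  · rintro D t - ht
    rw [List.length_range] at ht
    simp only [runs_pure]
    nlinarith

variable {m n : ℕ}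

/-! ### Coverage -/

/-- All targets within the sensing range of `p` are marked in `c`. -/
def Covers (I : Network m n) (p : Pt) (c : Fin m → Bool) : Prop :=
  ∀ i, (I.target i).dist p ≤ I.Rs → c i = true

theorem runs_markCovered (I : Network m n) (p : Pt) (c : Fin m → Bool) :
    Runs (markCovered I p c) (fun c' t => t ≤ 10 * (m + 1) ∧ Covers I p c' ∧
      ∀ i, c i = true → c' i = true) := by
  unfold markCovered
  refine runs_forT 9 (fun l (c' : Fin m → Bool) => (∀ i, c i = true → c' i = true) ∧
    ∀ i, i ∉ l → (I.target i).dist p ≤ I.Rs → c' i = true) ?_ ⟨fun _ => id, by simp⟩ ?_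
  · rintro i l c' ⟨h1, h2⟩
    simp only [runs_bind, runs_rd, runs_within, runs_ite, runs_wr, runs_pure, decide_eq_true_eq]
    refine ⟨fun h => ⟨⟨?_, ?_⟩, by norm_num⟩, fun h => ⟨⟨h1, ?_⟩, by norm_num⟩⟩
    · intro j hj
      by_cases hji : j = i
      · subst hji; simp
      · rw [Function.update_of_ne hji]; exact h1 j hj
    · intro j hj hd
      by_cases hji : j = i
      · subst hji; simp
      · rw [Function.update_of_ne hji]; exact h2 j (by simp [hji, hj]) hd
    · intro j hj hd
      by_cases hji : j = i
      · subst hji; exact absurd hd h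
      · exact h2 j (by simp [hji, hj]) hd
  · rintro c' t ⟨h1, h2⟩ ht
    rw [List.length_finRange] at ht
    exact ⟨by omega, fun i => h2 i (by simp), h1⟩

theorem runs_coverage (I : Network m n) (L : List Pt) :
    Runs (coverage I L) (fun c t => t ≤ 20 * (m + 1) * (L.length + 1) ∧ ∀ p ∈ L, Covers I p c) := by
  simp only [coverage, runs_bind]
  refine runs_alloc fun t₁ ht₁ => ?_
  refine runs_forT (10 * (m + 1)) (fun l c => ∀ p ∈ L, p ∉ l → Covers I p c) ?_ ?_ ?_
  · intro p l c h
    refine (runs_markCovered I p c).mono ?_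
    rintro c' t ⟨h1, h2, h3⟩
    refine ⟨fun q hq hql => ?_, h1⟩
    by_cases hqp : q = p
    · subst hqp; exact h2
    · exact fun i hi => h3 i (h q hq (by simp [hqp, hql]) i hi)
  · intro p hp hp'
    exact absurd hp hp'
  · intro c t h ht
    exact ⟨by nlinarith, fun p hp => h p hp (by simp)⟩

theorem runs_allMarked (c : Fin m → Bool) (ts : List (Fin m)) :
    Runs (allMarked c ts) (fun b t => t ≤ 2 * ts.length + 1 ∧
      (b = false → ∃ i ∈ ts, c i = false)) := by
  unfold allMarked
  refine runs_forT 1 (fun l b => l ⊆ ts ∧ (b = false → ∃ i ∈ ts, c i = false)) ?_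
    ⟨List.Subset.refl _, by simp⟩ ?_
  · rintro i l b ⟨h1, h2⟩
    simp only [runs_bind, runs_rd, runs_pure]
    refine ⟨⟨fun j hj => h1 (List.mem_cons_of_mem _ hj), ?_⟩, by norm_num⟩
    intro h
    rw [Bool.and_eq_false_iff] at h
    exact h.elim h2 fun h => ⟨i, h1 List.mem_cons_self, h⟩
  · rintro b t ⟨-, h⟩ ht
    exact ⟨by omega, h⟩

theorem runs_someUncovered (I : Network m n) (L : List Pt) :
    Runs (someUncovered I L) (fun _ t => t ≤ 30 * (m + 1) * (L.length + 1)) := by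
  simp only [someUncovered, runs_bind]
  refine (runs_coverage I L).mono ?_
  rintro c t ⟨ht, -⟩
  refine (runs_allMarked c _).mono ?_
  rintro b t' ⟨ht', -⟩
  rw [List.length_finRange] at ht'
  simp only [runs_pure]
  nlinarith

/-! ### Reference points -/

/-- For the location of a target, an unmarked element of `cov` must be that target, so a walk to it
stops within distance `Rs`. For an intersection point only the length of `cov` matters: a walk may
continue until the point itself is reached. -/
structure Ref.Good (I : Network m n) (r : Ref m) : Prop where
  length_le : r.cov.length ≤ m
  target : r.inter = false → ∃ i, r.pos = I.target i ∧ r.cov = [i]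

theorem runs_targetsNear (I : Network m n) (p : Pt) :
    Runs (targetsNear I p) (fun l t => l.length ≤ m ∧ t ≤ 10 * (m + 1)) := by
  unfold targetsNear
  refine runs_forT 9 (fun l (acc : List (Fin m)) => acc.length + l.length ≤ m) ?_ (by simp) ?_
  · intro i l acc h
    rw [List.length_cons] at h
    simp only [runs_bind, runs_rd, runs_within, runs_ite, runs_push, runs_pure]
    exact ⟨fun _ => ⟨by rw [List.length_cons]; omega, by norm_num⟩,
      fun _ => ⟨by omega, by norm_num⟩⟩
  · intro acc t h ht
    rw [List.length_finRange] at ht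
    exact ⟨by simpa using h, by omega⟩

theorem runs_references (I : Network m n) :
    Runs (references I) (fun X t => X.length ≤ 2 * (m + 1) ^ 2 ∧ (∀ r ∈ X, r.Good I) ∧
      t ≤ 200 * (m + 1) ^ 3) := by
  simp only [references, runs_bind]
  refine runs_forT_sum 2 List.length (fun _ => 1) (fun X => ∀ r ∈ X, r.Good I) ?_ (by simp) ?_
  · intro i X _ hX
    simp only [runs_bind, runs_rd, runs_push]
    refine ⟨⟨?_, by simp⟩, by norm_num⟩
    intro r hr
    rcases List.mem_cons.1 hr with rfl | hr
    · exact ⟨by have := i.pos; simp only [List.length_singleton]; omega, fun _ => ⟨i, rfl, rfl⟩⟩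
    · exact hX r hr
  · intro X t hX hlen ht
    rw [List.length_finRange] at ht
    simp only [List.map_const', List.length_finRange, List.sum_replicate, smul_eq_mul, mul_one,
      List.length_nil, zero_add] at hlen
    refine runs_forT_sum (m * (20 * m + 90) + 1) List.length (fun _ => 2 * m)
      (fun X => ∀ r ∈ X, r.Good I) ?_ hX ?_
    · intro i X _ hX
      refine runs_forT_sum (20 * m + 89) List.length (fun _ => 2)
        (fun X => ∀ r ∈ X, r.Good I) ?_ hX ?_
      · intro j X _ hX
        simp only [runs_bind, runs_step, runs_ite, runs_rd, runs_pure]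
        refine ⟨fun _ => ?_, fun _ => ⟨⟨hX, by omega⟩, by omega⟩⟩
        refine (runs_circleInter _ _ _).mono ?_
        rintro ps t ⟨h1, h2⟩
        refine runs_forT_sum (10 * (m + 1) + 1) List.length (fun _ => 1)
          (fun X => ∀ r ∈ X, r.Good I) ?_ hX ?_
        · intro z X _ hX
          simp only [runs_bind]
          refine (runs_targetsNear I z).mono ?_
          rintro cov t ⟨h3, h4⟩
          simp only [runs_push]
          refine ⟨⟨?_, by simp⟩, by omega⟩
          intro r hr
          rcases List.mem_cons.1 hr with rfl | hr
          · exact ⟨h3, by simp⟩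
          · exact hX r hr
        · intro X' t' h3 h4 h5
          simp only [List.map_const', List.sum_replicate, smul_eq_mul, mul_one] at h4
          exact ⟨⟨h3, by omega⟩, by nlinarith⟩
      · intro X' t' h3 h4 h5
        rw [List.length_finRange] at h5
        simp only [List.map_const', List.length_finRange, List.sum_replicate, smul_eq_mul] at h4
        exact ⟨⟨h3, by omega⟩, by linarith⟩
    · intro X' t' h3 h4 h5
      rw [List.length_finRange] at h5
      simp only [List.map_const', List.length_finRange, List.sum_replicate, smul_eq_mul] at h4
      exact ⟨by nlinarith, h3, by nlinarith⟩

/-- The distance from a reference point at which all of its targets are covered for sure, apart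
from the point itself. -/
def Ref.radius (I : Network m n) (r : Ref m) : ℝ := if r.inter then 0 else I.Rs

theorem Ref.radius_nonneg {I : Network m n} (hRs : 0 ≤ I.Rs) (r : Ref m) : 0 ≤ r.radius I := by
  unfold Ref.radius
  split
  · exact le_rfl
  · exact hRs

/-! ### Walks -/

theorem Pt.mix_mix (s s' : ℝ) (p q : Pt) :
    mix s' (mix s p q) q = mix (s + s' * (1 - s)) p q := by
  simp only [mix, Pt.mk.injEq]
  constructor <;> ring

theorem runs_extend {I : Network m n} (hRt : 0 < I.Rt) (q : Pt) (s : Trail m) :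
    Runs (extend I q s) (fun s' t => t ≤ 10 * (m + 1) + 31 ∧ s'.pts = s'.cur :: s.pts ∧
      Covers I s'.cur s'.covered ∧ (∀ i, s.covered i = true → s'.covered i = true) ∧
      s.cur.dist s'.cur ≤ I.Rt ∧ s'.cur.dist q ≤ max 0 (s.cur.dist q - I.Rt) ∧
      ∃ a, 0 ≤ a ∧ a ≤ 1 ∧ s'.cur = Pt.mix a s.cur q) := by
  simp only [extend, runs_bind]
  refine (runs_advance hRt _ _).mono ?_
  rintro z t ⟨h1, h2, h3, h4⟩
  refine (runs_markCovered I z _).mono ?_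
  rintro c t' ⟨h5, h6, h7⟩
  simp only [runs_push, runs_pure]
  exact ⟨by omega, trivial, h6, h7, h2, h3, h4⟩

/-- The outcome of a walk from the last point of the trail `s₀` towards `q` that generates `j`
points. -/
structure Walked (I : Network m n) (q : Pt) (ρ : ℝ) (s₀ s : Trail m) (j : ℕ) : Prop where
  length : s.pts.length = s₀.pts.length + j
  count : j ≤ ⌈(s₀.cur.dist q - ρ) / I.Rt⌉₊
  covers : Covers I s.cur s.covered
  mono : ∀ i, s₀.covered i = true → s.covered i = true
  dist_cur : ∀ o : Pt, o.dist s.cur ≤ o.dist s₀.cur + j * I.Rt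
  dist_pts : ∀ o : Pt, ∀ p ∈ s.pts, p ∈ s₀.pts ∨ o.dist p ≤ o.dist s₀.cur + j * I.Rt
  dist_far : ∀ (o : Pt) (r : ℝ), 0 ≤ r → o.dist q ≤ ρ + r →
    o.dist s.cur ≤ o.dist s₀.cur + r + I.Rt

/-- While the walk goes on, the distance to `q` exceeds `ρ`, and each step shortens it by `Rt` or
ends at `q`; this bounds the number of points by the rounded quotient. -/
theorem runs_walk {I : Network m n} (hRt : 0 < I.Rt) (q : Pt) {ρ : ℝ} (hρ : 0 ≤ ρ)
    {cond : Trail m → Timed Bool} {K : ℕ} {s₀ : Trail m} (h₀ : Covers I s₀.cur s₀.covered)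
    (hcond : ∀ s : Trail m, Covers I s.cur s.covered →
      Runs (cond s) (fun b t => t ≤ K ∧ (b = true → ρ < s.cur.dist q))) :
    Runs (whileT cond (extend I q) s₀) (fun s t => ∃ j, Walked I q ρ s₀ s j ∧
      t ≤ (K + 50 * (m + 1)) * (j + 1)) := by
  set J := ⌈(s₀.cur.dist q - ρ) / I.Rt⌉₊ with hJ
  refine runs_whileT (fun s t => ∃ j, Walked I q ρ s₀ s j ∧
    (∃ a, 0 ≤ a ∧ a ≤ 1 ∧ s.cur = Pt.mix a s₀.cur q) ∧
    s.cur.dist q ≤ max 0 (s₀.cur.dist q - j * I.Rt) ∧ t ≤ (K + 50 * (m + 1)) * j)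
    ((K + 50 * (m + 1)) * J) ?_ ?_
    ⟨0, ?_, ⟨0, le_rfl, zero_le_one, by simp [Pt.mix]⟩, by simp, by simp⟩
  · rintro s t ⟨j, hw, -, -, ht⟩
    exact ht.trans (Nat.mul_le_mul_left _ hw.count)
  · rintro s t ⟨j, hw, ⟨a, ha0, ha1, ha⟩, hd, ht⟩
    refine (hcond s hw.covers).mono ?_
    rintro b t₁ ⟨ht₁, hb⟩
    refine ⟨fun hbt => ?_, fun _ => ⟨j, hw, by nlinarith⟩⟩
    have hfar := hb hbt
    refine (runs_extend hRt q s).mono ?_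
    rintro s' t₂ ⟨ht₂, h1, h2, h3, h4, h5, b, hb0, hb1, h6⟩
    have hpos : ρ < s₀.cur.dist q - j * I.Rt := by
      rcases le_max_iff.1 hd with h | h <;> linarith
    have hj : j + 1 ≤ J := by
      rw [Nat.succ_le_iff, hJ, Nat.lt_ceil, lt_div_iff₀ hRt]
      linarith
    have hcur : ∀ o : Pt, o.dist s'.cur ≤ o.dist s₀.cur + (j + 1 : ℕ) * I.Rt := by
      intro o
      have := Pt.dist_triangle o s.cur s'.cur
      have := hw.dist_cur o
      push_cast
      linarith
    refine ⟨j + 1, ⟨?_, hj, h2, fun i hi => h3 i (hw.mono i hi), hcur, ?_, ?_⟩,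
      ⟨a + b * (1 - a), by nlinarith, by nlinarith, by rw [h6, ha, Pt.mix_mix]⟩, ?_, ?_⟩
    · rw [h1, List.length_cons, hw.length]; omega
    · intro o p hp
      rw [h1] at hp
      rcases List.mem_cons.1 hp with rfl | hp
      · exact Or.inr (hcur o)
      · refine (hw.dist_pts o p hp).imp id fun h => h.trans ?_
        push_cast
        linarith
    -- At the last point before this step `q` was still farther than `ρ`, so `Pt.dist_mix_le` bounds
    -- the distance of that point from `o`, and the step adds at most `Rt`. Using the number of
    -- steps instead would let the distance double.
    · intro o r hr hq
      have h7 : o.dist s.cur ≤ o.dist s₀.cur + r := by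
        rw [ha]
        refine Pt.dist_mix_le ha0 ha1 hr ?_
        rw [← ha]
        linarith
      have := Pt.dist_triangle o s.cur s'.cur
      linarith
    · refine h5.trans (max_le (le_max_left _ _) ?_)
      refine le_max_of_le_right ?_
      push_cast
      rcases le_max_iff.1 hd with h | h <;> linarith
    · nlinarith
  · exact ⟨by simp, by simp, h₀, fun _ => id, by simp, fun o p hp => Or.inl hp,
      fun o r hr _ => by linarith⟩

theorem runs_walkToRef {I : Network m n} (hRs : 0 ≤ I.Rs) (hRt : 0 < I.Rt) {r : Ref m}
    (hr : r.Good I) {s₀ : Trail m} (h₀ : Covers I s₀.cur s₀.covered) :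
    Runs (walkToRef I r s₀) (fun s t => ∃ j, Walked I r.pos (r.radius I) s₀ s j ∧
      t ≤ 70 * (m + 1) * (j + 1)) := by
  have key := runs_walk hRt r.pos (r.radius_nonneg hRs) (K := 10 * (m + 1)) h₀
    (cond := fun s => do
      let reached ← leT (distT s.cur r.pos) 0
      let cov ← allMarked s.covered r.cov
      return !(reached || cov)) ?_
  · refine key.mono ?_
    rintro s t ⟨j, hw, ht⟩
    exact ⟨j, hw, by nlinarith⟩
  · intro s hs
    simp only [runs_bind, runs_leT, runs_distT, runs_zero]
    refine (runs_allMarked _ _).mono ?_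
    rintro b t ⟨ht, hb⟩
    simp only [runs_pure]
    have := hr.length_le
    refine ⟨by omega, ?_⟩
    intro h
    simp only [Bool.not_eq_true', Bool.or_eq_false_iff, decide_eq_false_iff_not, not_le] at h
    unfold Ref.radius
    split
    · exact h.1
    · rename_i hi
      obtain ⟨i, hpos, hcov⟩ := hr.target (by simpa using hi)
      obtain ⟨i', hi', hc⟩ := hb h.2
      rw [hcov, List.mem_singleton] at hi'
      subst hi'
      -- Targets within range of the last point are always marked, so an unmarked target is farther
      -- away than `Rs`.
      by_contra hle
      have := hs i' (by rw [Pt.dist_comm, ← hpos]; linarith)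
      rw [hc] at this
      simp at this

theorem runs_walkToFermat {I : Network m n} (hRs : 0 ≤ I.Rs) (hRt : 0 < I.Rt) (f : Pt)
    {s₀ : Trail m} (h₀ : Covers I s₀.cur s₀.covered) :
    Runs (walkToFermat I f s₀) (fun s t => ∃ j, Walked I f I.Rs s₀ s j ∧
      t ≤ 70 * (m + 1) * (j + 1)) := by
  have key := runs_walk hRt f hRs (K := 20) h₀
    (cond := fun s => do
      let reached ← leT (distT s.cur f) 0
      let cov ← within I.Rs f s.cur
      return !(reached || cov)) ?_
  · refine key.mono ?_
    rintro s t ⟨j, hw, ht⟩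
    exact ⟨j, hw, by nlinarith⟩
  · intro s hs
    simp only [runs_bind, runs_leT, runs_distT, runs_zero, runs_within, runs_pure]
    refine ⟨by norm_num, ?_⟩
    intro h
    simp only [Bool.not_eq_true', Bool.or_eq_false_iff, decide_eq_false_iff_not, not_le] at h
    rw [Pt.dist_comm]
    exact h.2

/-! ### Deployment along the edges of a tree -/

def Node.radius (I : Network m n) : Node m → ℝ
  | .sink _ => 0
  | .ref r => r.radius I
  | .fermat _ => I.Rs

/-- A node that `n` points in a row, starting at the sink, suffice to reach. -/
structure Node.Fits (I : Network m n) (z : Node m) : Prop where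
  dist_le : I.sink.dist z.pos ≤ z.radius I + n * I.Rt
  good : ∀ r, z = .ref r → r.Good I

/-- The triangle inequality through the sink: the stopping radius cancels, so the bound involves `n`
but neither `Rs` nor the position of the node. -/
theorem Walked.count_le {I : Network m n} (hRt : 0 < I.Rt) {z : Node m} (hz : z.Fits I)
    {s₀ s : Trail m} {j : ℕ} (h : Walked I z.pos (z.radius I) s₀ s j) {a : ℕ}
    (ha : I.sink.dist s₀.cur ≤ a * (n + 1) * I.Rt) : j ≤ (a + 1) * (n + 1) := by
  refine h.count.trans (Nat.ceil_le.2 ?_)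
  rw [div_le_iff₀ hRt]
  have h1 := hz.dist_le
  have h2 := Pt.dist_triangle s₀.cur I.sink z.pos
  rw [Pt.dist_comm s₀.cur I.sink] at h2
  push_cast
  nlinarith

/-- The outcome of the deployment along an edge to the node `j`. -/
structure Deployed (I : Network m n) (s : Deploy m) (g : Pt) (j : ℕ) (s' : Deploy m) (z : Pt)
    (b : ℕ) : Prop where
  rep : s'.rep = Function.update s.rep j (some z)
  rest : s'.rest = s.rest
  length : s'.pts.length = s.pts.length + b
  covers : Covers I z s'.covered
  mono : ∀ i, s.covered i = true → s'.covered i = true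
  dist_rep : I.sink.dist z ≤ I.sink.dist g + b * I.Rt
  dist_far : I.sink.dist z ≤ I.sink.dist g + (n + 1) * I.Rt
  dist_pts : ∀ p ∈ s'.pts, p ∈ s.pts ∨ I.sink.dist p ≤ I.sink.dist g + b * I.Rt
  count : ∀ a : ℕ, I.sink.dist g ≤ a * (n + 1) * I.Rt → b ≤ (a + 1) * (n + 1)

theorem runs_deployEdge {I : Network m n} (hRs : 0 ≤ I.Rs) (hRt : 0 < I.Rt) {node : ℕ → Node m}
    {j : ℕ} (hz : (node j).Fits I) {s : Deploy m} {g : Pt} (hg : Covers I g s.covered) :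
    Runs (deployEdge I node s g j) (fun s' t => ∃ z b, Deployed I s g j s' z b ∧
      t ≤ 80 * (m + 1) * (b + 1)) := by
  have hn : 0 ≤ (n : ℝ) * I.Rt := by positivity
  have key : ∀ (u : Trail m) (b T : ℕ), Walked I (node j).pos ((node j).radius I)
      ⟨g, s.pts, s.covered⟩ u b → T ≤ 70 * (m + 1) * (b + 1) →
      ∃ z b', Deployed I s g j
        ⟨Function.update s.rep j (some u.cur), s.rest, u.pts, u.covered⟩ z b' ∧
      1 + (T + (1 + 0)) ≤ 80 * (m + 1) * (b' + 1) := by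
    intro u b T hw hT
    refine ⟨u.cur, b, ⟨rfl, rfl, hw.length, hw.covers, hw.mono, hw.dist_cur _, ?_, hw.dist_pts _,
      fun a ha => hw.count_le hRt hz ha⟩, by nlinarith⟩
    have := hw.dist_far I.sink (n * I.Rt) hn hz.dist_le
    simp only at this
    linarith
  simp only [deployEdge, runs_bind, runs_rd]
  cases hzj : node j with
  | sink p =>
    simp only [runs_pure, runs_bind, runs_wr]
    refine ⟨g, 0, ⟨rfl, rfl, rfl, hg, fun _ => id, by simp, ?_, fun p hp => Or.inl hp,
      by simp⟩, by omega⟩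
    nlinarith
  | ref r =>
    rw [hzj] at key
    simp only [runs_bind]
    refine (runs_walkToRef hRs hRt (hz.good r hzj) (s₀ := ⟨g, s.pts, s.covered⟩) hg).mono ?_
    rintro u T ⟨b, hw, hT⟩
    simp only [runs_wr, runs_pure]
    exact key u b T hw hT
  | fermat f =>
    rw [hzj] at key
    simp only [runs_bind]
    refine (runs_walkToFermat hRs hRt f (s₀ := ⟨g, s.pts, s.covered⟩) hg).mono ?_
    rintro u T ⟨b, hw, hT⟩
    simp only [runs_wr, runs_pure]
    exact key u b T hw hT

/-- The invariant of the deployment along the `N` edges in `E`, of which those in `pending` and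
`k` further ones are left. -/
structure DeployInv (I : Network m n) (E : List (ℕ × ℕ)) (pending : List (ℕ × ℕ)) (k : ℕ)
    (s : Deploy m) : Prop where
  le : k ≤ E.length
  root : s.rep 0 ≠ none
  sub : pending ⊆ E
  done : ∀ e ∈ E, e ∈ pending ∨ (s.rep e.1 ≠ none ∧ s.rep e.2 ≠ none)
  covers : ∀ u z, s.rep u = some z → Covers I z s.covered
  dist_rep : ∀ u z, s.rep u = some z → I.sink.dist z ≤ s.pts.length * I.Rt
  dist_far : ∀ u z, s.rep u = some z → I.sink.dist z ≤ ((E.length - k : ℕ) : ℝ) * (n + 1) * I.Rt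
  dist_pts : ∀ p ∈ s.pts, I.sink.dist p ≤ s.pts.length * I.Rt
  length : s.pts.length ≤ (E.length - k) * E.length * (n + 1)

/-- After `a` edges every representing point is within `a * (n + 1) * Rt` of the sink, so the next
edge generates at most `(a + 1) * (n + 1)` points, where `a + 1` is at most the number of edges. -/
theorem Deployed.inv {I : Network m n} (hRt : 0 < I.Rt) {E pending pending' : List (ℕ × ℕ)}
    {e : ℕ × ℕ} {k i j b : ℕ} {s s' : Deploy m} {g z : Pt} (hs : DeployInv I E pending (k + 1) s)
    (hp : ∀ x, x ∈ pending ↔ x = e ∨ x ∈ pending') (hg : s.rep i = some g)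
    (he : e = (i, j) ∨ e = (j, i)) (h : Deployed I s g j s' z b) :
    DeployInv I E pending' k s' := by
  have hk := hs.le
  have hkn : E.length - k = E.length - (k + 1) + 1 := by omega
  have hne : ∀ u, s.rep u ≠ none → s'.rep u ≠ none := by
    intro u hu
    rw [h.rep]
    by_cases huj : u = j
    · subst huj; simp
    · rwa [Function.update_of_ne huj]
  have hj : s'.rep j ≠ none := by rw [h.rep]; simp
  have hi : s'.rep i ≠ none := hne i (by rw [hg]; simp)
  have hrep : ∀ u z', s'.rep u = some z' → s.rep u = some z' ∨ z' = z := by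
    intro u z' hu
    rw [h.rep] at hu
    by_cases huj : u = j
    · subst huj
      rw [Function.update_self] at hu
      exact Or.inr (Option.some.inj hu).symm
    · rw [Function.update_of_ne huj] at hu
      exact Or.inl hu
  have hlen : (s'.pts.length : ℝ) = s.pts.length + b := by
    rw [h.length]; push_cast; rfl
  have hb0 : (0 : ℝ) ≤ b := Nat.cast_nonneg b
  have hg1 := hs.dist_rep i g hg
  have hg2 := hs.dist_far i g hg
  refine ⟨by omega, hne 0 hs.root, fun x hx => hs.sub ((hp x).2 (Or.inr hx)),
    ?_, ?_, ?_, ?_, ?_, ?_⟩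
  · intro x hx
    rcases hs.done x hx with h1 | ⟨h1, h2⟩
    · rcases (hp x).1 h1 with rfl | h2
      · right
        rcases he with rfl | rfl
        · exact ⟨hi, hj⟩
        · exact ⟨hj, hi⟩
      · exact Or.inl h2
    · exact Or.inr ⟨hne _ h1, hne _ h2⟩
  · intro u z' hu
    rcases hrep u z' hu with h1 | rfl
    · exact fun t ht => h.mono t (hs.covers u z' h1 t ht)
    · exact h.covers
  · intro u z' hu
    rw [hlen]
    rcases hrep u z' hu with h1 | rfl
    · have := hs.dist_rep u z' h1
      nlinarith
    · have := h.dist_rep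
      nlinarith
  · intro u z' hu
    rw [hkn]
    push_cast
    have hn : 0 ≤ ((n : ℝ) + 1) * I.Rt := by positivity
    rcases hrep u z' hu with h1 | rfl
    · have := hs.dist_far u z' h1
      nlinarith
    · have := h.dist_far
      nlinarith
  · intro p hp
    rw [hlen]
    rcases h.dist_pts p hp with h1 | h1
    · have := hs.dist_pts p h1
      nlinarith
    · nlinarith
  · have h1 := h.count _ hg2
    have h2 := hs.length
    rw [h.length]
    have h3 : E.length - (k + 1) + 1 ≤ E.length := by omega
    have h4 := h1.trans (Nat.mul_le_mul_right (n + 1) h3)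
    rw [hkn]
    nlinarith

theorem runs_deployPass {I : Network m n} (hRs : 0 ≤ I.Rs) (hRt : 0 < I.Rt) {node : ℕ → Node m}
    (hnode : ∀ j, (node j).Fits I) {E : List (ℕ × ℕ)}
    (hE : ∀ S : ℕ → Prop, S 0 → (∀ e ∈ E, (S e.1 ↔ S e.2)) → ∀ e ∈ E, S e.1) {s : Deploy m}
    (hs : DeployInv I E s.rest s.rest.length s) (hne : s.rest ≠ []) :
    Runs (deployPass I node s) (fun s' t => DeployInv I E s'.rest s'.rest.length s' ∧
      s'.rest.length < s.rest.length ∧ t + 80 * (m + 1) * s.pts.length ≤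
        90 * (m + 1) * s.rest.length + 80 * (m + 1) * s'.pts.length + 1) := by
  unfold deployPass
  -- Time is charged to the edges that are visited and to the points that are generated. The middle
  -- clause says that either some edge has been used, or all edges visited so far had no represented
  -- end.
  refine runs_forT_acc (fun r s' t =>
    (∃ pending : List (ℕ × ℕ), (∀ x, x ∈ pending ↔ x ∈ r ∨ x ∈ s'.rest) ∧
      DeployInv I E pending (r.length + s'.rest.length) s') ∧
    (r.length + s'.rest.length < s.rest.length ∨
      (s'.rep = s.rep ∧ r.length + s'.rest.length = s.rest.length ∧
        ∀ e ∈ s.rest, e ∈ r ∨ (s.rep e.1 = none ∧ s.rep e.2 = none))) ∧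
    t + 80 * (m + 1) * s.pts.length + 90 * (m + 1) * r.length ≤
        90 * (m + 1) * s.rest.length + 80 * (m + 1) * s'.pts.length) ?_ ?_ _ _
    ⟨⟨s.rest, by simp, by
      obtain ⟨h1, h2, h3, h4, h5, h6, h7, h8, h9⟩ := hs
      exact ⟨h1, h2, h3, h4, h5, h6, h7, h8, h9⟩⟩,
      Or.inr ⟨rfl, by simp, fun e he => Or.inl he⟩, by simp only; omega⟩
  · rintro e r s' t ⟨⟨pending, hp, hinv⟩, hprog, ht⟩
    rw [List.length_cons] at hinv hprog ht
    have hedge : ∀ g i j, s'.rep i = some g → (e = (i, j) ∨ e = (j, i)) →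
        Runs (deployEdge I node s' g j) (fun s'' t' =>
          (∃ pending : List (ℕ × ℕ), (∀ x, x ∈ pending ↔ x ∈ r ∨ x ∈ s''.rest) ∧
            DeployInv I E pending (r.length + s''.rest.length) s'') ∧
          (r.length + s''.rest.length < s.rest.length ∨
            (s''.rep = s.rep ∧ r.length + s''.rest.length = s.rest.length ∧
              ∀ e ∈ s.rest, e ∈ r ∨ (s.rep e.1 = none ∧ s.rep e.2 = none))) ∧
          t + 1 + (1 + (1 + t')) + 80 * (m + 1) * s.pts.length + 90 * (m + 1) * r.length ≤
            90 * (m + 1) * s.rest.length + 80 * (m + 1) * s''.pts.length) := by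
      intro g i j hg he
      refine (runs_deployEdge hRs hRt (hnode j) (hinv.covers i g hg)).mono ?_
      rintro s'' t' ⟨z, b, hd, ht'⟩
      refine ⟨⟨r ++ s''.rest, by simp, ?_⟩, ?_, ?_⟩
      · rw [show r.length + 1 + s'.rest.length = r.length + s''.rest.length + 1 by
          rw [hd.rest]; omega] at hinv
        refine hd.inv hRt hinv (e := e) ?_ hg he
        intro x
        rw [hp x, hd.rest]
        simp [or_assoc]
      · left
        rw [hd.rest]
        rcases hprog with h | ⟨-, h, -⟩ <;> omega
      · rw [hd.length]
        nlinarith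
    simp only [runs_bind, runs_rd]
    cases hgi : s'.rep e.1 with
    | some g =>
      exact hedge g e.1 e.2 hgi (Or.inl rfl)
    | none =>
      cases hgj : s'.rep e.2 with
      | some g =>
        exact hedge g e.2 e.1 hgj (Or.inr rfl)
      | none =>
        simp only [runs_bind, runs_push, runs_pure, List.length_cons]
        refine ⟨⟨pending, ?_, ?_⟩, ?_, by nlinarith⟩
        · intro x
          rw [hp x]
          simp only [List.mem_cons]
          tauto
        · obtain ⟨h1, h2, h3, h4, h5, h6, h7, h8, h9⟩ := hinv
          rw [show r.length + (s'.rest.length + 1) = r.length + 1 + s'.rest.length by omega]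
          exact ⟨h1, h2, h3, h4, h5, h6, h7, h8, h9⟩
        · rcases hprog with h | ⟨h1, h2, h3⟩
          · left; omega
          · refine Or.inr ⟨h1, by omega, ?_⟩
            intro x hx
            rcases h3 x hx with h | h
            · rcases List.mem_cons.1 h with rfl | h
              · right
                rw [← h1]
                exact ⟨hgi, hgj⟩
              · exact Or.inl h
            · exact Or.inr h
  · rintro s' t ⟨⟨pending, hp, hinv⟩, hprog, ht⟩
    simp only [List.length_nil, zero_add, mul_zero, add_zero, List.not_mem_nil, false_or] at *
    refine ⟨?_, ?_, by omega⟩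
    · obtain ⟨h1, h2, h3, h4, h5, h6, h7, h8, h9⟩ := hinv
      refine ⟨h1, h2, fun x hx => h3 ((hp x).2 hx), ?_, h5, h6, h7, h8, h9⟩
      intro e he
      exact (h4 e he).imp (hp e).1 id
    · rcases hprog with h | ⟨-, -, h⟩
      · exact h
      -- If no edge was used, the represented nodes form a set that contains the root and is closed
      -- under adjacency, so by connectedness an end of a remaining edge is represented.
      · exfalso
        obtain ⟨e, he⟩ := List.exists_mem_of_ne_nil _ hne
        refine hE (fun u => s.rep u ≠ none) hs.root ?_ e (hs.sub he) (h e he).1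
        intro x hx
        rcases hs.done x hx with h1 | h1
        · simp [h x h1]
        · simp [h1.1, h1.2]

/-- Each pass uses at least one edge, so there are at most as many passes as edges. The cost of
generating points is kept as a separate term, because only in the last regeneration may their number
exceed `n`. -/
theorem runs_deploy {I : Network m n} (hRs : 0 ≤ I.Rs) (hRt : 0 < I.Rt) {node : ℕ → Node m}
    (hnode : ∀ j, (node j).Fits I) {E : List (ℕ × ℕ)}
    (hE : ∀ S : ℕ → Prop, S 0 → (∀ e ∈ E, (S e.1 ↔ S e.2)) → ∀ e ∈ E, S e.1)
    {s₀ : Deploy m} (hs₀ : DeployInv I E E E.length s₀) (hrest : s₀.rest = E) :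
    Runs (whileT (fun s : Deploy m => step (!s.rest.isEmpty)) (deployPass I node) s₀)
      (fun s t => (∀ p ∈ s.pts, I.sink.dist p ≤ s.pts.length * I.Rt) ∧
        s.pts.length ≤ E.length * E.length * (n + 1) ∧
        t ≤ 100 * (m + 1) * (E.length + 1) ^ 2 + 80 * (m + 1) * s.pts.length) := by
  have hlen : ∀ {s : Deploy m}, DeployInv I E s.rest s.rest.length s →
      s.pts.length ≤ E.length * E.length * (n + 1) := by
    intro s hs
    refine hs.length.trans (Nat.mul_le_mul_right _ (Nat.mul_le_mul_right _ (Nat.sub_le _ _)))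
  refine runs_whileT (fun s t => DeployInv I E s.rest s.rest.length s ∧
    t + 100 * (m + 1) * (E.length + 1) * s.rest.length ≤
      100 * (m + 1) * (E.length + 1) * E.length + 80 * (m + 1) * s.pts.length)
    (100 * (m + 1) * (E.length + 1) * E.length + 80 * (m + 1) * (E.length * E.length * (n + 1)))
    ?_ ?_ ⟨by rw [hrest]; exact hs₀, by rw [hrest]; omega⟩
  · rintro s t ⟨hs, ht⟩
    have := Nat.mul_le_mul_left (80 * (m + 1)) (hlen hs)
    omega
  · rintro s t ⟨hs, ht⟩
    simp only [runs_step]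
    refine ⟨fun h => ?_, fun h => ?_⟩
    · have hne : s.rest ≠ [] := by
        rintro he
        simp [he] at h
      refine (runs_deployPass hRs hRt hnode hE hs hne).mono ?_
      rintro s' t' ⟨h1, h2, h3⟩
      refine ⟨h1, ?_⟩
      have h4 := hs.le
      have h5 : 100 * (m + 1) * (E.length + 1) * (s'.rest.length + 1) ≤
        100 * (m + 1) * (E.length + 1) * s.rest.length := Nat.mul_le_mul_left _ h2
      have h6 : (m + 1) * s.rest.length ≤ (m + 1) * E.length := Nat.mul_le_mul_left _ h4
      nlinarith
    · refine ⟨hs.dist_pts, hlen hs, ?_⟩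
      have h1 : 100 * (m + 1) * (E.length + 1) ^ 2 =
        100 * (m + 1) * (E.length + 1) * E.length + 100 * (m + 1) * (E.length + 1) := by ring
      have h2 : 1 ≤ (m + 1) * (E.length + 1) := Nat.mul_pos (by omega) (by omega)
      have h3 : 0 ≤ 100 * (m + 1) * (E.length + 1) * s.rest.length := Nat.zero_le _
      rw [h1]
      linarith

/-! ### Regeneration of the potential points -/

theorem regenerate_time {M k y V e N L t₁ t₂ t₃ t₄ t₅ t₆ t₇ t₈ t₉ t₁₀ t₁₁ t₁₂ t₁₃ t₁₄ t : ℕ}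
    (hM : 1 ≤ M) (hk : k ≤ M) (hy : y + 1 ≤ M) (he : e ≤ 2 * M) (hV : V ≤ 65 * M)
    (hN : N ≤ M)
    (h₂ : t₂ ≤ 20 * (N + 1) ^ 2) (h₃ : t₃ ≤ 500 * (k + 1) ^ 3)
    (h₁ : t₁ ≤ 1000 * M) (h₄ : t₄ ≤ 1000 * M) (h₅ : t₅ ≤ 1000 * M) (h₆ : t₆ ≤ 1000 * M)
    (h₇ : t₇ ≤ 1000 * M) (h₈ : t₈ ≤ 1000 * M) (h₁₀ : t₉ + t₁₀ ≤ 1000 * M)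
    (h₁₁ : t₁₁ ≤ 200 * (y + 1 + 1) * (V + 1) * (V + (y + 1 + 1) ^ 2)) (h₁₂ : t₁₂ ≤ 1000 * M)
    (h₁₃ : t₁₃ ≤ 1000 * M) (h₁₄ : t₁₄ ≤ 100 * M * (e + 1) ^ 2 + 80 * M * L)
    (ht : t ≤ t₁ + t₂ + t₃ + t₄ + t₅ + t₆ + t₇ + t₈ + t₉ + t₁₀ + t₁₁ + t₁₂ + t₁₃ + t₁₄ + 10) :
    t ≤ 2000000 * M ^ 4 + 80 * M * L := by
  have e2 : t₂ ≤ 80 * M ^ 2 := by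
    have : (N + 1) ^ 2 ≤ (2 * M) ^ 2 := Nat.pow_le_pow_left (by omega) 2
    rw [mul_pow] at this
    omega
  have e3 : t₃ ≤ 4000 * M ^ 3 := by
    have : (k + 1) ^ 3 ≤ (2 * M) ^ 3 := Nat.pow_le_pow_left (by omega) 3
    rw [mul_pow] at this
    omega
  -- The dominant term, from the Klein–Ravi algorithm; that it is only of fourth order depends on `V
  -- = O(M)`.
  have e11 : t₁₁ ≤ 1900000 * M ^ 4 := by
    have k1 : y + 1 + 1 ≤ 2 * M := by omega
    have k2 : V + 1 ≤ 66 * M := by omega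
    have k0 : M ≤ M ^ 2 := Nat.le_self_pow (by norm_num) M
    have k3 : V + (y + 1 + 1) ^ 2 ≤ 69 * M ^ 2 := by
      have : (y + 1 + 1) ^ 2 ≤ (2 * M) ^ 2 := Nat.pow_le_pow_left k1 2
      rw [mul_pow] at this
      omega
    have k4 := Nat.mul_le_mul (Nat.mul_le_mul (Nat.mul_le_mul_left 200 k1) k2) k3
    have k5 : 200 * (2 * M) * (66 * M) * (69 * M ^ 2) = 1821600 * M ^ 4 := by ring
    have k6 : 1821600 * M ^ 4 ≤ 1900000 * M ^ 4 := Nat.mul_le_mul_right _ (by norm_num)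
    exact h₁₁.trans (k4.trans (k5.trans_le k6))
  have e14 : 100 * M * (e + 1) ^ 2 ≤ 900 * M ^ 3 := by
    have : (e + 1) ^ 2 ≤ (3 * M) ^ 2 := Nat.pow_le_pow_left (by omega) 2
    calc 100 * M * (e + 1) ^ 2 ≤ 100 * M * (3 * M) ^ 2 := Nat.mul_le_mul_left _ this
      _ = 900 * M ^ 3 := by ring
  have p1 : M ≤ M ^ 4 := Nat.le_self_pow (by norm_num) M
  have p2 : M ^ 2 ≤ M ^ 4 := Nat.pow_le_pow_right hM (by norm_num)
  have p3 : M ^ 3 ≤ M ^ 4 := Nat.pow_le_pow_right hM (by norm_num)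
  linarith

set_option maxHeartbeats 1000000 in
theorem runs_regenerate {I : Network m n} (hRs : 0 ≤ I.Rs) (hRt : 0 < I.Rt) {Y : List (Ref m)}
    (hY : Y.length ≤ m) (hgood : ∀ r ∈ Y, r.Good I)
    (hdist : ∀ r ∈ Y, I.sink.dist r.pos ≤ r.radius I + n * I.Rt) :
    Runs (regenerate I Y) (fun L t => (∀ p ∈ L, I.sink.dist p ≤ L.length * I.Rt) ∧
      L.length ≤ 4 * (m + 1) ^ 2 * (n + 1) ∧
      t ≤ 2000000 * (m + 1) ^ 4 + 80 * (m + 1) * L.length) := by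
  have hn : 0 ≤ (n : ℝ) * I.Rt := by positivity
  -- One ball around the sink for all sites. It also contains the Fermat points, whose stopping
  -- radius is `Rs`.
  have hball : ∀ r ∈ Y, I.sink.dist r.pos ≤ I.Rs + n * I.Rt := by
    intro r hr
    refine (hdist r hr).trans ?_
    unfold Ref.radius
    split <;> linarith
  simp only [regenerate, runs_bind]
  refine runs_forT 1 (fun r (acc : List Pt) => r ⊆ Y ∧ acc.length + r.length = Y.length + 1 ∧
    ∀ p ∈ acc, I.sink.dist p ≤ I.Rs + n * I.Rt) ?_
    ⟨List.Subset.refl _, by simp; omega, by simp [Pt.dist_self]; linarith⟩ ?_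
  · rintro r l acc ⟨h1, h2, h3⟩
    simp only [runs_push]
    rw [List.length_cons] at h2
    refine ⟨⟨fun x hx => h1 (List.mem_cons_of_mem _ hx), by rw [List.length_cons]; omega, ?_⟩,
      le_rfl⟩
    intro p hp
    rcases List.mem_cons.1 hp with rfl | hp
    · exact hball r (h1 List.mem_cons_self)
    · exact h3 p hp
  rintro posY t₁ ⟨-, hposY, hposYball⟩ ht₁
  rw [List.length_nil, add_zero] at hposY
  refine (runs_distinctPts posY).mono ?_
  rintro sites t₂ ⟨hnd, hsub, hslen, ht₂⟩
  have hs : sites.length ≤ m + 1 := by omega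
  refine (runs_fermatPoints hnd (fun p hp => hposYball p (hsub hp))).mono ?_
  rintro F t₃ ⟨hFlen, hFball, ht₃⟩
  refine runs_forT 1 (fun r (acc : List (Node m)) => r ⊆ F ∧ acc.length + r.length = F.length ∧
    ∀ z ∈ acc, z.Fits I) ?_ ⟨List.Subset.refl _, by simp, by simp⟩ ?_
  · rintro f l acc ⟨h1, h2, h3⟩
    simp only [runs_push]
    rw [List.length_cons] at h2
    refine ⟨⟨fun x hx => h1 (List.mem_cons_of_mem _ hx), by rw [List.length_cons]; omega, ?_⟩,
      le_rfl⟩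
    intro z hz
    rcases List.mem_cons.1 hz with rfl | hz
    · exact ⟨hFball f (h1 List.mem_cons_self), by simp⟩
    · exact h3 z hz
  rintro nodes₁ t₄ ⟨-, hn₁, hfit₁⟩ ht₄
  rw [List.length_nil, add_zero] at hn₁
  refine runs_forT 1 (fun r (acc : List (Node m)) => r ⊆ Y ∧
    acc.length + r.length = F.length + Y.length ∧
    ∀ z ∈ acc, z.Fits I) ?_ ⟨List.Subset.refl _, by omega, hfit₁⟩ ?_
  · rintro r l acc ⟨h1, h2, h3⟩
    simp only [runs_push]
    rw [List.length_cons] at h2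
    refine ⟨⟨fun x hx => h1 (List.mem_cons_of_mem _ hx), by rw [List.length_cons]; omega, ?_⟩,
      le_rfl⟩
    intro z hz
    rcases List.mem_cons.1 hz with rfl | hz
    · refine ⟨hdist r (h1 List.mem_cons_self), ?_⟩
      rintro _ ⟨⟩
      exact hgood r (h1 List.mem_cons_self)
    · exact h3 z hz
  rintro nodes₂ t₅ ⟨-, hn₂, hfit₂⟩ ht₅
  rw [List.length_nil, add_zero] at hn₂
  simp only [runs_push]
  have hsink : (Node.sink I.sink : Node m).Fits I := by
    refine ⟨?_, by simp⟩
    simp only [Node.pos, Node.radius, Pt.dist_self]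
    linarith
  refine runs_lenT fun t₆ ht₆ => runs_lenT fun t₇ ht₇ => runs_toArr fun t₈ ht₈ =>
    runs_alloc fun t₉ ht₉ => ?_
  simp only [List.length_cons, hn₂] at ht₆ ht₈ ht₉ ⊢
  set V := F.length + Y.length + 1 with hV
  clear_value V
  refine runs_forT 2 (fun _ _ => True) ?_ trivial ?_
  · intro i l s _
    simp only [runs_bind, runs_rd, runs_wr]
    norm_num
  rintro pos t₁₀ - ht₁₀
  rw [List.length_range] at ht₁₀
  refine (runs_kleinRavi pos (by omega : 0 < Y.length + 1) (by omega : Y.length + 1 ≤ V)).mono ?_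
  rintro E t₁₁ ⟨hElen, hE, ht₁₁⟩
  refine runs_alloc fun t₁₂ ht₁₂ => ?_
  simp only [runs_wr]
  refine (runs_coverage I [I.sink]).mono ?_
  rintro c t₁₃ ⟨ht₁₃, hc⟩
  -- Outside the list of nodes the array holds the sink, which also fits; so no bound on the numbers
  -- of the end nodes of the edges is needed.
  refine (runs_deploy hRs hRt (node := fun i => (Node.sink I.sink :: nodes₂).getD i
    (Node.sink I.sink)) ?_ hE ?_ rfl).mono ?_
  · intro j
    by_cases hj : j < (Node.sink I.sink :: nodes₂).length
    · rw [List.getD_eq_getElem _ _ hj]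
      have := List.getElem_mem hj
      rcases List.mem_cons.1 this with h | h
      · rw [h]; exact hsink
      · exact hfit₂ _ h
    · rw [List.getD_eq_default _ _ (by omega)]
      exact hsink
  · have hrep : ∀ u z, Function.update (fun _ => none : ℕ → Option Pt) 0 (some I.sink) u = some z →
        z = I.sink := by
      intro u z hu
      by_cases h0 : u = 0
      · subst h0
        simpa using hu.symm
      · simp [Function.update_of_ne h0] at hu
    refine ⟨le_rfl, by simp, List.Subset.refl _, fun e he => Or.inl he, ?_, ?_, ?_,
      by simp, by simp⟩
    · intro u z hu
      rw [hrep u z hu]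
      exact hc _ (by simp)
    · intro u z hu
      rw [hrep u z hu, Pt.dist_self]
      simp
    · intro u z hu
      rw [hrep u z hu, Pt.dist_self]
      simp
  · rintro s t₁₄ ⟨h1, h2, h3⟩
    simp only [runs_pure]
    have hE2 : E.length ≤ 2 * (m + 1) := by omega
    refine ⟨h1, h2.trans ?_, ?_⟩
    · have := Nat.mul_le_mul hE2 hE2
      exact (Nat.mul_le_mul_right (n + 1) this).trans (by nlinarith)
    · have hV1 : V ≤ 65 * (m + 1) := by omega
      have ht₁₃' : t₁₃ ≤ 1000 * (m + 1) := ht₁₃.trans (by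
        rw [List.length_singleton]; omega)
      refine regenerate_time (M := m + 1) (k := sites.length) (y := Y.length) (V := V)
        (e := E.length) (N := posY.length) (L := s.pts.length) (t₁ := t₁) (t₂ := t₂) (t₃ := t₃)
        (t₄ := t₄) (t₅ := t₅) (t₆ := t₆) (t₇ := t₇) (t₈ := t₈) (t₉ := t₉) (t₁₀ := t₁₀)
        (t₁₁ := t₁₁) (t₁₂ := t₁₂) (t₁₃ := t₁₃) (t₁₄ := t₁₄)
        (Nat.le_add_left 1 m) hs (Nat.succ_le_succ hY) hE2 hV1 ?_ ht₂ ht₃ ?_ ?_ ?_ ?_ ?_ ?_ ?_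
        ht₁₁ ?_ ht₁₃' h3 ?_
      all_goals clear h1 h2 h3 ht₁₃ ht₂ ht₃ ht₁₁ hball hfit₁ hfit₂ hE
      all_goals linarith

/-! ### The selection of reference points -/

theorem runs_phi (I : Network m n) (p : Ref m) (eta : ℝ) :
    Runs (phi I p eta) (fun k t => k = ⌈(eta - p.radius I) / I.Rt⌉₊ ∧ t ≤ 3) := by
  unfold phi Ref.radius
  cases p.inter <;> simp

theorem runs_rho (I : Network m n) (c : Fin m → Bool) (p : Ref m) (k : ℕ) :
    Runs (rho I c p k) (fun _ t => t ≤ 4 * p.cov.length + 4) := by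
  simp only [rho, runs_bind, runs_step, runs_ite, runs_pure]
  refine ⟨fun _ => by omega, fun _ => ?_⟩
  refine runs_forT 3 (fun _ _ => True) ?_ trivial ?_
  · rintro i l w -
    simp only [runs_bind, runs_rd, runs_ite, runs_pure, runs_add, runs_mk_zero]
    norm_num
  · rintro w t - ht
    simp only [runs_div, runs_mk_zero, runs_ofNatT]
    omega

theorem Cand.runs_better (a b : Cand m) : Runs (a.better b) (fun _ t => t ≤ 3) := by
  unfold Cand.better
  cases a.rho <;> cases b.rho <;> simp

/-- A candidate that may be selected. -/
structure Cand.Eligible (I : Network m n) (X : List (Ref m)) (s : State m) (a : Cand m) :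
    Prop where
  mem : a.ref ∈ X
  src : a.src ∈ I.sink :: s.L
  count : ⌈(a.src.dist a.ref.pos - a.ref.radius I) / I.Rt⌉₊ ≤ n - s.L.length
  unmarked : ∃ i ∈ a.ref.cov, s.chosen i = false

theorem runs_select {I : Network m n} {X : List (Ref m)} (hX : X.length ≤ 2 * (m + 1) ^ 2)
    (hgood : ∀ r ∈ X, r.Good I) {s : State m} (hL : s.L.length ≤ n) :
    Runs (select I X s) (fun o t => (∀ a, o = some a → a.Eligible I X s) ∧
      t ≤ 110 * (m + 1) ^ 3 + 50 * (m + 1) ^ 2 * (n + 1)) := by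
  simp only [select, runs_bind]
  refine runs_lenT fun t₁ ht₁ => ?_
  refine (runs_coverage I s.L).mono ?_
  rintro c t₂ ⟨ht₂, -⟩
  refine runs_forT_mem (40 * (m + 1) + 8 * n) (fun o => ∀ a, o = some a → a.Eligible I X s) ?_
    (by simp) ?_
  · intro p best hp hbest
    have hlen := (hgood p hp).length_le
    simp only [runs_bind]
    refine (runs_allMarked s.chosen p.cov).mono ?_
    rintro old t₃ ⟨ht₃, hold⟩
    refine (runs_nearest I.sink s.L p.pos).mono ?_
    rintro ⟨src, eta⟩ t₄ ⟨ht₄, hsrc, heta⟩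
    refine (runs_phi I p eta).mono ?_
    rintro k t₅ ⟨hk, ht₅⟩
    simp only [runs_step, runs_ite, runs_pure, runs_bind]
    refine ⟨fun h => ?_, fun _ => ⟨hbest, by omega⟩⟩
    simp only [Bool.and_eq_true, Bool.not_eq_true', decide_eq_true_eq] at h
    refine (runs_rho I c p k).mono ?_
    intro r t₆ ht₆
    have hnew : Cand.Eligible I X s ⟨p, r, eta, src⟩ := by
      refine ⟨hp, hsrc, ?_, hold h.1⟩
      simp only at heta ⊢
      rw [← heta, ← hk]
      exact h.2
    cases best with
    | none =>
      simp only [runs_pure]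
      refine ⟨?_, by omega⟩
      rintro a ⟨⟩
      exact hnew
    | some b =>
      simp only [runs_bind]
      refine (Cand.runs_better _ b).mono ?_
      intro bt t₇ ht₇
      simp only [runs_pure]
      refine ⟨?_, by omega⟩
      intro a ha
      cases bt
      · exact hbest a ha
      · obtain rfl : _ = a := Option.some.inj ha
        exact hnew
  · intro o t ho ht
    refine ⟨ho, ?_⟩
    have h1 : t ≤ 2 * (m + 1) ^ 2 * (41 * (m + 1) + 8 * n) + 1 := by
      refine ht.trans (Nat.succ_le_succ (Nat.mul_le_mul hX (by omega)))
    have h2 : t₂ ≤ 20 * (m + 1) * (n + 1) :=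
      ht₂.trans (Nat.mul_le_mul_left _ (by omega))
    have h3 : (m + 1) * (n + 1) ≤ (m + 1) ^ 2 * (n + 1) :=
      Nat.mul_le_mul_right _ (Nat.le_self_pow (by norm_num) _)
    have h4 : n + 1 ≤ (m + 1) * (n + 1) := Nat.le_mul_of_pos_left _ (by omega)
    have h5 : 2 * (m + 1) ^ 2 * (41 * (m + 1) + 8 * n) ≤
      82 * (m + 1) ^ 3 + 16 * ((m + 1) ^ 2 * (n + 1)) := by
      have : 2 * (m + 1) ^ 2 * (41 * (m + 1) + 8 * n) + 16 * (m + 1) ^ 2 =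
        82 * (m + 1) ^ 3 + 16 * ((m + 1) ^ 2 * (n + 1)) := by ring
      omega
    linarith

/-! ### The inner loop -/

/-- The number of targets that are marked. -/
def marked (c : Fin m → Bool) : ℕ := (Finset.univ.filter fun i => c i = true).card

theorem marked_le (c : Fin m → Bool) : marked c ≤ m :=
  (Finset.card_le_univ _).trans (by simp)

theorem marked_lt {c c' : Fin m → Bool} (h : ∀ i, c i = true → c' i = true) {i : Fin m}
    (hi : c i = false) (hi' : c' i = true) : marked c < marked c' := by
  refine Finset.card_lt_card ((Finset.ssubset_iff_of_subset fun j hj => ?_).2 ⟨i, ?_, ?_⟩)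
  · simpa using h j (by simpa using hj)
  · simpa using hi'
  · simp [hi]

/-- The invariant of both loops. -/
structure State.Valid (I : Network m n) (s : State m) : Prop where
  length : s.L.length ≤ n
  dist_pts : ∀ p ∈ s.L, I.sink.dist p ≤ s.L.length * I.Rt
  good : ∀ r ∈ s.Y, r.Good I
  dist_refs : ∀ r ∈ s.Y, I.sink.dist r.pos ≤ r.radius I + n * I.Rt
  refs : s.Y.length ≤ marked s.chosen

theorem runs_mark (ts : List (Fin m)) (c : Fin m → Bool) :
    Runs (forT ts c (fun c i => wr c i true)) (fun c' t => (∀ i, c i = true → c' i = true) ∧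
      (∀ i ∈ ts, c' i = true) ∧ t ≤ 2 * ts.length + 1) := by
  refine runs_forT 1 (fun l (c' : Fin m → Bool) => (∀ i, c i = true → c' i = true) ∧
    ∀ i ∈ ts, i ∉ l → c' i = true) ?_ ⟨fun _ => id, fun i h h' => absurd h h'⟩ ?_
  · rintro i l c' ⟨h1, h2⟩
    simp only [runs_wr]
    refine ⟨⟨fun j hj => ?_, fun j hj hjl => ?_⟩, le_rfl⟩
    · by_cases hji : j = i
      · subst hji; simp
      · rw [Function.update_of_ne hji]; exact h1 j hj
    · by_cases hji : j = i
      · subst hji; simp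
      · rw [Function.update_of_ne hji]
        exact h2 j hj (by simp [hji, hjl])
  · rintro c' t ⟨h1, h2⟩ ht
    exact ⟨h1, fun i hi => h2 i hi (by simp), by omega⟩

/-- The selected point needs at most `n - |L|` more points, so `|L| ≤ n` is preserved. As its source
is within `|L| * Rt` of the sink, the point itself is within `n * Rt` plus its radius. It stands for
a target that becomes marked only now. -/
theorem runs_innerBody {I : Network m n} (hRs : 0 ≤ I.Rs) (hRt : 0 < I.Rt) {X : List (Ref m)}
    (hX : X.length ≤ 2 * (m + 1) ^ 2) (hgood : ∀ r ∈ X, r.Good I) {s : State m}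
    (hs : s.Valid I) :
    Runs (innerBody I X s) (fun s' t => s'.Valid I ∧
      ((s' = { s with go := false }) ∨ (s'.go = true ∧ marked s.chosen < marked s'.chosen)) ∧
      t ≤ 120 * (m + 1) ^ 3 + 170 * (m + 1) ^ 2 * (n + 1)) := by
  simp only [innerBody, runs_bind]
  refine (runs_select hX hgood hs.length).mono ?_
  rintro o t₁ ⟨ho, ht₁⟩
  cases o with
  | none =>
    simp only [runs_pure]
    obtain ⟨h1, h2, h3, h4, h5⟩ := hs
    refine ⟨⟨h1, h2, h3, h4, h5⟩, Or.inl trivial, ?_⟩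
    have : 0 ≤ (m + 1) ^ 2 * (n + 1) := Nat.zero_le _
    linarith [Nat.zero_le ((m + 1) ^ 3)]
  | some a =>
    obtain ⟨hmem, hsrc, hcount, i, hi, hun⟩ := ho a rfl
    have hr := hgood _ hmem
    simp only [runs_bind]
    refine (runs_coverage I (I.sink :: s.L)).mono ?_
    rintro c t₂ ⟨ht₂, hc⟩
    refine (runs_walkToRef hRs hRt hr (s₀ := ⟨a.src, [], c⟩) (hc _ hsrc)).mono ?_
    rintro u t₃ ⟨j, hw, ht₃⟩
    refine runs_pushAll fun t₄ ht₄ => ?_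
    simp only [runs_push]
    refine (runs_mark a.ref.cov s.chosen).mono ?_
    rintro ch t₅ ⟨hmono, hcov, ht₅⟩
    simp only [runs_pure]
    have hj : j ≤ n - s.L.length := hw.count.trans hcount
    have hlen : u.pts.length = j := by simpa using hw.length
    have hlt : marked s.chosen < marked ch := marked_lt hmono hun (hcov i hi)
    have hsrcd : I.sink.dist a.src ≤ s.L.length * I.Rt := by
      rcases List.mem_cons.1 hsrc with h | h
      · rw [h, Pt.dist_self]; positivity
      · exact hs.dist_pts _ h
    have hLj : s.L.length + j ≤ n := by have := hs.length; omega
    refine ⟨⟨?_, ?_, ?_, ?_, ?_⟩, Or.inr ⟨trivial, hlt⟩, ?_⟩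
    · simp only [List.length_append, List.length_reverse]
      omega
    · intro p hp
      simp only [List.length_append, List.length_reverse, hlen]
      push_cast
      rcases List.mem_append.1 hp with h | h
      · rcases hw.dist_pts I.sink p (List.mem_reverse.1 h) with h | h
        · simp at h
        · simp only at h
          linarith
      · have := hs.dist_pts p h
        have : 0 ≤ (j : ℝ) * I.Rt := by positivity
        linarith
    · intro r hrm
      rcases List.mem_cons.1 hrm with rfl | h
      · exact hr
      · exact hs.good r h
    · intro r hrm
      rcases List.mem_cons.1 hrm with rfl | h
      · have h1 := Nat.ceil_le.1 hcount
        rw [div_le_iff₀ hRt, Nat.cast_sub hs.length] at h1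
        have := Pt.dist_triangle I.sink a.src a.ref.pos
        linarith
      · exact hs.dist_refs r h
    · simp only [List.length_cons]
      have := hs.refs
      omega
    · have hm := hr.length_le
      have h2 : t₂ ≤ 20 * (m + 1) * (n + 2) := by
        refine ht₂.trans (Nat.mul_le_mul_left _ ?_)
        rw [List.length_cons]
        have := hs.length
        omega
      have h3 : t₃ ≤ 70 * (m + 1) * (n + 1) := ht₃.trans (Nat.mul_le_mul_left _ (by omega))
      have h4 : t₄ ≤ 2 * (n + 1) := by omega
      have h6 : (m + 1) * (n + 1) ≤ (m + 1) ^ 2 * (n + 1) :=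
        Nat.mul_le_mul_right _ (Nat.le_self_pow (by norm_num) _)
      have h7 : n + 1 ≤ (m + 1) * (n + 1) := Nat.le_mul_of_pos_left _ (by omega)
      have h8 : m + 1 ≤ (m + 1) ^ 3 := Nat.le_self_pow (by norm_num) _
      linarith [Nat.le_mul_of_pos_right (m + 1) (Nat.succ_pos n)]

theorem runs_unfinished (I : Network m n) {s : State m} (hs : s.L.length ≤ n) :
    Runs (unfinished I s) (fun b t => (b = true → s.go = true) ∧
      t ≤ 30 * (m + 1) * (n + 1)) := by
  simp only [unfinished, runs_ite, runs_pure]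
  refine ⟨fun h => ?_, fun h => ⟨by simp, by omega⟩⟩
  refine (runs_someUncovered I s.L).mono fun b t ht => ⟨fun _ => h, ht.trans ?_⟩
  exact Nat.mul_le_mul_left _ (by omega)

/-- A bound on the time of an iteration of the inner loop. -/
def innerTime (m n : ℕ) : ℕ := 130 * (m + 1) ^ 3 + 220 * (m + 1) ^ 2 * (n + 1)

/-- Every selection is paid for by a newly marked target. The additional `2` covers an iteration
that finds nothing to select and the last evaluation of the condition. -/
theorem runs_inner {I : Network m n} (hRs : 0 ≤ I.Rs) (hRt : 0 < I.Rt) {X : List (Ref m)}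
    (hX : X.length ≤ 2 * (m + 1) ^ 2) (hgood : ∀ r ∈ X, r.Good I) {s : State m}
    (hs : s.Valid I) :
    Runs (whileT (unfinished I) (innerBody I X) s) (fun s' t => s'.Valid I ∧
      ((s'.L = s.L ∧ s'.Y = s.Y ∧ s'.chosen = s.chosen) ∨ marked s.chosen < marked s'.chosen) ∧
      t + innerTime m n * marked s.chosen ≤ innerTime m n * (marked s'.chosen + 2)) := by
  have hK : 120 * (m + 1) ^ 3 + 170 * (m + 1) ^ 2 * (n + 1) + 30 * (m + 1) * (n + 1) + 1 ≤
      innerTime m n := by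
    have h6 : (m + 1) * (n + 1) ≤ (m + 1) ^ 2 * (n + 1) :=
      Nat.mul_le_mul_right _ (Nat.le_self_pow (by norm_num) _)
    have h8 : 1 ≤ (m + 1) ^ 3 := Nat.one_le_pow _ _ (by omega)
    unfold innerTime
    linarith [Nat.zero_le ((m + 1) ^ 2 * (n + 1))]
  have hK' : 30 * (m + 1) * (n + 1) + 1 ≤ innerTime m n := le_trans (by omega) hK
  generalize innerTime m n = K at *
  refine runs_whileT (fun s' t => s'.Valid I ∧
    ((s'.L = s.L ∧ s'.Y = s.Y ∧ s'.chosen = s.chosen) ∨ marked s.chosen < marked s'.chosen) ∧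
    t + K * marked s.chosen ≤ K * (marked s'.chosen + if s'.go then 0 else 1))
    (K * (m + 1)) ?_ ?_ ⟨hs, Or.inl ⟨rfl, rfl, rfl⟩, ?_⟩
  · rintro s' t ⟨-, -, ht⟩
    refine (Nat.le_add_right _ _).trans (ht.trans (Nat.mul_le_mul_left _ ?_))
    have := marked_le s'.chosen
    split <;> omega
  · rintro s' t ⟨hv, hch, ht⟩
    refine (runs_unfinished I hv.length).mono ?_
    rintro b t₁ ⟨hgo, ht₁⟩
    refine ⟨fun hb => ?_, fun _ => ⟨hv, hch, ?_⟩⟩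
    · rw [hgo hb] at ht
      refine (runs_innerBody hRs hRt hX hgood hv).mono ?_
      rintro s'' t₂ ⟨hv', hor, ht₂⟩
      simp only [if_true, add_zero] at ht
      rcases hor with rfl | ⟨hgo', hlt⟩
      · refine ⟨hv', hch, ?_⟩
        simp only [Bool.false_eq_true, if_false]
        rw [Nat.mul_succ]
        omega
      · refine ⟨hv', Or.inr ?_, ?_⟩
        · rcases hch with ⟨-, -, h⟩ | h
          · rwa [h] at hlt
          · exact h.trans hlt
        · simp only [hgo', if_true, add_zero]
          have := Nat.mul_le_mul_left K (Nat.succ_le_of_lt hlt)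
          rw [Nat.mul_succ] at this
          omega
    · have : K * (marked s'.chosen + if s'.go then 0 else 1) ≤ K * (marked s'.chosen + 1) :=
        Nat.mul_le_mul_left _ (by split <;> omega)
      rw [Nat.mul_succ] at this
      rw [Nat.mul_add]
      omega
  · exact (Nat.zero_add _).trans_le (Nat.mul_le_mul_left _ (Nat.le_add_right _ _))

/-! ### The main loop and the assignment of the sensors -/

/-- A bound on the time of an iteration of the outer loop, per newly marked target. -/
def outerTime (m n : ℕ) : ℕ :=
  3 * innerTime m n + 2000000 * (m + 1) ^ 4 + 120 * (m + 1) * (n + 1)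

/-- A bound on the additional time of the last iteration of the outer loop. -/
def lastTime (m n : ℕ) : ℕ := outerTime m n + 400 * (m + 1) ^ 3 * (n + 1)

/-- The hypothesis `hreg` says that `L` is no longer than what regeneration from the current `Y`
yields. If the inner loop changes nothing, the same regeneration is repeated and cannot be strictly
shorter; so the loop goes on only if a target has been marked. -/
theorem runs_outerBody {I : Network m n} (hRs : 0 ≤ I.Rs) (hRt : 0 < I.Rt) {X : List (Ref m)}
    (hX : X.length ≤ 2 * (m + 1) ^ 2) (hgood : ∀ r ∈ X, r.Good I) {s : State m}
    (hs : s.Valid I) (hreg : s.L.length ≤ (regenerate I s.Y).val.length) :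
    Runs (outerBody I X s) (fun s' t => s'.Valid I ∧ marked s.chosen ≤ marked s'.chosen ∧
      (s'.go = true → marked s.chosen < marked s'.chosen ∧
        s'.L.length ≤ (regenerate I s'.Y).val.length) ∧
      t + 30 * (m + 1) * (n + 1) + 1 + outerTime m n * marked s.chosen ≤
        outerTime m n * marked s'.chosen + if s'.go then 0 else lastTime m n) := by
  simp only [outerBody, runs_bind]
  refine (runs_inner hRs hRt hX hgood hs).mono ?_
  rintro s₁ t₁ ⟨hv, hch, ht₁⟩
  refine (runs_regenerate hRs hRt (hv.refs.trans (marked_le _)) hv.good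
    hv.dist_refs).and_val.mono ?_
  rintro L' t₂ ⟨⟨hdist, hlen, ht₂⟩, hval⟩
  refine runs_lenT fun t₃ ht₃ => runs_lenT fun t₄ ht₄ => ?_
  simp only [runs_step, runs_ite, runs_pure, decide_eq_true_eq]
  have hle : marked s.chosen ≤ marked s₁.chosen := by
    rcases hch with ⟨-, -, h⟩ | h
    · rw [h]
    · exact h.le
  have hn := hv.length
  have hlt : L'.length < s₁.L.length → marked s.chosen < marked s₁.chosen := by
    intro h
    refine hch.resolve_left ?_
    rintro ⟨h1, h2, -⟩
    rw [hval, h1, h2] at h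
    omega
  have hM : 1 ≤ (m + 1) * (n + 1) := Nat.mul_pos (by omega) (by omega)
  have hMn : n + 1 ≤ (m + 1) * (n + 1) := Nat.le_mul_of_pos_left _ (by omega)
  refine ⟨fun h => ⟨⟨?_, hdist, hv.good, hv.dist_refs, hv.refs⟩, hle, fun _ => ⟨hlt h, ?_⟩, ?_⟩,
    fun h => ⟨⟨hn, hv.dist_pts, hv.good, hv.dist_refs, hv.refs⟩, hle, by simp, ?_⟩⟩
  · simp only; omega
  · rw [hval]
  · simp only [if_true, add_zero]
    obtain ⟨d, hd⟩ := Nat.exists_eq_add_of_lt (hlt h)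
    have h2 : 80 * (m + 1) * L'.length ≤ 80 * (m + 1) * n := Nat.mul_le_mul_left _ (by omega)
    have h3 : outerTime m n ≤ outerTime m n * (d + 1) := Nat.le_mul_of_pos_right _ (by omega)
    -- With `d + 1` newly marked targets the inner loop costs `d + 3` units, at most three per
    -- target.
    have h4 : innerTime m n * (d + 3) ≤ 3 * innerTime m n * (d + 1) := by
      have := Nat.mul_le_mul_left (innerTime m n) (show d + 3 ≤ 3 * (d + 1) by omega)
      linarith
    have h5 : outerTime m n * (d + 1) = 3 * innerTime m n * (d + 1) +
      (2000000 * (m + 1) ^ 4 + 120 * (m + 1) * (n + 1)) * (d + 1) := by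
      unfold outerTime; ring
    have h6 : 2000000 * (m + 1) ^ 4 + 120 * (m + 1) * (n + 1) ≤
      (2000000 * (m + 1) ^ 4 + 120 * (m + 1) * (n + 1)) * (d + 1) :=
      Nat.le_mul_of_pos_right _ (by omega)
    rw [hd] at ht₁ ⊢
    have h7 : t₁ ≤ innerTime m n * (d + 3) := by linarith
    have h8 : t₃ + t₄ + 30 * (m + 1) * (n + 1) + 80 * (m + 1) * n + 2 ≤
        120 * (m + 1) * (n + 1) := by
      have : t₃ + t₄ + 2 ≤ 2 * (n + 1) + 2 := by omega
      linarith
    linarith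
  · simp only [Bool.false_eq_true, if_false]
    obtain ⟨d, hd⟩ := Nat.exists_eq_add_of_le hle
    -- In the last iteration `L'` need not be shorter than `L`, so only the general bound on its
    -- length applies; this is the source of the term `m^3 n` in `lastTime`.
    have h2 : 80 * (m + 1) * L'.length ≤ 80 * (m + 1) * (4 * (m + 1) ^ 2 * (n + 1)) :=
      Nat.mul_le_mul_left _ hlen
    have h3 : innerTime m n * d ≤ outerTime m n * d := by
      refine Nat.mul_le_mul_right _ ?_
      unfold outerTime
      linarith [Nat.zero_le (innerTime m n), Nat.zero_le ((m + 1) ^ 4),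
        Nat.zero_le ((m + 1) * (n + 1))]
    have h4 : lastTime m n = 3 * innerTime m n + 2000000 * (m + 1) ^ 4 +
        120 * (m + 1) * (n + 1) + 400 * (m + 1) ^ 3 * (n + 1) := by
      unfold lastTime outerTime; ring
    rw [hd] at ht₁ ⊢
    have h5 : (m + 1) ^ 2 * (n + 1) ≤ (m + 1) ^ 3 * (n + 1) :=
      Nat.mul_le_mul_right _ (Nat.pow_le_pow_right (by omega) (by norm_num))
    have h8 : t₃ + t₄ + 30 * (m + 1) * (n + 1) + 2 ≤
        120 * (m + 1) * (n + 1) + 8 * ((m + 1) ^ 3 * (n + 1)) := by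
      have : t₃ + t₄ + 2 ≤ (n + 1) + 4 * (m + 1) ^ 2 * (n + 1) + 3 := by omega
      linarith
    linarith [Nat.zero_le (innerTime m n), Nat.zero_le ((m + 1) ^ 3 * (n + 1))]

/-- At the start `L` is empty, so the comparison with the regeneration of `Y` holds trivially.
Afterwards the time telescopes over the marked targets, of which there are at most `m`. -/
theorem runs_outer {I : Network m n} (hRs : 0 ≤ I.Rs) (hRt : 0 < I.Rt) {X : List (Ref m)}
    (hX : X.length ≤ 2 * (m + 1) ^ 2) (hgood : ∀ r ∈ X, r.Good I) :
    Runs (whileT (unfinished I) (outerBody I X) ⟨[], [], fun _ => false, true⟩) (fun s t =>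
      s.L.length ≤ n ∧ t ≤ outerTime m n * (m + 2) + lastTime m n) := by
  have hO : 30 * (m + 1) * (n + 1) + 1 ≤ outerTime m n := by
    unfold outerTime
    have hM : 1 ≤ (m + 1) * (n + 1) := Nat.mul_pos (by omega) (by omega)
    linarith [Nat.zero_le (innerTime m n), Nat.zero_le ((m + 1) ^ 4)]
  have hb : ∀ (s : State m) (t : ℕ), t ≤ outerTime m n * marked s.chosen +
      (if s.go then 0 else lastTime m n) → t ≤ outerTime m n * m + lastTime m n := by
    intro s t h
    refine h.trans (Nat.add_le_add (Nat.mul_le_mul_left _ (marked_le _)) ?_)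
    split <;> omega
  refine runs_whileT (fun s t => s.Valid I ∧
    (s.go = true → s.L.length ≤ (regenerate I s.Y).val.length) ∧
    t ≤ outerTime m n * marked s.chosen + if s.go then 0 else lastTime m n)
    (outerTime m n * m + lastTime m n) (fun s t h => hb s t h.2.2) ?_
    ⟨⟨by simp, by simp, by simp, by simp, by simp⟩, by simp, by simp⟩
  rintro s t ⟨hv, hreg, ht⟩
  refine (runs_unfinished I hv.length).mono ?_
  rintro b t₁ ⟨hgo, ht₁⟩
  refine ⟨fun hbt => ?_, fun _ => ⟨hv.length, ?_⟩⟩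
  · refine (runs_outerBody hRs hRt hX hgood hv (hreg (hgo hbt))).mono ?_
    rintro s' t₂ ⟨hv', -, hgo', ht₂⟩
    refine ⟨hv', fun h => (hgo' h).2, ?_⟩
    rw [hgo hbt, if_pos rfl, add_zero] at ht
    omega
  · have := hb s t ht
    linarith [Nat.zero_le (outerTime m n)]

theorem runs_deploymentOrders (I : Network m n) {L : List Pt} (hL : L.length ≤ n) :
    Runs (deploymentOrders I L) (fun _ t => t ≤ 300 * (n + 1) ^ 3) := by
  simp only [deploymentOrders, runs_bind]
  refine runs_lenT fun t₁ ht₁ => runs_toArr fun t₂ ht₂ => runs_alloc fun t₃ ht₃ => ?_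
  refine runs_forT (9 * n + 2) (fun _ _ => True) ?_ trivial ?_
  · rintro i l a -
    simp only [runs_bind, runs_rd]
    refine runs_forT 8 (fun _ _ => True) ?_ trivial ?_
    · rintro j l a -
      simp only [runs_bind, runs_rd, runs_distT, runs_wr]
      norm_num
    · rintro a t - ht
      rw [List.length_range] at ht
      exact ⟨trivial, by omega⟩
  rintro a t₄ - ht₄
  refine (runs_hungarian n a).mono ?_
  intro row t₅ ht₅
  refine runs_forT 3 (fun _ _ => True) ?_ trivial ?_
  · rintro j l D -
    simp only [runs_bind, runs_rd, runs_push]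
    norm_num
  rintro D t₆ - ht₆
  rw [List.length_range] at ht₆
  rw [List.length_finRange] at ht₄
  have h1 : (n + 1) * (n + 1) ≤ (n + 1) ^ 3 := by
    rw [← sq]
    exact Nat.pow_le_pow_right (by omega) (by norm_num)
  have h2 : n * (9 * n + 2 + 1) ≤ 9 * ((n + 1) * (n + 1)) := by nlinarith
  have h3 : n + 1 ≤ (n + 1) * (n + 1) := Nat.le_mul_of_pos_left _ (by omega)
  linarith

theorem runs_stba {I : Network m n} (hRs : 0 ≤ I.Rs) (hRt : 0 < I.Rt) :
    Runs (stba I) (fun _ t => t ≤ outerTime m n * (m + 2) + lastTime m n + 300 * (m + 1) ^ 3 +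
      300 * (n + 1) ^ 3) := by
  simp only [stba, runs_bind]
  refine (runs_references I).mono ?_
  rintro X t₁ ⟨hX, hgood, ht₁⟩
  refine runs_alloc fun t₂ ht₂ => ?_
  refine (runs_outer hRs hRt hX hgood).mono ?_
  rintro s t₃ ⟨hL, ht₃⟩
  refine (runs_deploymentOrders I hL).mono ?_
  intro _ t₄ ht₄
  have : m + 1 ≤ (m + 1) ^ 3 := Nat.le_self_pow (by norm_num) _
  linarith

/-! ### The final estimate -/

theorem time_bound_le (hmn : 0 < m + n) :
    outerTime m n * (m + 2) + lastTime m n + 300 * (m + 1) ^ 3 + 300 * (n + 1) ^ 3 ≤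
      1000000000 * (m ^ 5 + n ^ 3) := by
  -- For `m = 0` the left side is `1`, which `n ^ 3` absorbs because `m + n > 0`; the next estimate
  -- is symmetric.
  have h1 : (m + 1) ^ 5 ≤ 32 * (m ^ 5 + n ^ 3) := by
    rcases Nat.eq_zero_or_pos m with rfl | hm
    · have : 1 ≤ n ^ 3 := Nat.one_le_pow _ _ (by omega)
      norm_num
      omega
    · have : (m + 1) ^ 5 ≤ (2 * m) ^ 5 := Nat.pow_le_pow_left (by omega) 5
      rw [mul_pow] at this
      omega
  have h2 : (n + 1) ^ 3 ≤ 8 * (m ^ 5 + n ^ 3) := by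
    rcases Nat.eq_zero_or_pos n with rfl | hn
    · have : 1 ≤ m ^ 5 := Nat.one_le_pow _ _ (by omega)
      norm_num
      omega
    · have : (n + 1) ^ 3 ≤ (2 * n) ^ 3 := Nat.pow_le_pow_left (by omega) 3
      rw [mul_pow] at this
      omega
  -- The two estimates lose a factor of at most `32 + 8 = 40`, so `1000000000` leaves ample room.
  refine le_trans ?_ (show 10000000 * ((m + 1) ^ 5 + (n + 1) ^ 3) ≤ _ by omega)
  -- The mixed term: if `n + 1 ≤ (m + 1) ^ 2`, the fifth power absorbs it; otherwise `(m + 1) ^ 2`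
  -- and `m + 1` are both at most `n + 1`, and the cube does.
  have h3 : (m + 1) ^ 3 * (n + 1) ≤ (m + 1) ^ 5 + (n + 1) ^ 3 := by
    rcases le_total (n + 1) ((m + 1) ^ 2) with h | h
    · refine le_trans (Nat.mul_le_mul_left _ h) ?_
      rw [← pow_add]
      exact Nat.le_add_right _ _
    · have h4 : m + 1 ≤ (m + 1) ^ 2 := Nat.le_self_pow (by norm_num) _
      have h5 := Nat.mul_le_mul_right (n + 1) (Nat.mul_le_mul h (h4.trans h))
      have e1 : (m + 1) ^ 2 * (m + 1) * (n + 1) = (m + 1) ^ 3 * (n + 1) := by ring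
      have e2 : (n + 1) * (n + 1) * (n + 1) = (n + 1) ^ 3 := by ring
      omega
  unfold lastTime outerTime innerTime
  obtain ⟨M, hM⟩ : ∃ M, M = m + 1 := ⟨_, rfl⟩
  obtain ⟨N, hN⟩ : ∃ N, N = n + 1 := ⟨_, rfl⟩
  have hM1 : 1 ≤ M := by omega
  rw [show m + 2 = M + 1 by omega]
  clear h1 h2 hmn
  rw [← hM, ← hN] at h3 ⊢
  have p1 : M * N ≤ M ^ 3 * N := Nat.mul_le_mul_right _ (Nat.le_self_pow (by norm_num) M)
  have p2 : M ^ 2 * N ≤ M ^ 3 * N :=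
    Nat.mul_le_mul_right _ (Nat.pow_le_pow_right hM1 (by norm_num))
  have p3 : M ^ 3 ≤ M ^ 5 := Nat.pow_le_pow_right hM1 (by norm_num)
  have p4 : M ^ 4 ≤ M ^ 5 := Nat.pow_le_pow_right hM1 (by norm_num)
  ring_nf at *
  linarith [Nat.zero_le (N ^ 3), Nat.zero_le (M ^ 5)]

end STBA

theorem theorem4 :
    ∃ C : ℕ, ∀ (m n : ℕ) (I : STBA.Network m n), 0 ≤ I.Rs → 0 < I.Rt → 0 < m + n →
      (STBA.stba I).time ≤ ((C * (m ^ 5 + n ^ 3) : ℕ) : ℕ∞) := by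
  refine ⟨1000000000, fun m n I hRs hRt hmn => ?_⟩
  obtain ⟨t, ht, hle⟩ := STBA.runs_stba hRs hRt
  rw [ht]
  exact_mod_cast hle.trans (STBA.time_bound_le hmn)
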